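/- **Lemma (Implicit form).** *The clock.* Let $d\in\mathbb N$, $T_0>0$, $\sigma\in(0,d)$, $n_0\in(0,d-1)$, $k_0\in\mathbb R$. Let $\mathcal H_c=\mathbb C^d$ with orthonormal (energy) basis $|E_0\rangle,\dots,|E_{d-1}\rangle$ and clock Hamiltonian $\hat H_c=\sum_{n=0}^{d-1}\frac{2\pi n}{T_0}|E_n\rangle\langle E_n|$. For $k\in\mathbb Z$ put $|\theta_k\rangle=\frac1{\sqrt d}\sum_{n=0}^{d-1}e^{-2\pi i nk/d}|E_n\rangle$, and for $y\in\mathbb R$ put $\mathcal S_d(y)=\{k\in\mathbb Z:\ -\frac d2\le y-k<\frac d2\}$. The normalised Gaussian clock state is $$|\Psi_{\rm nor}(k_0)\rangle=\sum_{k\in\mathcal S_d(k_0)}\psi_{\rm nor}(k_0;k)\,|\theta_k\rangle,\qquad \psi_{\rm nor}(k_0;x)=A\,e^{-\frac{\pi}{\sigma^2}(x-k_0)^2}e^{i2\pi n_0(x-k_0)/d},\qquad A=\Big(\sum_{k\in\mathcal S_d(k_0)}e^{-\frac{2\pi}{\sigma^2}(k-k_0)^2}\Big)^{-1/2}.$$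 *The potential.* Let $V_0:\mathbb R\to\mathbb R$ be smooth and $2\pi$-periodic with $\int_0^{2\pi}V_0(x)\,dx=1$, let $V_d(x)=\frac{2\pi}dV_0\big(\frac{2\pi x}d\big)$ and $\hat V_d=\frac d{T_0}\sum_{k=0}^{d-1}V_d(k)|\theta_k\rangle\langle\theta_k|$. *The system.* Let $\hat H_s$ and $\hat H_s^{int}$ be commuting Hermitian operators on a Hilbert space $\mathcal H_s$ of finite dimension $d_s$, where the eigenvalues of $\hat H_s^{int}$ lie in $[-\pi,\pi)$ and $U_s=e^{-i\hat H_s^{int}}$ is the energy-preserving unitary to be implemented, $[U_s,\hat H_s]=0$. For a density operator $\rho_s(0)$ on $\mathcal H_s$ let $$\hat H_{sc}=\hat H_s\otimes 1+1\otimes\hat H_c+\hat H_s^{int}\otimes\hat V_d,\qquad \rho_s'(t)=\mathrm{tr}_c\Big[e^{-it\hat H_{sc}}\big(\rho_s(0)\otimes|\Psi_{\rm nor}(k_0)\rangle\langle\Psi_{\rm nor}(k_0)|\big)e^{it\hat H_{sc}}\Big],$$ and let $\rho_s(t)$ be the state evolved from $\rho_s(0)$ by the time-dependent Hamiltonian $\hat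 H_s+g(t)\hat H_s^{int}$ with the pulse $g(x)=\frac{2\pi}{T_0}V_0\big(\frac{2\pi x}{T_0}\big)$, that is, $$\rho_s(t)=e^{-it\hat H_s}\,e^{-i\hat H_s^{int}\int_0^tg(x)dx}\,\rho_s(0)\,e^{i\hat H_s^{int}\int_0^tg(x)dx}\,e^{it\hat H_s}.$$ *Claim.* For all density operators $\rho_s(0)$ on $\mathcal H_s$ and all $t\in[0,T_0]$, $$\|\rho_s(t)-\rho_s'(t)\|_1\le\sqrt{d_s\,\mathrm{tr}[\rho_s(0)^2]}\,\Big(2\varepsilon_v(t,d)+\varepsilon_v(t,d)^2+\epsilon_V(t,d)\Big),$$ where $\|\cdot\|_1$ is the trace norm (sum of the singular values) and the error terms are as follows. (1) With $\epsilon_k=2\pi\Big|\int_0^{2\pi t/T_0}\big(V_0(x)-V_0(x+2\pi k/d)\big)dx\Big|$ for $k\in\mathbb R$, $$\epsilon_V(t,d)=\max_{\bar\kappa\in[0,1]}\ \sum_{k=k_0-d/2+\bar\kappa}^{k_0+d/2+\bar\kappa}(\epsilon_k^2+\epsilon_k)\,|\psi_{\rm nor}(k_0;k)|^2,$$ where $k$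 runs in unit steps through $d+1$ real values. (2) $$\varepsilon_v(t,d)=|t|\frac d{T_0}\,\varepsilon_T+\Big(|t|\frac d{T_0}+1\Big)\varepsilon_{step}+\varepsilon_{nor}(t),\qquad \varepsilon_{step}=2A\,e^{-\frac{\pi d^2}{4\sigma^2}},$$ $$\varepsilon_{nor}(t)=\left|\sqrt{\frac{\sum_{k\in\mathcal S_d(k_0+td/T_0)}e^{-\frac{2\pi}{\sigma^2}(k-k_0-td/T_0)^2}}{\sum_{k\in\mathcal S_d(k_0)}e^{-\frac{2\pi}{\sigma^2}(k-k_0)^2}}}-1\right|,$$ $$\varepsilon_T=\varepsilon_2+2A\left(\frac{2\pi}{1-e^{-\pi d/\sigma^2}}+\frac{b+2\pi/d}{1-e^{-\pi d^2/\sigma^2}}+\frac{2\pi d}{\sigma^2}+\frac{\pi d^2}{\sigma^2}+\frac1d\right)e^{-\frac\pi4\frac{d^2}{\sigma^2}}.$$ Here $b$ is any real number with $$b\ \ge\ \sup_{k\in\mathbb N^+}\Big(2\max_{x\in[0,2\pi]}\big|\pi V_0^{(k-1)}(x)\big|\Big)^{1/k}$$ (in particular this supremum is assumed finite), and with $$\alpha_0=\frac2{d-1}\min\{n_0,\,(d-1)-n_0\},\quad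 \kappa=0.792,\quad \bar\upsilon=\frac{\pi\alpha_0\kappa\,b}{\ln(\pi\alpha_0^2\sigma^2/2)},\quad \mathcal N=\left\lfloor\frac{\pi\alpha_0^2}{2(\bar\upsilon+d/\sigma^2)^2}\Big(\frac d\sigma\Big)^2\right\rfloor,$$ if $\mathcal N\ge8$ and $\bar\upsilon\ge0$, $$\varepsilon_2=(2\pi)^{5/4}\sigma^{3/2}A\Big(1+\frac{\pi^2}8\Big)\sqrt{\frac e2\,\frac{\alpha_0}{\bar\upsilon\sigma^2/d+1}}\ \exp\Big(-\frac\pi4\frac{\alpha_0^2}{(d/\sigma^2+\bar\upsilon)^2}\Big(\frac d\sigma\Big)^2\Big),$$ and otherwise (in particular when $\pi\alpha_0^2\sigma^2=2$, where $\bar\upsilon$ is undefined) $$\varepsilon_2=\frac{3^{7/4}}{\sqrt{2\pi}\,e}\ \frac{A(8+\pi^2)}{\alpha_0^3}\Big(\frac{\kappa\sqrt{6\pi}}{\ln3}\,b+\frac d\sigma\Big)^3\frac{\sigma}{d^3}.$$ -/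

import Mathlib

open scoped Matrix Kronecker ContDiff ComplexOrder

noncomputable section

namespace GaussianClock

/-! ### The finite clock -/

/-- The set `S_d(k₀)` of the `d` integers closest to `k₀`. -/
def window (d : ℕ) (k₀ : ℝ) : Finset ℤ :=
  Finset.Ioc ⌊k₀ - d / 2⌋ ⌊k₀ + d / 2⌋

theorem mem_window {d : ℕ} {k₀ : ℝ} {k : ℤ} :
    k ∈ window d k₀ ↔ -((d : ℝ) / 2) ≤ k₀ - k ∧ k₀ - k < (d : ℝ) / 2 := by
  rw [window, Finset.mem_Ioc, Int.floor_lt, Int.le_floor]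
  constructor <;> rintro ⟨h₁, h₂⟩ <;> constructor <;> linarith

/-- The normalisation constant `A(σ; k₀)` of the Gaussian clock state. -/
def normConst (d : ℕ) (σ k₀ : ℝ) : ℝ :=
  1 / √(∑ k ∈ window d k₀, Real.exp (-(2 * Real.pi / σ ^ 2) * ((k : ℝ) - k₀) ^ 2))

/-- The normalised Gaussian wave function
`ψ_nor(k₀; x) = A exp(-π (x - k₀)² / σ²) exp(2πi n₀ (x - k₀) / d)`. -/
def psiNor (d : ℕ) (σ n₀ k₀ x : ℝ) : ℂ :=
  (normConst d σ k₀ : ℂ) * (Real.exp (-(Real.pi / σ ^ 2) * (x - k₀) ^ 2) : ℂ) *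
    Complex.exp (Complex.I * ((2 * Real.pi * n₀ * (x - k₀) / d : ℝ) : ℂ))

/-- The time state `θ_k = d^{-1/2} ∑ₙ exp(-2πi n k / d) Eₙ`, for all integers `k`, written in the
energy basis `(Eₙ)`, which is the standard basis of `Fin d → ℂ`. -/
def timeState (d : ℕ) (k : ℤ) : Fin d → ℂ := fun n =>
  ((1 / √(d : ℝ) : ℝ) : ℂ) *
    Complex.exp (-(Complex.I * ((2 * Real.pi * (n : ℝ) * (k : ℝ) / d : ℝ) : ℂ)))

/-- The normalised Gaussian clock state `Ψ_nor(k₀) = ∑_{k ∈ S_d(k₀)} ψ_nor(k₀; k) θ_k`. -/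
def clockState (d : ℕ) (σ n₀ k₀ : ℝ) : Fin d → ℂ :=
  ∑ k ∈ window d k₀, psiNor d σ n₀ k₀ k • timeState d k

/-- The clock Hamiltonian `H_c = ∑ₙ n ω |Eₙ⟩⟨Eₙ|` with `ω = 2π / T₀`. -/
def clockHam (d : ℕ) (T₀ : ℝ) : Matrix (Fin d) (Fin d) ℂ :=
  Matrix.diagonal fun n => (((n : ℝ) * (2 * Real.pi / T₀) : ℝ) : ℂ)

/-- The stretched potential `V_d(x) = (2π / d) V₀(2π x / d)`. -/
def stretchedPot (d : ℕ) (V₀ : ℝ → ℝ) (x : ℝ) : ℝ :=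
  2 * Real.pi / d * V₀ (2 * Real.pi * x / d)

/-- The interaction potential `V̂_d = (d / T₀) ∑ₖ V_d(k) |θ_k⟩⟨θ_k|`. -/
def potOp (d : ℕ) (T₀ : ℝ) (V₀ : ℝ → ℝ) : Matrix (Fin d) (Fin d) ℂ :=
  ∑ k ∈ Finset.range d, (((d : ℝ) / T₀ * stretchedPot d V₀ k : ℝ) : ℂ) •
    Matrix.vecMulVec (timeState d k) (star (timeState d k))

/-! ### System, clock and their dynamics -/

/-- `ρ` is a density matrix. -/
def IsState {n : ℕ} (ρ : Matrix (Fin n) (Fin n) ℂ) : Prop :=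
  ρ.PosSemidef ∧ ρ.trace = 1

/-- The trace norm: the sum of the singular values, i.e. `tr √(Mᴴ M)`. -/
def traceNorm {n : ℕ} (M : Matrix (Fin n) (Fin n) ℂ) : ℝ :=
  ∑ i, √((Matrix.isHermitian_conjTranspose_mul_self M).eigenvalues i)

/-- The partial trace over the second tensor factor. -/
def partialTraceClock {n d : ℕ} (M : Matrix (Fin n × Fin d) (Fin n × Fin d) ℂ) :
    Matrix (Fin n) (Fin n) ℂ :=
  Matrix.of fun i j => ∑ k, M (i, k) (j, k)

/-- The total Hamiltonian `H_s ⊗ 1 + 1 ⊗ H_c + H_s^int ⊗ V̂_d`. -/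
def totalHam {n : ℕ} (d : ℕ) (T₀ : ℝ) (V₀ : ℝ → ℝ) (Hs Hint : Matrix (Fin n) (Fin n) ℂ) :
    Matrix (Fin n × Fin d) (Fin n × Fin d) ℂ :=
  Hs ⊗ₖ (1 : Matrix (Fin d) (Fin d) ℂ) + (1 : Matrix (Fin n) (Fin n) ℂ) ⊗ₖ clockHam d T₀ +
    Hint ⊗ₖ potOp d T₀ V₀

/-- The state `ρ_sc'(t) = e^{-itH} (ρ ⊗ |Ψ_nor(k₀)⟩⟨Ψ_nor(k₀)|) e^{itH}`, with `H` the total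
Hamiltonian. -/
def jointState {n : ℕ} (d : ℕ) (σ n₀ k₀ T₀ : ℝ) (V₀ : ℝ → ℝ)
    (Hs Hint ρ : Matrix (Fin n) (Fin n) ℂ) (t : ℝ) :
    Matrix (Fin n × Fin d) (Fin n × Fin d) ℂ :=
  NormedSpace.exp (-(Complex.I * (t : ℂ)) • totalHam d T₀ V₀ Hs Hint) *
    (ρ ⊗ₖ Matrix.vecMulVec (clockState d σ n₀ k₀) (star (clockState d σ n₀ k₀))) *
    NormedSpace.exp ((Complex.I * (t : ℂ)) • totalHam d T₀ V₀ Hs Hint)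

/-- The system state `ρ_s'(t) = tr_c ρ_sc'(t)` under control by the clock. -/
def clockControlled {n : ℕ} (d : ℕ) (σ n₀ k₀ T₀ : ℝ) (V₀ : ℝ → ℝ)
    (Hs Hint ρ : Matrix (Fin n) (Fin n) ℂ) (t : ℝ) : Matrix (Fin n) (Fin n) ℂ :=
  partialTraceClock (jointState d σ n₀ k₀ T₀ V₀ Hs Hint ρ t)

/-- The pulse `g(x) = (2π / T₀) V₀(2π x / T₀)` of the time dependent Hamiltonian
`H_s + g(t) H_s^int`. -/
def pulse (T₀ : ℝ) (V₀ : ℝ → ℝ) (x : ℝ) : ℝ :=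
  2 * Real.pi / T₀ * V₀ (x * (2 * Real.pi) / T₀)

/-- The system state `ρ_s(t)` at time `t`, evolved from `ρ` at time `0` by the time dependent
Hamiltonian `H_s + g(t) H_s^int` (with commuting `H_s`, `H_s^int`). -/
def pulseControlled {n : ℕ} (T₀ : ℝ) (V₀ : ℝ → ℝ) (Hs Hint ρ : Matrix (Fin n) (Fin n) ℂ)
    (t : ℝ) : Matrix (Fin n) (Fin n) ℂ :=
  NormedSpace.exp (-(Complex.I * (t : ℂ)) • Hs) *
    NormedSpace.exp (-(Complex.I * ((∫ x in (0 : ℝ)..t, pulse T₀ V₀ x : ℝ) : ℂ)) • Hint) * ρ *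
    NormedSpace.exp ((Complex.I * ((∫ x in (0 : ℝ)..t, pulse T₀ V₀ x : ℝ) : ℂ)) • Hint) *
    NormedSpace.exp ((Complex.I * (t : ℂ)) • Hs)

/-! ### The error terms -/

/-- The distance `α₀ = (2 / (d - 1)) min {n₀, (d - 1) - n₀}` of the mean energy from the edge of
the spectrum. -/
def alpha (d : ℕ) (n₀ : ℝ) : ℝ :=
  2 / ((d : ℝ) - 1) * min n₀ ((d : ℝ) - 1 - n₀)

/-- The constant `κ = 0.792`. -/
def kappa : ℝ := 792 / 1000

/-- `b ≥ sup_{k ≥ 1} (2 max_{[0,2π]} |V^{(k-1)}|)^{1/k}`; here `p = k - 1`. -/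
def IsDerivBound (V : ℝ → ℝ) (b : ℝ) : Prop :=
  ∀ p : ℕ, ∀ x ∈ Set.Icc (0 : ℝ) (2 * Real.pi),
    (2 * |iteratedDeriv p V x|) ^ ((1 : ℝ) / ((p : ℝ) + 1)) ≤ b

/-- The rate parameter `ῡ = π α₀ κ b / ln(π α₀² σ² / 2)`. -/
def rate (d : ℕ) (σ n₀ b : ℝ) : ℝ :=
  Real.pi * alpha d n₀ * kappa * b / Real.log (Real.pi * alpha d n₀ ^ 2 * σ ^ 2 / 2)

/-- The decay parameter `𝒩 = ⌊π α₀² / (2 (ῡ + d/σ²)²) · (d/σ)²⌋`. -/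
def decayN (d : ℕ) (σ n₀ b : ℝ) : ℤ :=
  ⌊Real.pi * alpha d n₀ ^ 2 / (2 * (rate d σ n₀ b + d / σ ^ 2) ^ 2) * (d / σ) ^ 2⌋

open Classical in
/-- The bound on `|ε̄₂|`. -/
def epsTwo (d : ℕ) (σ n₀ k₀ b : ℝ) : ℝ :=
  if 8 ≤ decayN d σ n₀ b ∧ 0 ≤ rate d σ n₀ b then
    (2 * Real.pi) ^ ((5 : ℝ) / 4) * σ ^ ((3 : ℝ) / 2) * normConst d σ k₀ *
      (1 + Real.pi ^ 2 / 8) *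
      √(Real.exp 1 / 2 * (alpha d n₀ / (rate d σ n₀ b * σ ^ 2 / d + 1))) *
      Real.exp (-(Real.pi / 4) * (alpha d n₀ ^ 2 / (d / σ ^ 2 + rate d σ n₀ b) ^ 2) *
        (d / σ) ^ 2)
  else
    (3 : ℝ) ^ ((7 : ℝ) / 4) / (√(2 * Real.pi) * Real.exp 1) *
      (normConst d σ k₀ * (8 + Real.pi ^ 2) / alpha d n₀ ^ 3) *
      (kappa * √(6 * Real.pi) / Real.log 3 * b + d / σ) ^ 3 * (σ / (d : ℝ) ^ 3)

/-- The bound on the translation error `ε_T`. -/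
def epsT (d : ℕ) (σ n₀ k₀ b : ℝ) : ℝ :=
  epsTwo d σ n₀ k₀ b + 2 * normConst d σ k₀ *
    (2 * Real.pi / (1 - Real.exp (-(Real.pi * d / σ ^ 2))) +
      (b + 2 * Real.pi / d) / (1 - Real.exp (-(Real.pi * (d : ℝ) ^ 2 / σ ^ 2))) +
      (2 * Real.pi * (d / σ ^ 2) + Real.pi * ((d : ℝ) ^ 2 / σ ^ 2) + 1 / d)) *
    Real.exp (-(Real.pi / 4) * ((d : ℝ) ^ 2 / σ ^ 2))

/-- The bound `2 A exp(-π d² / (4 σ²))` on the step error. -/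
def epsStep (d : ℕ) (σ k₀ : ℝ) : ℝ :=
  2 * normConst d σ k₀ * Real.exp (-(Real.pi * (d : ℝ) ^ 2 / (4 * σ ^ 2)))

/-- The normalisation error `ε_nor(t) = |A(σ; k₀) / A(σ; k₀ + t d / T₀) - 1|`. -/
def epsNor (d : ℕ) (σ k₀ T₀ t : ℝ) : ℝ :=
  |√((∑ k ∈ window d (k₀ + d / T₀ * t),
        Real.exp (-(2 * Real.pi / σ ^ 2) * ((k : ℝ) - k₀ - d / T₀ * t) ^ 2)) /
      ∑ k ∈ window d k₀, Real.exp (-(2 * Real.pi / σ ^ 2) * ((k : ℝ) - k₀) ^ 2)) - 1|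

/-- The clock error
`ε_v(t, d) = |t| (d/T₀) ε_T + (|t| (d/T₀) + 1) ε_step + ε_nor(t)`. -/
def epsv (d : ℕ) (σ n₀ k₀ T₀ b t : ℝ) : ℝ :=
  |t| * (d / T₀) * epsT d σ n₀ k₀ b + (|t| * (d / T₀) + 1) * epsStep d σ k₀ +
    epsNor d σ k₀ T₀ t

/-- `ε_k = 2π |∫₀^{2πt/T₀} (V₀(x) - V₀(x + 2πk/d)) dx|`, for real `k`. -/
def epsK (d : ℕ) (T₀ : ℝ) (V₀ : ℝ → ℝ) (t k : ℝ) : ℝ :=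
  2 * Real.pi *
    |∫ x in (0 : ℝ)..(t * (2 * Real.pi) / T₀), (V₀ x - V₀ (x + 2 * Real.pi * k / d))|

/-- `ε_V(t, d) = max_{κ̄ ∈ [0,1]} ∑_k (ε_k² + ε_k) |ψ_nor(k₀; k)|²`, where `k` runs in unit steps
from `k₀ - d/2 + κ̄` to `k₀ + d/2 + κ̄`. The maximum exists, the sum being continuous in `κ̄`. -/
def epsV (d : ℕ) (σ n₀ k₀ T₀ : ℝ) (V₀ : ℝ → ℝ) (t : ℝ) : ℝ :=
  sSup ((fun κ : ℝ => ∑ j ∈ Finset.range (d + 1),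
    (epsK d T₀ V₀ t (k₀ - d / 2 + κ + j) ^ 2 + epsK d T₀ V₀ t (k₀ - d / 2 + κ + j)) *
      ‖psiNor d σ n₀ k₀ (k₀ - d / 2 + κ + j)‖ ^ 2) '' Set.Icc (0 : ℝ) 1)

end GaussianClock

end

/-! Diagonalise the interaction. In the eigenspace of `Hint` with eigenvalue `Ω` the clock evolves
on its own under `H_c + Ω V̂_d` (`sectorHam`), and `e^{-itH_s}` splits off by commutation. In this
frame both system states are entrywise products with one matrix, the initial state in the
eigenbasis: the pulse multiplies the entry `(i, j)` by `exp(-i (Ω_i - Ω_j) ∫ g)`, the clock by the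
overlap of its states in the sectors `j` and `i` (`pulseControlled_eq`, `clockControlled_eq`). A
uniform bound on phase minus overlap therefore controls the Hilbert–Schmidt norm, and Cauchy–Schwarz
passes to the trace norm (`traceNorm_conj_le`).

The overlaps are read off an ideal clock state: the Gaussian translated by `Δ = t d / T₀`, carrying
at position `x` the phase `-Ω ∫ V₀` over the stretch from `x - Δ` to `x`. Its overlaps are Gaussian
averages of almost correct phases, which produces `ε_V` and the normalisation error
(`norm_phase_sub_overlap_le`).

The true state stays close to the ideal one because the latter almost solves the Schrödinger
equation. In the energy component `n`, the operator `d/dΔ + i (T₀/d) H` acts on each summand as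
`-d/dx`, so the defect is a lattice sum of the derivative of a Gaussian wave packet of frequency `ν
= (n₀ - n)/d` (`schroedinger_defect`). The integral of a derivative vanishes, so by Poisson
summation only the Fourier modes `m ≠ 0` contribute to the sum over `ℤ`, and there `|ν - m| ≥ α₀/2`.
The derivative bounds extend the phase to an entire function whose imaginary part at height `η` is
at most `e^{Bη} - 1`, with `B = 2πb/d`; shifting the contour by `η` then gains `e^{-2π|ν-m|η}`
(`norm_integral_modGauss_le`). The choice of `η` gives `ε₂` (`exists_alias_add_tail_le`), the points
outside the window give Gaussian tails, and both together give `ε_T` (`norm_defect_le`). Unitarity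
integrates the defect over `Δ`, and every slide of the window by one site costs `ε_step`
(`norm_evolved_sub_idealState_le`). -/

namespace GaussianClock

open Filter Topology MeasureTheory Complex

/-! ### Entire extensions of functions with geometrically bounded derivatives -/

/-- The Taylor series of `θ` at `x₀`, summed on the complex plane. -/
noncomputable def taylorSum (θ : ℝ → ℝ) (x₀ : ℝ) (z : ℂ) : ℂ :=
  ∑' k : ℕ, ((iteratedDeriv k θ x₀ : ℝ) : ℂ) * (z - x₀) ^ k / (k.factorial : ℂ)

section
variable {θ : ℝ → ℝ} {B : ℝ}

/-- The factor `1 + |θ x₀|` covers the coefficient of order zero, on which the derivative bounds say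
nothing. -/
theorem norm_taylorSum_term_le (hB : 0 ≤ B) (hb : ∀ k x, |iteratedDeriv (k + 1) θ x| ≤ B ^ (k + 1))
    (x₀ : ℝ) (k : ℕ) {z : ℂ} {R : ℝ} (hz : ‖z - x₀‖ ≤ R) :
    ‖((iteratedDeriv k θ x₀ : ℝ) : ℂ) * (z - x₀) ^ k / (k.factorial : ℂ)‖ ≤
      (1 + |θ x₀|) * ((B * R) ^ k / k.factorial) := by
  have hR : 0 ≤ R := (norm_nonneg _).trans hz
  rw [norm_div, norm_mul, norm_pow, Complex.norm_real, Complex.norm_natCast, Real.norm_eq_abs,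
    ← mul_div_assoc, mul_pow]
  have h1 : |iteratedDeriv k θ x₀| ≤ (1 + |θ x₀|) * B ^ k := by
    rcases k with _ | k
    · simp
    · refine (hb k x₀).trans (le_mul_of_one_le_left (by positivity) ?_)
      linarith [abs_nonneg (θ x₀)]
  rw [← mul_assoc]
  gcongr

theorem summable_taylorSum (hB : 0 ≤ B) (hb : ∀ k x, |iteratedDeriv (k + 1) θ x| ≤ B ^ (k + 1))
    (x₀ : ℝ) (z : ℂ) :
    Summable fun k : ℕ =>
      ((iteratedDeriv k θ x₀ : ℝ) : ℂ) * (z - x₀) ^ k / (k.factorial : ℂ) :=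
  Summable.of_norm_bounded ((Real.summable_pow_div_factorial (B * ‖z - x₀‖)).mul_left _)
    fun k => norm_taylorSum_term_le hB hb x₀ k le_rfl

theorem differentiable_taylorSum (hB : 0 ≤ B)
    (hb : ∀ k x, |iteratedDeriv (k + 1) θ x| ≤ B ^ (k + 1)) (x₀ : ℝ) :
    Differentiable ℂ (taylorSum θ x₀) := by
  intro z
  have h := differentiableOn_tsum_of_summable_norm (U := Metric.ball (x₀ : ℂ) (‖z - x₀‖ + 1))
    (F := fun (k : ℕ) (z : ℂ) =>
      ((iteratedDeriv k θ x₀ : ℝ) : ℂ) * (z - x₀) ^ k / (k.factorial : ℂ))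
    ((Real.summable_pow_div_factorial (B * (‖z - x₀‖ + 1))).mul_left (1 + |θ x₀|))
    (fun k => by fun_prop) Metric.isOpen_ball
    (fun k w hw => norm_taylorSum_term_le hB hb x₀ k
      (by rw [Metric.mem_ball, dist_eq_norm] at hw; exact hw.le))
  exact h.differentiableAt (Metric.isOpen_ball.mem_nhds
    (by rw [Metric.mem_ball, dist_eq_norm]; linarith))

/-- The Lagrange remainder of order `n + 1` is at most `(B |x - x₀|)^(n+1) / (n+1)!`, which tends to
zero. -/
theorem taylorSum_ofReal (hB : 0 ≤ B) (hθ : ContDiff ℝ ∞ θ)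
    (hb : ∀ k x, |iteratedDeriv (k + 1) θ x| ≤ B ^ (k + 1)) (x₀ x : ℝ) :
    taylorSum θ x₀ x = θ x := by
  have hs := (summable_taylorSum hB hb x₀ x).hasSum
  have h1 := hs.tendsto_sum_nat.comp (tendsto_add_atTop_nat 1)
  refine tendsto_nhds_unique h1 ?_
  rw [tendsto_iff_norm_sub_tendsto_zero]
  have h0 := (FloorSemiring.tendsto_pow_div_factorial_atTop (B * |x - x₀|)).comp
    (tendsto_add_atTop_nat 1)
  refine squeeze_zero (fun _ => norm_nonneg _) (fun n => ?_) h0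
  rcases eq_or_ne x₀ x with rfl | hne
  · have : ∑ i ∈ Finset.range (n + 1),
      ((iteratedDeriv i θ x₀ : ℝ) : ℂ) * ((x₀ : ℂ) - x₀) ^ i / (i.factorial : ℂ) = θ x₀ := by
      rw [Finset.sum_range_succ']; simp
    simp only [Function.comp_apply, this]; simp
  obtain ⟨x', -, hx'⟩ := taylor_mean_remainder_lagrange_iteratedDeriv (n := n) hne
    (f := θ) ((hθ.of_le (by exact_mod_cast le_top)).contDiffOn)
  have he : ((taylorWithinEval θ n (Set.uIcc x₀ x) x₀ x : ℝ) : ℂ) = ∑ i ∈ Finset.range (n + 1),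
      ((iteratedDeriv i θ x₀ : ℝ) : ℂ) * ((x : ℂ) - x₀) ^ i / (i.factorial : ℂ) := by
    rw [taylor_within_apply]
    push_cast
    refine Finset.sum_congr rfl fun i _ => ?_
    rw [iteratedDerivWithin_eq_iteratedDeriv (uniqueDiffOn_uIcc hne)
      ((hθ.of_le (by exact_mod_cast le_top)).contDiffAt) Set.left_mem_uIcc]
    push_cast [smul_eq_mul]
    field_simp
  simp only [Function.comp_apply]
  rw [← he, norm_sub_rev, ← Complex.ofReal_sub, hx', Complex.norm_real, norm_div, norm_mul,
    norm_pow, mul_pow]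
  simp only [Real.norm_eq_abs, Nat.abs_cast]
  gcongr
  exact hb n x'

/-- Both sums agree with `θ` on the real line, so the identity theorem applies. This lets an
estimate obtained by expanding at the foot of each vertical line hold for one entire function. -/
theorem taylorSum_eq (hB : 0 ≤ B) (hθ : ContDiff ℝ ∞ θ)
    (hb : ∀ k x, |iteratedDeriv (k + 1) θ x| ≤ B ^ (k + 1)) (x₀ x₁ : ℝ) :
    taylorSum θ x₀ = taylorSum θ x₁ := by
  have h : ∀ x, AnalyticOnNhd ℂ (taylorSum θ x) Set.univ := fun x =>
    (differentiable_taylorSum hB hb x).differentiableOn.analyticOnNhd isOpen_univ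
  refine (h x₀).eq_of_frequently_eq (z₀ := 0) (h x₁) ?_
  have ht : Tendsto (fun x : ℝ => (x : ℂ)) (𝓝[≠] 0) (𝓝[≠] 0) := by
    have := Complex.continuous_ofReal.continuousAt (x := 0) |>.continuousWithinAt (s := {0}ᶜ)
    refine tendsto_nhdsWithin_iff.2 ⟨by simpa using this.tendsto, ?_⟩
    filter_upwards [self_mem_nhdsWithin] with x hx
    simpa using hx
  refine ht.frequently (Eventually.frequently (Eventually.of_forall fun x => ?_))
  rw [taylorSum_ofReal hB hθ hb, taylorSum_ofReal hB hθ hb]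

/-- Expanded at `x`, the term of order zero is real and drops out; the others are dominated by the
exponential series without its first term. The size of `θ` itself therefore plays no role. -/
theorem abs_im_taylorSum_le (hB : 0 ≤ B)
    (hb : ∀ k x, |iteratedDeriv (k + 1) θ x| ≤ B ^ (k + 1)) (x η : ℝ) :
    |(taylorSum θ x (x + η * I)).im| ≤ Real.exp (B * |η|) - 1 := by
  have hs := summable_taylorSum hB hb x (x + η * I)
  rw [taylorSum, hs.tsum_eq_zero_add, add_im]
  have h0 : (((iteratedDeriv 0 θ x : ℝ) : ℂ) * ((x + η * I : ℂ) - x) ^ 0 /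
      ((0 : ℕ).factorial : ℂ)).im = 0 := by simp
  rw [h0, zero_add]
  refine (Complex.abs_im_le_norm _).trans ?_
  have he := (NormedSpace.expSeries_div_hasSum_exp (𝔸 := ℝ) (B * |η|))
  rw [← Real.exp_eq_exp_ℝ] at he
  have he' := (hasSum_nat_add_iff' (f := fun n : ℕ => (B * |η|) ^ n / (n.factorial : ℝ)) 1).2 he
  simp only [Finset.range_one, Finset.sum_singleton, pow_zero, Nat.factorial_zero, Nat.cast_one,
    div_one] at he'
  refine tsum_of_norm_bounded he' fun k => ?_
  rw [add_sub_cancel_left, norm_div, norm_mul, norm_pow, Complex.norm_real, Complex.norm_natCast,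
    Real.norm_eq_abs, norm_mul, Complex.norm_I, mul_one, Complex.norm_real, Real.norm_eq_abs,
    mul_pow]
  gcongr
  exact hb k x

/-- A smooth real function whose derivatives satisfy `|θ⁽ᵏ⁾| ≤ Bᵏ` for `k ≥ 1` extends to an entire
function, with controlled imaginary part. -/
theorem exists_entire_extension (hB : 0 ≤ B) (hθ : ContDiff ℝ ∞ θ)
    (hb : ∀ k x, |iteratedDeriv (k + 1) θ x| ≤ B ^ (k + 1)) :
    ∃ F : ℂ → ℂ, Differentiable ℂ F ∧ (∀ x : ℝ, F x = θ x) ∧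
      ∀ x η : ℝ, |(F (x + η * I)).im| ≤ Real.exp (B * |η|) - 1 :=
  ⟨taylorSum θ 0, differentiable_taylorSum hB hb 0, taylorSum_ofReal hB hθ hb 0, fun x η => by
    rw [taylorSum_eq hB hθ hb 0 x]; exact abs_im_taylorSum_le hB hb x η⟩

end

/-! ### Shifting the contour of integration -/

/-- The integral of an entire function with Gaussian decay on a horizontal strip does not change
under vertical translations of the line of integration. -/
theorem integral_eq_integral_add_mul_I {f : ℂ → ℂ} (hf : Differentiable ℂ f) {c C p y : ℝ}
    (hp : 0 < p)
    (hC : ∀ x η : ℝ, |η| ≤ |c| → ‖f (x + η * I)‖ ≤ C * Real.exp (-p * (x - y) ^ 2)) :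
    ∫ x : ℝ, f x = ∫ x : ℝ, f (x + c * I) := by
  have hg : Integrable fun x : ℝ => C * Real.exp (-p * (x - y) ^ 2) :=
    ((integrable_exp_neg_mul_sq hp).comp_sub_right y).const_mul C
  have hint : ∀ η : ℝ, |η| ≤ |c| → Integrable fun x : ℝ => f (x + η * I) := fun η hη =>
    hg.mono' (hf.continuous.comp (by fun_prop)).aestronglyMeasurable
      (Eventually.of_forall fun x => hC x η hη)
  have hint0 : Integrable fun x : ℝ => f x := by simpa using hint 0 (by simp)
  -- The vertical sides of the rectangle vanish in the limit; `s T` is taken to be `T` and `-T`.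
  have hlim : ∀ (s : ℝ → ℝ), Tendsto (fun T => |s T|) atTop atTop →
      Tendsto (fun T : ℝ => ∫ η in (0 : ℝ)..c, f (s T + η * I)) atTop (𝓝 0) := by
    intro s hs
    have h1 : Tendsto (fun T => C * Real.exp (-p * (s T - y) ^ 2) * |c - 0|) atTop (𝓝 0) := by
      have h2 : Tendsto (fun T => (s T - y) ^ 2) atTop atTop := by
        have h3 : Tendsto (fun T => |s T| - |y|) atTop atTop :=
          tendsto_atTop_add_const_right _ _ hs
        have h4 : Tendsto (fun T => |s T - y|) atTop atTop :=
          tendsto_atTop_mono (fun T => abs_sub_abs_le_abs_sub _ _) h3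
        refine (tendsto_pow_atTop (α := ℝ) two_ne_zero).comp h4 |>.congr fun T => ?_
        simp
      have h5 : Tendsto (fun T => -p * (s T - y) ^ 2) atTop atBot :=
        h2.const_mul_atTop_of_neg (by linarith)
      have := ((Real.tendsto_exp_atBot.comp h5).const_mul C).mul_const |c - 0|
      simpa using this
    refine squeeze_zero_norm (fun T => ?_) h1
    refine intervalIntegral.norm_integral_le_of_norm_le_const fun η hη => hC _ η ?_
    simpa using Set.abs_sub_left_of_mem_uIcc (Set.uIoc_subset_uIcc hη)
  have hT : Tendsto (fun T : ℝ => ∫ x in (-T)..T, f x) atTop (𝓝 (∫ x : ℝ, f x)) :=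
    intervalIntegral_tendsto_integral hint0 tendsto_neg_atTop_atBot tendsto_id
  have hT' : Tendsto (fun T : ℝ => ∫ x in (-T)..T, f (x + c * I)) atTop
      (𝓝 (∫ x : ℝ, f (x + c * I))) :=
    intervalIntegral_tendsto_integral (hint c le_rfl) tendsto_neg_atTop_atBot tendsto_id
  have h1 := hlim (fun T => T) tendsto_abs_atTop_atTop
  have h2 := hlim (fun T => -T) (by simpa using tendsto_abs_atTop_atTop (G := ℝ))
  have hkey : ∀ T : ℝ, (∫ x in (-T)..T, f x) - (∫ x in (-T)..T, f (x + c * I)) =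
      I * (∫ η in (0 : ℝ)..c, f (((-T : ℝ) : ℂ) + η * I)) -
        I * (∫ η in (0 : ℝ)..c, f ((T : ℂ) + η * I)) := by
    intro T
    have := Complex.integral_boundary_rect_eq_zero_of_differentiableOn f (-T) (T + c * I)
      hf.differentiableOn
    simp only [neg_im, ofReal_im, neg_zero, ofReal_zero, zero_mul, add_zero, neg_re,
      ofReal_re, add_re, mul_re, I_re, mul_zero, I_im, tsub_zero, add_im, mul_im,
      mul_one, zero_add, smul_eq_mul, ofReal_neg] at this
    simp only [ofReal_neg]
    linear_combination this
  have h3 : Tendsto (fun T : ℝ => (∫ x in (-T)..T, f x) - (∫ x in (-T)..T, f (x + c * I))) atTop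
      (𝓝 (I * 0 - I * 0)) := by
    simp_rw [hkey]
    exact (h2.const_mul I).sub (h1.const_mul I)
  have := tendsto_nhds_unique (hT.sub hT') h3
  simpa [sub_eq_zero] using this

/-! ### Modulated Gaussians and Poisson summation -/

/-- A Gaussian of width `σ` centred at `y` with linear phase `2 π ν x` and additional phase
`-θ x`. -/
noncomputable def modGauss (σ y ν : ℝ) (θ : ℝ → ℝ) (x : ℝ) : ℂ :=
  cexp (((-(Real.pi / σ ^ 2) * (x - y) ^ 2 : ℝ) : ℂ) + I * ((2 * Real.pi * ν * x - θ x : ℝ) : ℂ))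

theorem norm_modGauss (σ y ν : ℝ) (θ : ℝ → ℝ) (x : ℝ) :
    ‖modGauss σ y ν θ x‖ = Real.exp (-(Real.pi / σ ^ 2) * (x - y) ^ 2) := by
  rw [modGauss, Complex.norm_exp, add_re, ofReal_re, I_mul_re, ofReal_im, neg_zero, add_zero]

/-- The derivative of `modGauss`. -/
noncomputable def modGaussDeriv (σ y ν : ℝ) (θ : ℝ → ℝ) (x : ℝ) : ℂ :=
  modGauss σ y ν θ x * (((-(2 * Real.pi / σ ^ 2) * (x - y) : ℝ) : ℂ) +
    I * ((2 * Real.pi * ν - deriv θ x : ℝ) : ℂ))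

theorem hasDerivAt_modGauss {θ : ℝ → ℝ} (hθ : Differentiable ℝ θ) (σ y ν x : ℝ) :
    HasDerivAt (modGauss σ y ν θ) (modGaussDeriv σ y ν θ x) x := by
  have h1 : HasDerivAt (fun x : ℝ => -(Real.pi / σ ^ 2) * (x - y) ^ 2)
      (-(2 * Real.pi / σ ^ 2) * (x - y)) x := by
    refine ((((hasDerivAt_id' x).sub_const y).fun_pow 2).const_mul
      (-(Real.pi / σ ^ 2))).congr_deriv ?_
    norm_num
    ring
  have h2 : HasDerivAt (fun x : ℝ => 2 * Real.pi * ν * x - θ x)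
      (2 * Real.pi * ν - deriv θ x) x := by
    simpa using ((hasDerivAt_id' x).const_mul (2 * Real.pi * ν)).fun_sub (hθ x).hasDerivAt
  exact (h1.ofReal_comp.add (h2.ofReal_comp.const_mul I)).cexp

theorem continuous_modGauss {θ : ℝ → ℝ} (hθ : Continuous θ) (σ y ν : ℝ) :
    Continuous (modGauss σ y ν θ) := by
  unfold modGauss; fun_prop

theorem continuous_modGaussDeriv {θ : ℝ → ℝ} (hθ : ContDiff ℝ ∞ θ) (σ y ν : ℝ) :
    Continuous (modGaussDeriv σ y ν θ) := by
  have := hθ.continuous_deriv (by exact_mod_cast le_top)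
  have := continuous_modGauss hθ.continuous σ y ν
  unfold modGaussDeriv; fun_prop

theorem norm_modGaussDeriv_le {θ : ℝ → ℝ} {B : ℝ} (hb : ∀ x, |deriv θ x| ≤ B) (σ y ν x : ℝ) :
    ‖modGaussDeriv σ y ν θ x‖ ≤ (2 * Real.pi * |ν| + B + 2 * Real.pi / σ ^ 2 * |x - y|) *
      Real.exp (-(Real.pi / σ ^ 2) * (x - y) ^ 2) := by
  rw [modGaussDeriv, norm_mul, norm_modGauss, mul_comm]
  gcongr
  refine (norm_add_le _ _).trans ?_
  rw [norm_mul, norm_I, one_mul, norm_real, norm_real, Real.norm_eq_abs, Real.norm_eq_abs, abs_mul,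
    abs_neg, abs_of_nonneg (by positivity : 0 ≤ 2 * Real.pi / σ ^ 2)]
  have h1 := abs_sub (2 * Real.pi * ν) (deriv θ x)
  have h2 : |2 * Real.pi * ν| = 2 * Real.pi * |ν| := by
    rw [abs_mul, abs_of_nonneg Real.two_pi_pos.le]
  linarith [hb x]

/-- Half of the Gaussian exponent is spent on absorbing the linear factor. -/
theorem exists_norm_modGaussDeriv_le {θ : ℝ → ℝ} {B : ℝ} (hb : ∀ x, |deriv θ x| ≤ B)
    {σ : ℝ} (hσ : 0 < σ) (y ν : ℝ) :
    ∃ C, 0 ≤ C ∧ ∀ x, ‖modGaussDeriv σ y ν θ x‖ ≤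
      C * Real.exp (-(Real.pi / σ ^ 2 / 2) * (x - y) ^ 2) := by
  have hB : 0 ≤ B := (abs_nonneg _).trans (hb 0)
  set p := Real.pi / σ ^ 2 with hp
  have hp0 : 0 < p := by positivity
  refine ⟨2 * Real.pi * |ν| + B + 2 * p * (1 + 2 / p), by positivity, fun x => ?_⟩
  refine (norm_modGaussDeriv_le hb σ y ν x).trans ?_
  rw [mul_div_assoc, ← hp]
  set u := x - y
  have h1 : Real.exp (-p * u ^ 2) = Real.exp (-(p / 2) * u ^ 2) * Real.exp (-(p / 2) * u ^ 2) := by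
    rw [← Real.exp_add]; ring_nf
  rw [h1, ← mul_assoc]
  refine mul_le_mul_of_nonneg_right ?_ (Real.exp_pos _).le
  have h2 : Real.exp (-(p / 2) * u ^ 2) ≤ 1 := Real.exp_le_one_iff.2 (by nlinarith [sq_nonneg u])
  have h3 : |u| * Real.exp (-(p / 2) * u ^ 2) ≤ 1 + 2 / p := by
    rw [neg_mul, Real.exp_neg, ← div_eq_mul_inv, div_le_iff₀ (Real.exp_pos _)]
    have h4 := Real.add_one_le_exp (p / 2 * u ^ 2)
    have h5 : |u| ≤ 1 + u ^ 2 := by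
      rw [← sq_abs u]; nlinarith [sq_nonneg (|u| - 1), abs_nonneg u]
    calc |u| ≤ 1 + u ^ 2 := h5
      _ ≤ (1 + 2 / p) * (p / 2 * u ^ 2 + 1) := by
        have : (1 + 2 / p) * (p / 2 * u ^ 2 + 1) = 1 + u ^ 2 + (p / 2 * u ^ 2 + 2 / p) := by
          field_simp; ring
        rw [this]
        have : 0 ≤ p / 2 * u ^ 2 + 2 / p := by positivity
        linarith
      _ ≤ _ := by gcongr
  have h4 : 0 ≤ 2 * Real.pi * |ν| + B := by positivity
  have h5 := mul_le_of_le_one_right h4 h2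
  have h6 := mul_le_mul_of_nonneg_left h3 (by positivity : 0 ≤ 2 * p)
  linarith

/-- Polynomial decay of order above one is what Poisson summation asks for. -/
theorem gaussian_isBigO_rpow (p y : ℝ) (hp : 0 < p) :
    (fun x : ℝ => Real.exp (-p * (x - y) ^ 2)) =O[cocompact ℝ] fun x : ℝ => |x| ^ (-2 : ℝ) := by
  refine Asymptotics.IsBigO.of_bound (2 / p + 2 * y ^ 2) ?_
  filter_upwards [(Set.finite_singleton (0 : ℝ)).isCompact.compl_mem_cocompact] with x hx
  have hx0 : 0 < |x| := abs_pos.2 hx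
  rw [Real.norm_of_nonneg (Real.exp_pos _).le, Real.norm_of_nonneg (by positivity),
    Real.rpow_neg hx0.le, Real.rpow_two, sq_abs, neg_mul, Real.exp_neg, ← div_eq_mul_inv,
    inv_eq_one_div, div_le_div_iff₀ (Real.exp_pos _) (by rw [← sq_abs]; positivity), one_mul]
  have h1 := Real.add_one_le_exp (p * (x - y) ^ 2)
  calc x ^ 2 ≤ (2 / p + 2 * y ^ 2) * (p * (x - y) ^ 2 + 1) := by
        have : (2 / p + 2 * y ^ 2) * (p * (x - y) ^ 2 + 1) =
          2 * (x - y) ^ 2 + 2 * y ^ 2 + (2 / p + 2 * p * (y * (x - y)) ^ 2) := by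
          field_simp; ring
        rw [this]
        have : 0 ≤ 2 / p + 2 * p * (y * (x - y)) ^ 2 := by positivity
        nlinarith [sq_nonneg (x - 2 * y)]
    _ ≤ _ := by gcongr

theorem modGaussDeriv_isBigO {θ : ℝ → ℝ} {B : ℝ} (hb : ∀ x, |deriv θ x| ≤ B)
    {σ : ℝ} (hσ : 0 < σ) (y ν : ℝ) :
    modGaussDeriv σ y ν θ =O[cocompact ℝ] fun x : ℝ => |x| ^ (-2 : ℝ) := by
  obtain ⟨C, hC, h⟩ := exists_norm_modGaussDeriv_le hb hσ y ν
  refine Asymptotics.IsBigO.trans (Asymptotics.IsBigO.of_bound C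
    (Eventually.of_forall fun x => ?_)) (gaussian_isBigO_rpow (Real.pi / σ ^ 2 / 2) y (by positivity))
  rw [Real.norm_of_nonneg (Real.exp_pos _).le]
  exact h x

theorem summable_modGaussDeriv {θ : ℝ → ℝ} {B : ℝ} (hb : ∀ x, |deriv θ x| ≤ B)
    {σ : ℝ} (hσ : 0 < σ) (y ν : ℝ) :
    Summable fun k : ℤ => modGaussDeriv σ y ν θ k :=
  summable_of_isBigO (Real.summable_abs_int_rpow one_lt_two)
    ((modGaussDeriv_isBigO hb hσ y ν).comp_tendsto Int.tendsto_coe_cofinite)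

theorem integrable_gaussian_sub {p : ℝ} (hp : 0 < p) (y : ℝ) :
    Integrable fun x : ℝ => Real.exp (-p * (x - y) ^ 2) :=
  (integrable_exp_neg_mul_sq hp).comp_sub_right y

theorem integrable_modGauss {θ : ℝ → ℝ} (hθ : Continuous θ) {σ : ℝ} (hσ : 0 < σ) (y ν : ℝ) :
    Integrable (modGauss σ y ν θ) :=
  (integrable_gaussian_sub (by positivity : 0 < Real.pi / σ ^ 2) y).mono'
    (continuous_modGauss hθ σ y ν).aestronglyMeasurable
    (Eventually.of_forall fun x => (norm_modGauss σ y ν θ x).le)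

theorem integrable_modGaussDeriv {θ : ℝ → ℝ} (hθ : ContDiff ℝ ∞ θ) {B : ℝ}
    (hb : ∀ x, |deriv θ x| ≤ B) {σ : ℝ} (hσ : 0 < σ) (y ν : ℝ) :
    Integrable (modGaussDeriv σ y ν θ) := by
  obtain ⟨C, hC, h⟩ := exists_norm_modGaussDeriv_le hb hσ y ν
  exact ((integrable_gaussian_sub (by positivity : 0 < Real.pi / σ ^ 2 / 2) y).const_mul C).mono'
    (continuous_modGaussDeriv hθ σ y ν).aestronglyMeasurable (Eventually.of_forall h)

/-- The integral of a modulated Gaussian is exponentially small in the frequency. -/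
theorem norm_integral_modGauss_le {θ : ℝ → ℝ} (hθ : ContDiff ℝ ∞ θ) {B : ℝ} (hB : 0 ≤ B)
    (hb : ∀ k x, |iteratedDeriv (k + 1) θ x| ≤ B ^ (k + 1)) {σ : ℝ} (hσ : 0 < σ) (y ν : ℝ)
    {η : ℝ} (hη : 0 ≤ η) :
    ‖∫ x, modGauss σ y ν θ x‖ ≤
      σ * Real.exp (Real.pi * η ^ 2 / σ ^ 2 + Real.exp (B * η) - 1 - 2 * Real.pi * |ν| * η) := by
  obtain ⟨F, hF, hFθ, hFim⟩ := exists_entire_extension hB hθ hb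
  have hp : 0 < Real.pi / σ ^ 2 := by positivity
  set f : ℂ → ℂ := fun z => cexp (-((Real.pi / σ ^ 2 : ℝ) : ℂ) * (z - y) ^ 2 +
    I * (((2 * Real.pi * ν : ℝ) : ℂ) * z - F z)) with hf
  have hfd : Differentiable ℂ f := by fun_prop
  have hnorm : ∀ x e : ℝ, ‖f (x + e * I)‖ = Real.exp (-(Real.pi / σ ^ 2) * (x - y) ^ 2 +
      Real.pi / σ ^ 2 * e ^ 2 - 2 * Real.pi * ν * e + (F (x + e * I)).im) := by
    intro x e
    rw [hf, Complex.norm_exp]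
    congr 1
    have : (x + e * I - y : ℂ) ^ 2 = (((x - y) ^ 2 - e ^ 2 : ℝ) : ℂ) +
        ((2 * (x - y) * e : ℝ) : ℂ) * I := by
      push_cast
      linear_combination (e : ℂ) ^ 2 * I_sq
    rw [this, add_re, I_mul_re, sub_im, im_ofReal_mul, ← ofReal_neg, re_ofReal_mul, add_re,
      ofReal_re, re_ofReal_mul, I_re, add_im, im_ofReal_mul, ofReal_im, I_im]
    ring
  -- The contour is moved up or down according to the sign of `ν`, so that the oscillating factor
  -- always decays.
  obtain ⟨e, he1, he2⟩ : ∃ e : ℝ, |e| = η ∧ ν * e = |ν| * η := by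
    rcases le_total 0 ν with h | h
    · exact ⟨η, abs_of_nonneg hη, by rw [abs_of_nonneg h]⟩
    · exact ⟨-η, by rw [abs_neg, abs_of_nonneg hη], by rw [abs_of_nonpos h]; ring⟩
  have hesq : e ^ 2 = η ^ 2 := by rw [← sq_abs, he1]
  have h0 : ∀ x : ℝ, modGauss σ y ν θ x = f x := by
    intro x
    rw [modGauss, hf]
    simp only [hFθ]
    push_cast
    ring_nf
  -- Any finite constant uniform on the strip suffices here; the sharp exponent is recovered on the
  -- shifted line.
  have hshift := integral_eq_integral_add_mul_I hfd (c := e) hp (y := y)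
    (C := Real.exp (Real.pi / σ ^ 2 * η ^ 2 + 2 * Real.pi * |ν| * η + Real.exp (B * η)))
    (fun x e' he' => by
      rw [hnorm, ← Real.exp_add]
      refine Real.exp_le_exp.2 ?_
      rw [he1] at he'
      have h1 : e' ^ 2 ≤ η ^ 2 := sq_le_sq' (by linarith [neg_abs_le e']) ((le_abs_self _).trans he')
      have h2 : -(2 * Real.pi * ν * e') ≤ 2 * Real.pi * |ν| * η := by
        refine (neg_le_abs _).trans ?_
        rw [abs_mul, abs_mul, abs_of_pos Real.two_pi_pos]
        gcongr
      have h3 : (F (x + e' * I)).im ≤ Real.exp (B * η) := by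
        refine (le_abs_self _).trans ((hFim x e').trans ?_)
        have : Real.exp (B * |e'|) ≤ Real.exp (B * η) := by gcongr
        linarith
      have h4 := mul_le_mul_of_nonneg_left h1 hp.le
      linarith)
  simp_rw [h0]
  rw [hshift]
  have hG : ∫ x : ℝ, Real.exp (-(Real.pi / σ ^ 2) * (x - y) ^ 2) = σ := by
    rw [integral_sub_right_eq_self (fun x : ℝ => Real.exp (-(Real.pi / σ ^ 2) * x ^ 2)),
      integral_gaussian]
    rw [div_div_eq_mul_div, mul_div_cancel_left₀ _ Real.pi_ne_zero, Real.sqrt_sq hσ.le]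
  refine (norm_integral_le_of_norm_le (g := fun x : ℝ => Real.exp (-(Real.pi / σ ^ 2) * (x - y) ^ 2)
    * Real.exp (Real.pi * η ^ 2 / σ ^ 2 + Real.exp (B * η) - 1 - 2 * Real.pi * |ν| * η))
    ((integrable_gaussian_sub hp y).mul_const _) (Eventually.of_forall fun x => ?_)).trans_eq ?_
  · rw [hnorm, ← Real.exp_add]
    refine Real.exp_le_exp.2 ?_
    have h3 : (F (x + e * I)).im ≤ Real.exp (B * η) - 1 := by
      rw [← he1]; exact (le_abs_self _).trans (hFim x e)
    rw [hesq]
    have : 2 * Real.pi * ν * e = 2 * Real.pi * |ν| * η := by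
      rw [mul_assoc, he2, mul_assoc (2 * Real.pi)]
    rw [this]
    have : Real.pi / σ ^ 2 * η ^ 2 = Real.pi * η ^ 2 / σ ^ 2 := by ring
    linarith
  · rw [integral_mul_const, hG]

open FourierTransform in
theorem fourier_modGauss (σ y ν : ℝ) (θ : ℝ → ℝ) (q : ℝ) :
    𝓕 (modGauss σ y ν θ) q = ∫ x, modGauss σ y (ν - q) θ x := by
  rw [Real.fourier_real_eq_integral_exp_smul]
  congr 1
  ext x
  rw [modGauss, modGauss, smul_eq_mul, ← Complex.exp_add]
  congr 1
  push_cast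
  ring

-- The factor `q` removes the mode `q = 0`, the one whose frequency may fail to be bounded away from
-- zero.
open FourierTransform in
theorem fourier_modGaussDeriv {θ : ℝ → ℝ} (hθ : ContDiff ℝ ∞ θ) {B : ℝ}
    (hb : ∀ x, |deriv θ x| ≤ B) {σ : ℝ} (hσ : 0 < σ) (y ν q : ℝ) :
    𝓕 (modGaussDeriv σ y ν θ) q = 2 * Real.pi * I * q * ∫ x, modGauss σ y (ν - q) θ x := by
  have hd : Differentiable ℝ θ := hθ.differentiable (by simp)
  have h1 : deriv (modGauss σ y ν θ) = modGaussDeriv σ y ν θ :=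
    funext fun x => (hasDerivAt_modGauss hd σ y ν x).deriv
  have := Real.fourier_deriv (integrable_modGauss hθ.continuous hσ y ν)
    (fun x => (hasDerivAt_modGauss hd σ y ν x).differentiableAt)
    (by rw [h1]; exact integrable_modGaussDeriv hθ hb hσ y ν)
  rw [← h1, this]
  simp only [smul_eq_mul, fourier_modGauss]

theorem exp_add_exp_neg_le {z w : ℝ} (h : |z| ≤ w) :
    Real.exp z + Real.exp (-z) ≤ Real.exp w + Real.exp (-w) := by
  have h1 : Real.cosh z ≤ Real.cosh w := Real.cosh_le_cosh.2 (h.trans (le_abs_self w))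
  rw [Real.cosh_eq, Real.cosh_eq] at h1
  linarith

/-- Poisson summation bound for the lattice sum of the derivative of a modulated Gaussian. -/
theorem norm_tsum_modGaussDeriv_le {θ : ℝ → ℝ} (hθ : ContDiff ℝ ∞ θ) {B : ℝ} (hB : 0 ≤ B)
    (hb : ∀ k x, |iteratedDeriv (k + 1) θ x| ≤ B ^ (k + 1)) {σ : ℝ} (hσ : 0 < σ) (y : ℝ)
    {ν a : ℝ} (ha : a ≤ 1) (hν : |ν| ≤ 1 - a / 2) {η : ℝ} (hη : 0 < η) :
    ‖∑' k : ℤ, modGaussDeriv σ y ν θ k‖ ≤ 2 * Real.pi * σ *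
      Real.exp (Real.pi * η ^ 2 / σ ^ 2 + Real.exp (B * η) - 1 - Real.pi * a * η) *
      ((1 + Real.exp (-(2 * Real.pi * η))) / (1 - Real.exp (-(2 * Real.pi * η))) ^ 2) := by
  have hb1 : ∀ x, |deriv θ x| ≤ B := fun x => by simpa using hb 0 x
  set x := Real.exp (-(2 * Real.pi * η)) with hx
  have hx0 : 0 < x := Real.exp_pos _
  have hx1 : x < 1 := Real.exp_lt_one_iff.2 (by have := Real.pi_pos; nlinarith [mul_pos this hη])
  set P := Real.pi * η ^ 2 / σ ^ 2 + Real.exp (B * η) - 1 with hP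
  set z := 2 * Real.pi * η * ν with hz
  set c := 2 * Real.pi * σ * Real.exp P with hc
  have hc0 : 0 < c := by positivity
  -- `s` is any lower bound of the detuning, possibly negative. The signed values `n - ν` and `n + 1
  -- + ν` turn the two halves of the mode sum into series of the form `∑ n xⁿ`.
  have hterm : ∀ (m : ℤ) (s : ℝ), s ≤ |ν - m| →
      ‖FourierTransform.fourier (modGaussDeriv σ y ν θ) (m : ℝ)‖ ≤
        c * (|(m : ℝ)| * Real.exp (-(2 * Real.pi * η) * s)) := by
    intro m s hs
    rw [fourier_modGaussDeriv hθ hb1 hσ]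
    rw [norm_mul, norm_mul, norm_mul, norm_mul, norm_I, Complex.norm_real, Complex.norm_real,
      Real.norm_eq_abs, Real.norm_eq_abs, abs_of_pos Real.pi_pos, Complex.norm_ofNat, mul_one]
    have h1 := norm_integral_modGauss_le hθ hB hb hσ y (ν - m) hη.le
    have h2 : Real.exp (Real.pi * η ^ 2 / σ ^ 2 + Real.exp (B * η) - 1 -
        2 * Real.pi * |ν - m| * η) ≤ Real.exp P * Real.exp (-(2 * Real.pi * η) * s) := by
      rw [← Real.exp_add]
      refine Real.exp_le_exp.2 ?_
      have := mul_le_mul_of_nonneg_left hs (by positivity : 0 ≤ 2 * Real.pi * η)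
      linarith
    calc 2 * Real.pi * |(m : ℝ)| * ‖∫ x, modGauss σ y (ν - m) θ x‖
        ≤ 2 * Real.pi * |(m : ℝ)| * (σ * (Real.exp P * Real.exp (-(2 * Real.pi * η) * s))) := by
          gcongr; exact h1.trans (by gcongr)
      _ = _ := by rw [hc]; ring
  have hgeo : HasSum (fun n : ℕ => (n : ℝ) * x ^ n) (x / (1 - x) ^ 2) :=
    hasSum_coe_mul_geometric_of_norm_lt_one (by rwa [Real.norm_of_nonneg hx0.le])
  have hgeo' : HasSum (fun n : ℕ => ((n + 1 : ℕ) : ℝ) * x ^ (n + 1)) (x / (1 - x) ^ 2) := by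
    simpa using (hasSum_nat_add_iff' (f := fun n : ℕ => (n : ℝ) * x ^ n) 1).2 hgeo
  have hxpow : ∀ n : ℕ, Real.exp (-(2 * Real.pi * η) * n) = x ^ n := fun n => by
    rw [hx, ← Real.exp_nat_mul]; ring_nf
  set g : ℤ → ℝ := fun m => ‖FourierTransform.fourier (modGaussDeriv σ y ν θ) (m : ℝ)‖
  have hg1 : ∀ n : ℕ, g n ≤ c * (Real.exp z * ((n : ℝ) * x ^ n)) := by
    intro n
    refine (hterm n (n - ν) (by
      rw [abs_sub_comm, Int.cast_natCast]; exact le_abs_self _)).trans_eq ?_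
    rw [← hxpow, Int.cast_natCast, Nat.abs_cast,
      show -(2 * Real.pi * η) * (n - ν) = z + -(2 * Real.pi * η) * n by rw [hz]; ring, Real.exp_add]
    ring
  have hg2 : ∀ n : ℕ, g (-(n + 1 : ℤ)) ≤
      c * (Real.exp (-z) * (((n + 1 : ℕ) : ℝ) * x ^ (n + 1))) := by
    intro n
    refine (hterm (-(n + 1 : ℤ)) ((n + 1 : ℕ) + ν) ?_).trans_eq ?_
    · push_cast
      refine le_trans (le_of_eq ?_) (le_abs_self _)
      ring
    rw [← hxpow, show -(2 * Real.pi * η) * ((n + 1 : ℕ) + ν) =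
      -z + -(2 * Real.pi * η) * (n + 1 : ℕ) by rw [hz]; ring, Real.exp_add]
    have : |((-(n + 1 : ℤ) : ℤ) : ℝ)| = ((n + 1 : ℕ) : ℝ) := by
      push_cast; rw [abs_neg, abs_of_nonneg (by positivity)]
    rw [this]
    ring
  have hs1 : HasSum (fun n : ℕ => c * (Real.exp z * ((n : ℝ) * x ^ n)))
      (c * (Real.exp z * (x / (1 - x) ^ 2))) := (hgeo.mul_left _).mul_left _
  have hs2 : HasSum (fun n : ℕ => c * (Real.exp (-z) * (((n + 1 : ℕ) : ℝ) * x ^ (n + 1))))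
      (c * (Real.exp (-z) * (x / (1 - x) ^ 2))) := (hgeo'.mul_left _).mul_left _
  have hgs1 : Summable fun n : ℕ => g n :=
    Summable.of_nonneg_of_le (fun n => norm_nonneg _) hg1 hs1.summable
  have hgs2 : Summable fun n : ℕ => g (-(n + 1 : ℤ)) :=
    Summable.of_nonneg_of_le (fun n => norm_nonneg _) hg2 hs2.summable
  have hgsum : Summable g := Summable.of_nat_of_neg_add_one hgs1 hgs2
  have hfs : Summable fun m : ℤ => FourierTransform.fourier (modGaussDeriv σ y ν θ) (m : ℝ) :=
    hgsum.of_norm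
  have hpo := Real.tsum_eq_tsum_fourier_of_rpow_decay_of_summable
    (continuous_modGaussDeriv hθ σ y ν) one_lt_two (modGaussDeriv_isBigO hb1 hσ y ν) hfs 0
  simp only [zero_add, QuotientAddGroup.mk_zero, fourier_eval_zero, mul_one] at hpo
  rw [hpo]
  refine (norm_tsum_le_tsum_norm hgsum).trans ?_
  have htot : ∑' m, g m ≤ c * (Real.exp z * (x / (1 - x) ^ 2)) +
      c * (Real.exp (-z) * (x / (1 - x) ^ 2)) := by
    rw [tsum_of_nat_of_neg_add_one hgs1 hgs2]
    exact add_le_add (hasSum_le hg1 hgs1.hasSum hs1) (hasSum_le hg2 hgs2.hasSum hs2)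
  refine htot.trans ?_
  -- Since `cosh` is even and increasing on the positive axis, the worst case is `|ν| = 1 - a/2`.
  have hzw : |z| ≤ 2 * Real.pi * η * (1 - a / 2) := by
    rw [hz, abs_mul, abs_of_pos (by positivity : 0 < 2 * Real.pi * η)]
    gcongr
  have h1 := exp_add_exp_neg_le hzw
  have h2 : x * Real.exp (2 * Real.pi * η * (1 - a / 2)) = Real.exp (-(Real.pi * a * η)) := by
    rw [hx, ← Real.exp_add]; ring_nf
  -- This comparison of exponents is where `a ≤ 1` is needed.
  have h3 : x * Real.exp (-(2 * Real.pi * η * (1 - a / 2))) ≤ Real.exp (-(Real.pi * a * η)) * x := by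
    rw [mul_comm x, hx, ← Real.exp_add, ← Real.exp_add]
    refine Real.exp_le_exp.2 ?_
    have := mul_nonneg (by positivity : 0 ≤ 2 * Real.pi * η) (by linarith : 0 ≤ 1 - a)
    linarith
  have h4 : x * (Real.exp z + Real.exp (-z)) ≤ Real.exp (-(Real.pi * a * η)) * (1 + x) := by
    have := mul_le_mul_of_nonneg_left h1 hx0.le
    linarith
  have h5 : Real.exp (P - Real.pi * a * η) = Real.exp P * Real.exp (-(Real.pi * a * η)) := by
    rw [← Real.exp_add]; ring_nf
  rw [h5]
  have h6 : 0 < (1 - x) ^ 2 := by have : 0 < 1 - x := by linarith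
                                  positivity
  calc c * (Real.exp z * (x / (1 - x) ^ 2)) + c * (Real.exp (-z) * (x / (1 - x) ^ 2))
      = c / (1 - x) ^ 2 * (x * (Real.exp z + Real.exp (-z))) := by ring
    _ ≤ c / (1 - x) ^ 2 * (Real.exp (-(Real.pi * a * η)) * (1 + x)) := by gcongr
    _ = _ := by rw [hc]; ring

/-! ### Tails of Gaussian lattice sums -/

/-- From `(D/2 + v)² ≥ D²/4 + D v`: beyond the edge of the window the Gaussian decays at least
geometrically. -/
theorem gaussian_tail_le {σ : ℝ} (hσ : 0 < σ) {D u v : ℝ} (hD : 0 < D) (hv : 0 ≤ v)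
    (hu : D / 2 + v ≤ u) :
    Real.exp (-(Real.pi / σ ^ 2) * u ^ 2) ≤
      Real.exp (-(Real.pi / 4 * (D ^ 2 / σ ^ 2))) * Real.exp (-(Real.pi * D / σ ^ 2) * v) := by
  rw [← Real.exp_add]
  refine Real.exp_le_exp.2 ?_
  have h1 : D ^ 2 / 4 + D * v ≤ u ^ 2 := by nlinarith
  have h2 : 0 ≤ Real.pi / σ ^ 2 := by positivity
  have h3 := mul_le_mul_of_nonneg_left h1 h2
  calc -(Real.pi / σ ^ 2) * u ^ 2 ≤ -(Real.pi / σ ^ 2 * (D ^ 2 / 4 + D * v)) := by linarith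
    _ = _ := by ring

/-- The linear factor is absorbed by `u ≤ (D/2) exp((2/D)(u - D/2))`, which lowers the geometric
rate by `2/D`; the rate stays nonnegative because `σ ≤ D`. -/
theorem mul_gaussian_tail_le {σ : ℝ} (hσ : 0 < σ) {D u v : ℝ} (hD : σ ≤ D) (hv : 0 ≤ v)
    (hu : D / 2 + v ≤ u) :
    u * Real.exp (-(Real.pi / σ ^ 2) * u ^ 2) ≤
      D / 2 * Real.exp (-(Real.pi / 4 * (D ^ 2 / σ ^ 2))) *
        Real.exp (-(Real.pi * D / σ ^ 2 - 2 / D) * v) := by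
  have hD0 : 0 < D := hσ.trans_le hD
  set w := u - D / 2 with hw
  have hwv : v ≤ w := by linarith
  have h1 := gaussian_tail_le hσ hD0 (hv.trans hwv) (by linarith : D / 2 + w ≤ u)
  have h2 : u ≤ D / 2 * Real.exp (2 / D * w) := by
    have := Real.add_one_le_exp (2 / D * w)
    calc u = D / 2 * (2 / D * w + 1) := by rw [hw]; field_simp; ring
      _ ≤ _ := by gcongr
  have hc : 0 ≤ Real.pi * D / σ ^ 2 - 2 / D := by
    rw [sub_nonneg, div_le_div_iff₀ hD0 (by positivity)]
    nlinarith [Real.pi_gt_three]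
  calc u * Real.exp (-(Real.pi / σ ^ 2) * u ^ 2)
      ≤ (D / 2 * Real.exp (2 / D * w)) * (Real.exp (-(Real.pi / 4 * (D ^ 2 / σ ^ 2))) *
        Real.exp (-(Real.pi * D / σ ^ 2) * w)) := by gcongr
    _ = D / 2 * Real.exp (-(Real.pi / 4 * (D ^ 2 / σ ^ 2))) *
        Real.exp (-(Real.pi * D / σ ^ 2 - 2 / D) * w) := by
      have : Real.exp (-(Real.pi * D / σ ^ 2 - 2 / D) * w) =
        Real.exp (2 / D * w) * Real.exp (-(Real.pi * D / σ ^ 2) * w) := by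
        rw [← Real.exp_add]; ring_nf
      rw [this]; ring
    _ ≤ _ := by
      have : -(Real.pi * D / σ ^ 2 - 2 / D) * w ≤ -(Real.pi * D / σ ^ 2 - 2 / D) * v := by
        nlinarith
      gcongr

theorem hasSum_exp_geometric {c : ℝ} (hc : 0 < c) :
    HasSum (fun n : ℕ => Real.exp (-c * n)) (1 - Real.exp (-c))⁻¹ := by
  have := hasSum_geometric_of_lt_one (Real.exp_pos (-c)).le (Real.exp_lt_one_iff.2 (by linarith))
  refine this.congr_fun ?_ |> id
  intro n
  rw [← Real.exp_nat_mul]; ring_nf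

theorem inv_one_sub_exp_neg_le {c : ℝ} (hc : 0 < c) : (1 - Real.exp (-c))⁻¹ ≤ 1 + 1 / c := by
  have h1 := Real.add_one_le_exp c
  have h2 : 0 < 1 - Real.exp (-c) := by
    have := Real.exp_lt_one_iff.2 (show -c < 0 by linarith); linarith
  rw [inv_le_comm₀ h2 (by positivity), Real.exp_neg]
  have h3 : (Real.exp c)⁻¹ ≤ (c + 1)⁻¹ := by gcongr
  have h4 : (1 + 1 / c)⁻¹ = 1 - (c + 1)⁻¹ := by field_simp; ring
  rw [h4]; linarith

/-- One side of the tail of a lattice sum. -/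
theorem tsum_tail_le {σ : ℝ} (hσ : 0 < σ) {D : ℝ} (hD : σ ≤ D) {α : ℝ} (hα : 0 ≤ α)
    {f : ℕ → ℂ} {u : ℕ → ℝ} (hu : ∀ n : ℕ, D / 2 + n ≤ u n)
    (hf : ∀ n, ‖f n‖ ≤ (α + 2 * Real.pi / σ ^ 2 * u n) *
      Real.exp (-(Real.pi / σ ^ 2) * (u n) ^ 2)) :
    ‖∑' n, f n‖ ≤ (α * (1 - Real.exp (-(Real.pi * D / σ ^ 2)))⁻¹ +
      (Real.pi * (D / σ ^ 2) + Real.pi * (D ^ 2 / σ ^ 2))) *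
      Real.exp (-(Real.pi / 4 * (D ^ 2 / σ ^ 2))) := by
  have hD0 : 0 < D := hσ.trans_le hD
  set c' := Real.pi * D / σ ^ 2 - 2 / D with hc'
  have hDD : 1 / D ≤ D / σ ^ 2 := by
    rw [div_le_div_iff₀ hD0 (by positivity)]; nlinarith
  have hDσ : 0 < D / σ ^ 2 := by positivity
  -- `1.14 < π - 2`, and `2/D ≤ 2 D/σ²`.
  have hcl : 114 / 100 * (D / σ ^ 2) ≤ c' := by
    have h1 : 2 / D = 2 * (1 / D) := by ring
    rw [hc', h1, mul_div_assoc]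
    nlinarith [Real.pi_gt_d2]
  have hc0 : 0 < c' := lt_of_lt_of_le (by positivity) hcl
  set e := Real.exp (-(Real.pi / 4 * (D ^ 2 / σ ^ 2))) with he
  have he0 : 0 < e := Real.exp_pos _
  have hb : ∀ n : ℕ, ‖f n‖ ≤ α * e * Real.exp (-(Real.pi * D / σ ^ 2) * n) +
      Real.pi * (D / σ ^ 2) * e * Real.exp (-c' * n) := by
    intro n
    have h1 := gaussian_tail_le hσ hD0 (Nat.cast_nonneg n) (hu n)
    have h2 := mul_gaussian_tail_le hσ hD (Nat.cast_nonneg n) (hu n)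
    refine (hf n).trans ?_
    rw [add_mul, mul_assoc (2 * Real.pi / σ ^ 2)]
    refine add_le_add ?_ ?_
    · rw [mul_assoc α]; gcongr
    · calc _ ≤ 2 * Real.pi / σ ^ 2 * (D / 2 * e * Real.exp (-c' * n)) := by gcongr
        _ = _ := by ring
  have hs := ((hasSum_exp_geometric (by positivity : 0 < Real.pi * D / σ ^ 2)).mul_left (α * e)).add
    ((hasSum_exp_geometric hc0).mul_left (Real.pi * (D / σ ^ 2) * e))
  refine (tsum_of_norm_bounded hs hb).trans ?_
  -- By `1/(1 - e^{-c}) ≤ 1 + 1/c`, the geometric factor costs at most one extra `π`, which is below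
  -- `π D²/σ²`.
  have h3 : Real.pi * (D / σ ^ 2) * (1 - Real.exp (-c'))⁻¹ ≤
      Real.pi * (D / σ ^ 2) + Real.pi * (D ^ 2 / σ ^ 2) := by
    calc _ ≤ Real.pi * (D / σ ^ 2) * (1 + 1 / c') := by
          gcongr; exact inv_one_sub_exp_neg_le hc0
      _ = Real.pi * (D / σ ^ 2) + Real.pi * ((D / σ ^ 2) / c') := by ring
      _ ≤ _ := by
        have h4 : D / σ ^ 2 / c' ≤ 1 := by rw [div_le_one hc0]; linarith
        have h5 : 1 ≤ D ^ 2 / σ ^ 2 := by rw [one_le_div (by positivity)]; gcongr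
        have h6 := mul_le_mul_of_nonneg_left (h4.trans h5) Real.pi_pos.le
        linarith
  calc _ = (α * (1 - Real.exp (-(Real.pi * D / σ ^ 2)))⁻¹ +
      Real.pi * (D / σ ^ 2) * (1 - Real.exp (-c'))⁻¹) * e := by ring
    _ ≤ _ := by gcongr

theorem norm_sum_range_le_of_summable_int {u : ℤ → ℂ} (hu : Summable u) (M : ℤ) (d : ℕ)
    {P T : ℝ} (hP : ‖∑' k, u k‖ ≤ P) (h1 : ‖∑' n : ℕ, u (M + ((n + d : ℕ) : ℤ))‖ ≤ T)
    (h2 : ‖∑' n : ℕ, u (M + -(n + 1 : ℤ))‖ ≤ T) :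
    ‖∑ j ∈ Finset.range d, u (M + j)‖ ≤ P + 2 * T := by
  have hu' : Summable fun j : ℤ => u (M + j) := (Equiv.addLeft M).summable_iff.2 hu
  have ht : ∑' j : ℤ, u (M + j) = ∑' k : ℤ, u k := (Equiv.addLeft M).tsum_eq u
  have hs1 : Summable fun n : ℕ => u (M + (n : ℤ)) := hu'.comp_injective Nat.cast_injective
  have hs2 : Summable fun n : ℕ => u (M + -(n + 1 : ℤ)) :=
    hu'.comp_injective (i := fun n : ℕ => (-(n + 1 : ℤ))) fun m n h => by simpa using h
  have hd : ∑ j ∈ Finset.range d, u (M + j) + ∑' n : ℕ, u (M + ((n + d : ℕ) : ℤ)) =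
      ∑' n : ℕ, u (M + n) := Summable.sum_add_tsum_nat_add (f := fun n : ℕ => u (M + n)) d hs1
  rw [← ht, tsum_of_nat_of_neg_add_one (f := fun j : ℤ => u (M + j)) hs1 hs2, ← hd] at hP
  revert hP h1 h2 hd
  generalize ∑ j ∈ Finset.range d, u (M + j) = S
  generalize ∑' n : ℕ, u (M + ((n + d : ℕ) : ℤ)) = T1
  generalize ∑' n : ℕ, u (M + -(n + 1 : ℤ)) = T2
  intro hP h1 h2 _
  have h3 : S = S + T1 + T2 - T1 - T2 := by ring
  have h4 := norm_sub_le (S + T1 + T2 - T1) T2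
  have h5 := norm_sub_le (S + T1 + T2) T1
  rw [← h3] at h4
  linarith

/-- The lattice sum of the derivative of a modulated Gaussian over a window of length `d`
around its centre. -/
theorem norm_sum_modGaussDeriv_le {θ : ℝ → ℝ} (hθ : ContDiff ℝ ∞ θ) {B : ℝ} (hB : 0 ≤ B)
    (hb : ∀ k x, |iteratedDeriv (k + 1) θ x| ≤ B ^ (k + 1)) {σ : ℝ} (hσ : 0 < σ) {d : ℕ}
    (hd : σ ≤ d) {N : ℤ} {y : ℝ} (hN1 : (N : ℝ) ≤ y - d / 2) (hN2 : y - d / 2 ≤ N + 1)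
    {ν a : ℝ} (ha : a ≤ 1) (hν : |ν| ≤ 1 - a / 2) {η : ℝ} (hη : 0 < η) :
    ‖∑ j ∈ Finset.range d, modGaussDeriv σ y ν θ ((N + 1 + j : ℤ) : ℝ)‖ ≤ 2 * Real.pi * σ *
      Real.exp (Real.pi * η ^ 2 / σ ^ 2 + Real.exp (B * η) - 1 - Real.pi * a * η) *
      ((1 + Real.exp (-(2 * Real.pi * η))) / (1 - Real.exp (-(2 * Real.pi * η))) ^ 2) +
      2 * ((2 * Real.pi * |ν| + B) * (1 - Real.exp (-(Real.pi * d / σ ^ 2)))⁻¹ +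
      (Real.pi * (d / σ ^ 2) + Real.pi * ((d : ℝ) ^ 2 / σ ^ 2))) *
      Real.exp (-(Real.pi / 4 * ((d : ℝ) ^ 2 / σ ^ 2))) := by
  have hb1 : ∀ x, |deriv θ x| ≤ B := fun x => by simpa using hb 0 x
  have hα : 0 ≤ 2 * Real.pi * |ν| + B := by positivity
  rw [mul_assoc 2 (_ + _)]
  refine norm_sum_range_le_of_summable_int (u := fun k : ℤ => modGaussDeriv σ y ν θ k)
    (summable_modGaussDeriv hb1 hσ y ν) (N + 1) d
    (norm_tsum_modGaussDeriv_le hθ hB hb hσ y ha hν hη) ?_ ?_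
  -- The window is `N + 1, …, N + d`. The first points left out, `N + d + 1` and `N`, are at
  -- distance at least `d/2` from `y` by `hN2` and `hN1`.
  · refine tsum_tail_le hσ hd hα
      (u := fun n => |((N + 1 + ((n + d : ℕ) : ℤ) : ℤ) : ℝ) - y|) (fun n => ?_) (fun n => ?_)
    · refine le_trans ?_ (le_abs_self _)
      push_cast; linarith
    · rw [sq_abs]; exact norm_modGaussDeriv_le hb1 σ y ν _
  · refine tsum_tail_le hσ hd hα
      (u := fun n : ℕ => |((N + 1 + -(n + 1 : ℤ) : ℤ) : ℝ) - y|) (fun n => ?_) (fun n => ?_)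
    · refine le_trans ?_ (neg_le_abs _)
      push_cast; linarith
    · rw [sq_abs]; exact norm_modGaussDeriv_le hb1 σ y ν _

/-! ### Choice of the contour: the bound `epsTwo` -/

/-- The bound on the aliased part of the translation error (in units of the normalisation) obtained
from shifting the contour of integration by `η`. -/
noncomputable def aliasBound (σ a B η : ℝ) : ℝ :=
  2 * Real.pi * σ *
    Real.exp (Real.pi * η ^ 2 / σ ^ 2 + Real.exp (B * η) - 1 - Real.pi * a * η) *
    ((1 + Real.exp (-(2 * Real.pi * η))) / (1 - Real.exp (-(2 * Real.pi * η))) ^ 2)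

theorem exp_mul_le_one_add {β c : ℝ} (h0 : 0 ≤ β) (h1 : β ≤ 1) :
    Real.exp (β * c) ≤ 1 + β * (Real.exp c - 1) := by
  have := convexOn_exp.2 (Set.mem_univ (0 : ℝ)) (Set.mem_univ c) (sub_nonneg.2 h1) h0 (by ring)
  simp only [smul_eq_mul, mul_zero, zero_add, Real.exp_zero, mul_one] at this
  linarith

theorem alias_ratio_mono {x y : ℝ} (hx : 0 ≤ x) (hxy : x ≤ y) (hy : y < 1) :
    (1 + x) / (1 - x) ^ 2 ≤ (1 + y) / (1 - y) ^ 2 := by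
  have h1 : 0 < 1 - y := by linarith
  have h2 : 1 - y ≤ 1 - x := by linarith
  gcongr
  linarith

/-- The left side is at most `1/(2 cosh p - 2) ≤ 1/(p² + p⁴/12)`. The constant slightly exceeds
`√3`, the maximum of `p/(1 + p²/12)`, attained at `p = 2√3`. -/
theorem exp_neg_mul_alias_ratio_le {p : ℝ} (hp : 0 < p) :
    Real.exp (-p) * ((1 + Real.exp (-(2 * p))) / (1 - Real.exp (-(2 * p))) ^ 2) ≤
      17321 / 10000 / p ^ 3 := by
  set q := Real.exp (-p) with hq
  have hq0 : 0 < q := Real.exp_pos _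
  have hq1 : q < 1 := Real.exp_lt_one_iff.2 (by linarith)
  have hq2 : Real.exp (-(2 * p)) = q ^ 2 := by rw [hq, ← Real.exp_nat_mul]; ring_nf
  have hcosh : 1 + p ^ 2 / 2 + p ^ 4 / 24 ≤ Real.cosh p := by
    have := sum_le_hasSum (Finset.range 3)
      (fun n _ => div_nonneg (by rw [pow_mul]; positivity) (Nat.cast_nonneg _)) (Real.hasSum_cosh p)
    simpa [Finset.sum_range_succ, Nat.factorial] using this
  have hinv : Real.exp p = q⁻¹ := by rw [hq, Real.exp_neg, inv_inv]
  rw [Real.cosh_eq, hinv, ← hq] at hcosh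
  have hkey : (1 - q) ^ 2 / q = q⁻¹ + q - 2 := by field_simp; ring
  have hlow : p ^ 2 + p ^ 4 / 12 ≤ (1 - q) ^ 2 / q := by rw [hkey]; linarith
  have h1q : 0 < 1 - q := by linarith
  rw [hq2]
  calc q * ((1 + q ^ 2) / (1 - q ^ 2) ^ 2) ≤ ((1 - q) ^ 2 / q)⁻¹ := by
        rw [inv_div, ← mul_div_assoc]
        have : (1 - q ^ 2) ^ 2 = (1 - q) ^ 2 * (1 + q) ^ 2 := by ring
        rw [this, div_le_div_iff₀ (by positivity) (by positivity)]
        have h2 : 1 + q ^ 2 ≤ (1 + q) ^ 2 := by nlinarith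
        have := mul_le_mul_of_nonneg_left h2 (by positivity : 0 ≤ q * (1 - q) ^ 2)
        linarith
    _ ≤ (p ^ 2 + p ^ 4 / 12)⁻¹ := by gcongr
    _ ≤ _ := by
        rw [inv_eq_one_div, div_le_div_iff₀ (by positivity) (by positivity)]
        have : 0 ≤ 17321 / 10000 * (1 + p ^ 2 / 12) - p := by nlinarith [sq_nonneg (p - 3.464)]
        nlinarith [mul_nonneg (sq_nonneg p) this]

/-- The coefficient of `b` in the cubic branch of `epsTwo` is about `3.13`, marginally below `π`;
these are the only facts used about it. -/
theorem mode_constant_bounds :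
    312 / 100 ≤ kappa * √(6 * Real.pi) / Real.log 3 ∧
      Real.pi ≤ 101 / 100 * (kappa * √(6 * Real.pi) / Real.log 3) := by
  have h3 := abs_le.1 Real.log_three_near_10
  have hl : Real.log 3 ≤ 10987 / 10000 := by linarith [h3.2]
  have hl0 : 0 < Real.log 3 := Real.log_pos (by norm_num)
  have hs : 4341 / 1000 ≤ √(6 * Real.pi) := by
    apply Real.le_sqrt_of_sq_le
    nlinarith [Real.pi_gt_d4]
  have h : 3125 / 1000 ≤ kappa * √(6 * Real.pi) / Real.log 3 := by
    rw [le_div_iff₀ hl0, kappa]; linarith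
  constructor
  · linarith
  · linarith [Real.pi_lt_d4]

theorem prefactor_bound :
    1790 / 100 ≤ (3 : ℝ) ^ ((7 : ℝ) / 4) / (√(2 * Real.pi) * Real.exp 1) * (8 + Real.pi ^ 2) := by
  have h1 : 683 / 100 ≤ (3 : ℝ) ^ ((7 : ℝ) / 4) := by
    have : (3 : ℝ) ^ ((7 : ℝ) / 4) = (2187 : ℝ) ^ ((4 : ℝ)⁻¹) := by
      rw [show (2187 : ℝ) = (3 : ℝ) ^ (7 : ℝ) by norm_num, ← Real.rpow_mul (by norm_num)]
      norm_num
    rw [this, Real.le_rpow_inv_iff_of_pos (by norm_num) (by norm_num) (by norm_num)]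
    norm_num
  have h2 : √(2 * Real.pi) ≤ 25067 / 10000 := by
    apply Real.sqrt_le_iff.2
    constructor
    · norm_num
    · nlinarith [Real.pi_lt_d4]
  have h3 : Real.exp 1 ≤ 27183 / 10000 := by linarith [Real.exp_one_lt_d9]
  have h4 : √(2 * Real.pi) * Real.exp 1 ≤ 25067 / 10000 * (27183 / 10000) := by gcongr
  have h5 : 9869 / 1000 ≤ Real.pi ^ 2 := by nlinarith [Real.pi_gt_d4]
  rw [div_mul_eq_mul_div, le_div_iff₀ (by positivity)]
  have h6 : 683 / 100 * (8 + 9869 / 1000) ≤ (3 : ℝ) ^ ((7 : ℝ) / 4) * (8 + Real.pi ^ 2) := by gcongr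
  linarith

/-- The contour shift by `1 / (2 X)` with `X = lam b / d + 1 / σ`. -/
theorem aliasBound_le_cubic {σ a b D lam : ℝ} (hσ : 0 < σ) (ha : 0 < a) (ha1 : a ≤ 1)
    (hb : 0 ≤ b) (hD : 0 < D) (hlam : 312 / 100 ≤ lam) (hlam' : Real.pi ≤ 101 / 100 * lam) :
    aliasBound σ a (2 * Real.pi * b / D) (1 / (2 * (lam * b / D + 1 / σ))) ≤
      1618 / 100 * (σ * ((lam * b / D + 1 / σ) / a) ^ 3) := by
  have hlam0 : 0 < lam := by linarith
  have hpi := Real.pi_pos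
  set X := lam * b / D + 1 / σ with hX
  have hX0 : 0 < X := by positivity
  set η := 1 / (2 * X) with hη
  have hη0 : 0 < η := by positivity
  -- `β` and `1 - β` are the shares of `X` due to the potential and to the Gaussian width. The
  -- growing part of the exponent is at most `0.8 (1 - β) + 1.75 β ≤ 1.75`, and `e^{1.75} < 5.76`.
  set β := lam * b / D / X with hβ
  have hβ0 : 0 ≤ β := by positivity
  have hβ' : 1 - β = 1 / σ / X := by
    rw [hβ, eq_div_iff hX0.ne', sub_mul, div_mul_cancel₀ _ hX0.ne', hX]; ring
  have hβ1 : 0 ≤ 1 - β := by rw [hβ']; positivity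
  have hK1 : Real.pi * η ^ 2 / σ ^ 2 ≤ 8 / 10 * (1 - β) := by
    have : Real.pi * η ^ 2 / σ ^ 2 = Real.pi / 4 * (1 - β) ^ 2 := by
      rw [hβ', hη]; field_simp; norm_num
    rw [this]
    have h1 : (1 - β) ^ 2 ≤ 1 - β := by nlinarith
    nlinarith [Real.pi_lt_d2]
  have hK2 : Real.exp (2 * Real.pi * b / D * η) - 1 ≤ 175 / 100 * β := by
    have h1 : 2 * Real.pi * b / D * η ≤ β * (101 / 100) := by
      have : 2 * Real.pi * b / D * η = Real.pi * (b / D / X) := by rw [hη]; field_simp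
      rw [this, hβ]
      calc Real.pi * (b / D / X) ≤ 101 / 100 * lam * (b / D / X) := by gcongr
        _ = _ := by ring
    have h2 : Real.exp (101 / 100) ≤ 275 / 100 := by
      rw [show (101 / 100 : ℝ) = 1 + 1 / 100 by norm_num, Real.exp_add]
      have h3 : Real.exp (1 / 100) ≤ 100 / 99 := by
        have := Real.add_one_le_exp (-(1 / 100 : ℝ))
        rw [Real.exp_neg] at this
        rw [← inv_inv (Real.exp (1 / 100)), inv_le_comm₀ (by positivity) (by norm_num)]
        linarith
      have h4 := Real.exp_one_lt_d9.le
      calc Real.exp 1 * Real.exp (1 / 100) ≤ 2.7182818286 * (100 / 99) := by gcongr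
        _ ≤ _ := by norm_num
    have h3 := exp_mul_le_one_add (c := 101 / 100) hβ0 (by linarith)
    have h4 : Real.exp (2 * Real.pi * b / D * η) ≤ Real.exp (β * (101 / 100)) :=
      Real.exp_le_exp.2 h1
    nlinarith
  set p := Real.pi * a * η with hp
  have hp0 : 0 < p := by positivity
  have hE : Real.exp (Real.pi * η ^ 2 / σ ^ 2 + Real.exp (2 * Real.pi * b / D * η) - 1 - p) ≤
      576 / 100 * Real.exp (-p) := by
    have h1 : Real.exp (175 / 100) ≤ 576 / 100 := by
      have h2 : Real.exp (175 / 100) ^ 4 ≤ (576 / 100) ^ 4 := by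
        rw [← Real.exp_nat_mul, show ((4 : ℕ) : ℝ) * (175 / 100) = (7 : ℕ) * 1 by norm_num,
          Real.exp_nat_mul]
        calc Real.exp 1 ^ 7 ≤ 2.7182818286 ^ 7 := by gcongr; exact Real.exp_one_lt_d9.le
          _ ≤ _ := by norm_num
      exact le_of_pow_le_pow_left₀ (by norm_num) (by norm_num) h2
    calc _ ≤ Real.exp (175 / 100 + -p) := Real.exp_le_exp.2 (by linarith)
      _ = Real.exp (175 / 100) * Real.exp (-p) := Real.exp_add _ _
      _ ≤ _ := by gcongr
  have hx : Real.exp (-(2 * Real.pi * η)) ≤ Real.exp (-(2 * p)) := by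
    refine Real.exp_le_exp.2 ?_
    rw [hp]
    have : Real.pi * a * η ≤ Real.pi * 1 * η := by gcongr
    linarith
  have hS := alias_ratio_mono (Real.exp_pos _).le hx (Real.exp_lt_one_iff.2 (by linarith))
  have hR := exp_neg_mul_alias_ratio_le hp0
  unfold aliasBound
  rw [← hp]
  calc _ ≤ 2 * Real.pi * σ * (576 / 100 * Real.exp (-p)) *
        ((1 + Real.exp (-(2 * p))) / (1 - Real.exp (-(2 * p))) ^ 2) := by gcongr
    _ = 2 * Real.pi * σ * (576 / 100) *
        (Real.exp (-p) * ((1 + Real.exp (-(2 * p))) / (1 - Real.exp (-(2 * p))) ^ 2)) := by ring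
    _ ≤ 2 * Real.pi * σ * (576 / 100) * (17321 / 10000 / p ^ 3) := by gcongr
    _ = 16 * (576 / 100) * (17321 / 10000) / Real.pi ^ 2 * (σ * (X / a) ^ 3) := by
        rw [hp, hη]; field_simp; norm_num
    -- `16 · 5.76 · 1.7321 / π²` is about `16.174`.
    _ ≤ _ := by
        refine mul_le_mul_of_nonneg_right ?_ (by positivity)
        rw [div_le_iff₀ (by positivity)]
        nlinarith [Real.pi_gt_d4]

/-- The Gaussian weight at the edge of the window, times the geometric tail factor. -/
theorem tail_factor_le {σ D : ℝ} (hσ : 0 < σ) (hσD : σ ≤ D) (hD : 2 ≤ D) :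
    (1 - Real.exp (-(Real.pi * D / σ ^ 2)))⁻¹ * Real.exp (-(Real.pi / 4 * (D ^ 2 / σ ^ 2))) ≤
      6 / 10 * σ := by
  have hpi := Real.pi_gt_d2
  set s := D / σ with hs
  have hs1 : 1 ≤ s := by rwa [hs, one_le_div hσ]
  have hsσ : 2 ≤ s * σ := by rwa [hs, div_mul_cancel₀ _ hσ.ne']
  have h1 := inv_one_sub_exp_neg_le (c := Real.pi * D / σ ^ 2)
    (by have := hσ.trans_le hσD; positivity)
  have h2 : Real.exp (-(Real.pi / 4 * (D ^ 2 / σ ^ 2))) ≤ (1 + 785 / 1000 * s ^ 2)⁻¹ := by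
    rw [Real.exp_neg]
    have h3 := Real.add_one_le_exp (Real.pi / 4 * (D ^ 2 / σ ^ 2))
    have h4 : D ^ 2 / σ ^ 2 = s ^ 2 := by rw [hs, div_pow]
    rw [h4] at h3 ⊢
    gcongr
    nlinarith [sq_nonneg s]
  have h5 : 1 / (Real.pi * D / σ ^ 2) ≤ 32 / 100 * σ := by
    have : 1 / (Real.pi * D / σ ^ 2) = σ * (1 / (Real.pi * s)) := by rw [hs]; field_simp
    rw [this, mul_comm]
    refine mul_le_mul_of_nonneg_right ?_ hσ.le
    rw [div_le_iff₀ (by positivity)]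
    nlinarith
  calc _ ≤ (s * σ / 2 + 32 / 100 * σ) * (1 + 785 / 1000 * s ^ 2)⁻¹ := by
        gcongr
        linarith
    _ ≤ _ := by
        rw [← div_eq_mul_inv, div_le_iff₀ (by positivity)]
        have : 0 ≤ 6 / 10 * (1 + 785 / 1000 * s ^ 2) - s / 2 - 32 / 100 := by
          nlinarith [sq_nonneg (s - 1 / 2)]
        nlinarith [mul_nonneg hσ.le this]

/-- The exponent obtained from a contour shift `ξ` (in units of the optimal shift of the pure
Gaussian) in the regime where the potential is slowly varying. -/
theorem exists_shift_exponent_le {M L w r κ : ℝ} (hκ : κ = 792 / 1000) (hL : 0 < L)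
    (hLM : L = Real.log M) (hw : 0 < w) (hr : r = 1 + κ * w / L) (hK : 8 * r ^ 2 ≤ M) :
    ∃ ξ, 0 < ξ ∧ 396 / 1000 / r ≤ ξ ∧
      M * ξ ^ 2 / 2 + Real.exp (w * ξ) - 1 - M * ξ ≤ -(M / (2 * r ^ 2)) := by
  have hκ0 : 0 < κ := by rw [hκ]; norm_num
  have hr1 : 1 < r := by rw [hr]; have : 0 < κ * w / L := by positivity
                         linarith
  have hr0 : 0 < r := by linarith
  have hM0 : 0 < M := lt_of_lt_of_le (by positivity) hK
  set m := √M with hm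
  have hm0 : 0 < m := Real.sqrt_pos.2 hM0
  have hmM : m ^ 2 = M := Real.sq_sqrt hM0.le
  -- `2.828 < √8`.
  have hmr : 2828 / 1000 * r ≤ m := by
    apply Real.le_sqrt_of_sq_le
    nlinarith [sq_nonneg r]
  have hexp : Real.exp (L / 2) = m := by
    rw [hLM, hm, Real.sqrt_eq_rpow, Real.rpow_def_of_pos hM0]
    ring_nf
  -- The shift `1/r` is used as long as `exp(w/r)` does not exceed `√M`.
  by_cases hc : w / r ≤ L / 2
  · refine ⟨1 / r, by positivity, by gcongr; norm_num, ?_⟩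
    obtain ⟨τ, hτ⟩ : ∃ τ, τ = w / r / (L / 2) := ⟨_, rfl⟩
    have hτ0 : 0 ≤ τ := by rw [hτ]; positivity
    have hτ1 : τ ≤ 1 := by rwa [hτ, div_le_one (by positivity)]
    have h1 : Real.exp (w * (1 / r)) ≤ 1 + τ * m := by
      have h2 := exp_mul_le_one_add (c := L / 2) hτ0 hτ1
      have h3 : τ * (L / 2) = w * (1 / r) := by rw [hτ]; field_simp
      rw [h3, hexp] at h2
      nlinarith
    -- The form of `r` makes the excess `τ √M` caused by the potential proportional to `r - 1`,
    -- exactly the room left by the quadratic part in `h4`.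
    have h2 : κ * r * τ = 2 * (r - 1) := by rw [hτ, hr]; field_simp; ring
    have h3 : τ * m ≤ M / r ^ 2 * (r - 1) := by
      have h5 : κ * (τ * m * r ^ 2) ≤ κ * (M * (r - 1)) := by
        have h6 : κ * (τ * m * r ^ 2) = (2 * (r - 1)) * (m * r) := by rw [← h2]; ring
        have h7 : 2 * r ≤ κ * m := by rw [hκ]; nlinarith
        have h8 := mul_le_mul_of_nonneg_left h7 (mul_nonneg (by linarith : 0 ≤ r - 1) hm0.le)
        rw [h6, ← hmM]
        nlinarith
      have h6 := le_of_mul_le_mul_left h5 hκ0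
      rw [div_mul_eq_mul_div, le_div_iff₀ (by positivity)]
      exact h6
    have h4 : M * (1 / r) ^ 2 / 2 - M * (1 / r) + M / (2 * r ^ 2) = -(M / r ^ 2 * (r - 1)) := by
      field_simp; ring
    linarith
  · push Not at hc
    -- Otherwise the shift is stopped where `exp(w ξ)` equals `√M`.
    refine ⟨L / (2 * w), by positivity, ?_, ?_⟩
    · rw [div_le_div_iff₀ hr0 (by positivity)]
      have : L * r = L + κ * w := by rw [hr]; field_simp
      rw [this, hκ]; linarith
    have h1 : w * (L / (2 * w)) = L / 2 := by field_simp
    rw [h1, hexp]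
    set ξ := L / (2 * w) with hξ
    have hξ0 : 0 < ξ := by positivity
    set ζ := r * ξ with hζ
    have hζξ : ζ = ξ + 396 / 1000 := by
      rw [hζ, hξ, hr, hκ]; field_simp; ring
    have hζ1 : ζ < 1 := by
      rw [hζ, hξ, ← mul_div_assoc, div_lt_one (by positivity)]
      rw [lt_div_iff₀ hr0] at hc
      linarith
    have hcub : (1 + ζ ^ 2) * (ζ - 396 / 1000) ≤ 2 * ζ * (ζ - 3537 / 10000) := by
      have h0 : 396 / 1000 < ζ := by linarith
      nlinarith [mul_nonneg (by linarith : 0 ≤ 1 - ζ) (sq_nonneg (ζ - 3 / 5)),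
        sq_nonneg (ζ - 3 / 8), sq_nonneg (ζ - 55/100)]
    -- `√M = M/√M ≤ M/(2.828 r)`, and `1/2.828 < 0.3537`.
    have h2 : m ≤ 3537 / 10000 * (M / r) := by
      rw [← mul_div_assoc, le_div_iff₀ hr0, ← hmM]
      nlinarith
    have h3 : M * ξ ^ 2 / 2 + 3537 / 10000 * (M / r) - M * ξ + M / (2 * r ^ 2) ≤ 0 := by
      have h4 : M * ξ ^ 2 / 2 + 3537 / 10000 * (M / r) - M * ξ + M / (2 * r ^ 2) =
          M / (2 * r ^ 2) * (1 + ζ ^ 2 - 2 * r * (ζ - 3537 / 10000)) := by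
        rw [hζ]; field_simp; ring
      rw [h4]
      refine mul_nonpos_of_nonneg_of_nonpos (by positivity) ?_
      have h5 : ξ * (1 + ζ ^ 2 - 2 * r * (ζ - 3537 / 10000)) ≤ 0 := by
        have h6 : ξ * (1 + ζ ^ 2 - 2 * r * (ζ - 3537 / 10000)) =
          (1 + ζ ^ 2) * ξ - 2 * ζ * (ζ - 3537 / 10000) := by rw [hζ]; ring
        rw [h6, show ξ = ζ - 396 / 1000 by linarith]
        linarith
      by_contra hcon
      push Not at hcon
      nlinarith [mul_pos hξ0 hcon]
    linarith

/-- The contour shift in the regime `8 ≤ 𝒩`. -/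
theorem exists_aliasBound_le_exp {σ a b D : ℝ} (hσ : 0 < σ) (ha : 0 < a) (ha1 : a ≤ 1) (hb : 0 < b)
    (hD : 0 < D) {L r : ℝ} (hL : 0 < L) (hLM : L = Real.log (Real.pi * a ^ 2 * σ ^ 2 / 2))
    (hr : r = 1 + kappa * (Real.pi * a * b * σ ^ 2 / D) / L)
    (hK : 8 * r ^ 2 ≤ Real.pi * a ^ 2 * σ ^ 2 / 2) :
    b ≤ 42 / 100 * D ∧ ∃ η, 0 < η ∧ aliasBound σ a (2 * Real.pi * b / D) η ≤
      (2 * Real.pi) ^ ((5 : ℝ) / 4) * σ ^ ((3 : ℝ) / 2) * (1 + Real.pi ^ 2 / 8) *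
        √(Real.exp 1 / 2 * (a / r)) * Real.exp (-(Real.pi * a ^ 2 * σ ^ 2 / 2 / (2 * r ^ 2))) := by
  have hpi := Real.pi_gt_d2
  have hpi0 := Real.pi_pos
  set M := Real.pi * a ^ 2 * σ ^ 2 / 2 with hM
  set w := Real.pi * a * b * σ ^ 2 / D with hw
  have hw0 : 0 < w := by positivity
  have hk0 : 0 < kappa := by norm_num [kappa]
  have hr1 : 1 < r := by rw [hr]; have : 0 < kappa * w / L := by positivity
                         linarith
  have hr0 : 0 < r := by linarith
  have hM0 : 0 < M := by positivity
  -- From `8 r² ≤ π (aσ)²/2`, since `4/√π > 2.25`.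
  have hτ : 225 / 100 * r ≤ a * σ := by
    refine le_of_sq_le_sq ?_ (by positivity) |> id
    have : (a * σ) ^ 2 = 2 * M / Real.pi := by rw [hM]; field_simp
    rw [this, le_div_iff₀ hpi0]
    nlinarith [Real.pi_lt_d2, sq_nonneg r]
  constructor
  -- `log M ≤ √M` and `√8 r ≤ √M` give `κ w ≤ r √M ≤ M/2.828`: in this regime the potential is
  -- necessarily slow compared with `D`.
  · set m := √M with hm
    have hm0 : 0 < m := Real.sqrt_pos.2 hM0
    have hmM : m ^ 2 = M := Real.sq_sqrt hM0.le
    have hlog : L ≤ m := by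
      have h1 : L = 2 * Real.log m := by
        rw [hLM, ← hmM, Real.log_pow]; norm_num
      have h2 := Real.log_le_sub_one_of_pos (by positivity : 0 < m / 2)
      rw [Real.log_div hm0.ne' two_ne_zero] at h2
      linarith [Real.log_two_lt_d9]
    have hmr : 2828 / 1000 * r ≤ m := by
      apply Real.le_sqrt_of_sq_le
      nlinarith [sq_nonneg r]
    have h1 : kappa * w ≤ r * L := by
      rw [hr]; field_simp; linarith
    have h2 : kappa * w ≤ M / (2828 / 1000) := by
      rw [le_div_iff₀ (by norm_num)]
      have : r * L ≤ r * m := by gcongr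
      nlinarith
    have h3 : kappa * (Real.pi * a * σ ^ 2) * b ≤
        (Real.pi * a * σ ^ 2) * (a / 2 / (2828 / 1000)) * D := by
      rw [hw, hM] at h2
      have := mul_le_mul_of_nonneg_right h2 hD.le
      have e1 : kappa * (Real.pi * a * b * σ ^ 2 / D) * D = kappa * (Real.pi * a * σ ^ 2) * b := by
        field_simp
      rw [e1] at this
      linarith
    have h4 : kappa * b ≤ a / 2 / (2828 / 1000) * D := by
      refine le_of_mul_le_mul_left ?_ (by positivity : 0 < Real.pi * a * σ ^ 2)
      linarith
    have h5 : a / 2 / (2828 / 1000) * D ≤ 1 / 2 / (2828 / 1000) * D := by gcongr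
    rw [kappa] at h4
    linarith
  obtain ⟨ξ, hξ0, hξr, hξE⟩ := exists_shift_exponent_le (κ := kappa) rfl hL hLM hw0 hr hK
  have hσ2 : 2 ≤ σ := by
    have : a * σ ≤ 1 * σ := by gcongr
    linarith
  -- `a σ²/2` minimises `π η²/σ² - π a η`, the exponent without potential.
  refine ⟨ξ * a * σ ^ 2 / 2, by positivity, ?_⟩
  have hη : 3 ≤ 2 * Real.pi * (ξ * a * σ ^ 2 / 2) := by
    have h1 : 396 / 1000 * (225 / 100) ≤ ξ * (a * σ) := by
      calc 396 / 1000 * (225 / 100) = 396 / 1000 / r * (225 / 100 * r) := by field_simp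
        _ ≤ _ := by gcongr
    have h2 : 396 / 1000 * (225 / 100) * 2 ≤ ξ * (a * σ) * σ := by gcongr
    nlinarith
  have hx : Real.exp (-(2 * Real.pi * (ξ * a * σ ^ 2 / 2))) ≤ 1 / 4 := by
    rw [Real.exp_neg]
    have := Real.add_one_le_exp (2 * Real.pi * (ξ * a * σ ^ 2 / 2))
    rw [inv_le_comm₀ (by positivity) (by norm_num)]
    linarith
  have hS := alias_ratio_mono (Real.exp_pos _).le hx (by norm_num)
  have hE : Real.pi * (ξ * a * σ ^ 2 / 2) ^ 2 / σ ^ 2 +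
      Real.exp (2 * Real.pi * b / D * (ξ * a * σ ^ 2 / 2)) - 1 -
      Real.pi * a * (ξ * a * σ ^ 2 / 2) ≤ -(M / (2 * r ^ 2)) := by
    refine le_trans (le_of_eq ?_) hξE
    have e1 : Real.pi * (ξ * a * σ ^ 2 / 2) ^ 2 / σ ^ 2 = M * ξ ^ 2 / 2 := by
      rw [hM]; field_simp
    have e2 : 2 * Real.pi * b / D * (ξ * a * σ ^ 2 / 2) = w * ξ := by rw [hw]; field_simp
    have e3 : Real.pi * a * (ξ * a * σ ^ 2 / 2) = M * ξ := by rw [hM]; ring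
    rw [e1, e2, e3]
  have hA : 2 * Real.pi ≤ (2 * Real.pi) ^ ((5 : ℝ) / 4) :=
    Real.self_le_rpow_of_one_le (by linarith) (by norm_num)
  -- This trades the factor `σ` of the alias bound for the `σ^{3/2}` and the square root in
  -- `epsTwo`; it rests on `2.25 r ≤ a σ`.
  have hsq : 17 / 10 / √σ ≤ √(Real.exp 1 / 2 * (a / r)) := by
    rw [div_le_iff₀ (Real.sqrt_pos.2 hσ), ← Real.sqrt_mul (by positivity)]
    apply Real.le_sqrt_of_sq_le
    have h1 : 225 / 100 ≤ a / r * σ := by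
      rw [div_mul_eq_mul_div, le_div_iff₀ hr0]; exact hτ
    have h2 := Real.exp_one_gt_d9
    calc (17 / 10 : ℝ) ^ 2 ≤ 2.7182818283 / 2 * (225 / 100) := by norm_num
      _ ≤ Real.exp 1 / 2 * (a / r * σ) := by gcongr
      _ = _ := by ring
  have hσ32 : σ ^ ((3 : ℝ) / 2) = σ * √σ := by
    rw [Real.sqrt_eq_rpow, ← Real.rpow_one_add' hσ.le (by norm_num)]; norm_num
  have hπ8 : 2 ≤ 1 + Real.pi ^ 2 / 8 := by nlinarith
  unfold aliasBound
  have hsσ : 0 < √σ := Real.sqrt_pos.2 hσ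
  calc _ ≤ 2 * Real.pi * σ * Real.exp (-(M / (2 * r ^ 2))) * ((1 + 1 / 4) / (1 - 1 / 4) ^ 2) := by
        gcongr
    _ ≤ 2 * Real.pi * σ * Real.exp (-(M / (2 * r ^ 2))) * (2 * (17 / 10)) := by
        refine mul_le_mul_of_nonneg_left (by norm_num) (by positivity)
    _ = 2 * Real.pi * (σ * √σ) * 2 * (17 / 10 / √σ) * Real.exp (-(M / (2 * r ^ 2))) := by
        field_simp
    _ ≤ _ := by rw [hσ32]; gcongr

theorem alpha_pos {d : ℕ} {n₀ : ℝ} (hn₀ : n₀ ∈ Set.Ioo (0 : ℝ) ((d : ℝ) - 1)) : 0 < alpha d n₀ := by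
  have h1 : 0 < (d : ℝ) - 1 := hn₀.1.trans hn₀.2
  exact mul_pos (by positivity) (lt_min hn₀.1 (by linarith [hn₀.2]))

theorem alpha_le_one {d : ℕ} {n₀ : ℝ} (hn₀ : n₀ ∈ Set.Ioo (0 : ℝ) ((d : ℝ) - 1)) :
    alpha d n₀ ≤ 1 := by
  have h1 : 0 < (d : ℝ) - 1 := hn₀.1.trans hn₀.2
  rw [alpha, div_mul_eq_mul_div, div_le_one h1]
  linarith [min_le_left n₀ ((d : ℝ) - 1 - n₀), min_le_right n₀ ((d : ℝ) - 1 - n₀)]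

/-- The detuning of an energy level from the mean energy stays away from the reciprocal lattice. -/
theorem abs_detuning_le {d : ℕ} {n₀ : ℝ} (hn₀ : n₀ ∈ Set.Ioo (0 : ℝ) ((d : ℝ) - 1)) (n : Fin d) :
    |(n₀ - n) / d| ≤ 1 - alpha d n₀ / 2 := by
  have h1 : 0 < (d : ℝ) - 1 := hn₀.1.trans hn₀.2
  have hd : 0 < (d : ℝ) := by linarith
  have hn : (n : ℝ) + 1 ≤ d := by exact_mod_cast n.2
  have hn' : 0 ≤ (n : ℝ) := Nat.cast_nonneg _
  set m := min n₀ ((d : ℝ) - 1 - n₀) with hm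
  have hm1 : m ≤ n₀ := min_le_left _ _
  have hm2 : m ≤ (d : ℝ) - 1 - n₀ := min_le_right _ _
  have ha : alpha d n₀ / 2 ≤ (1 + m) / d := by
    rw [alpha, ← hm, le_div_iff₀ hd]
    have : 2 / ((d : ℝ) - 1) * m / 2 * d = m + m / ((d : ℝ) - 1) := by field_simp; ring
    rw [this]
    have : m / ((d : ℝ) - 1) ≤ 1 := by rw [div_le_one h1]; linarith
    linarith
  rw [abs_div, abs_of_pos hd]
  have h2 : |n₀ - n| / d ≤ (d - (1 + m)) / d := by
    gcongr
    rw [abs_le]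
    constructor <;> linarith
  have h3 : ((d : ℝ) - (1 + m)) / d = 1 - (1 + m) / d := by field_simp
  linarith

theorem normConst_nonneg (d : ℕ) (σ k₀ : ℝ) : 0 ≤ normConst d σ k₀ := by
  unfold normConst; positivity

/-- The geometric factor of the tail times the Gaussian weight at the edge of the window. -/
noncomputable def edgeWeight (σ D : ℝ) : ℝ :=
  (1 - Real.exp (-(Real.pi * D / σ ^ 2)))⁻¹ * Real.exp (-(Real.pi / 4 * (D ^ 2 / σ ^ 2)))

theorem edgeWeight_nonneg {σ D : ℝ} (hD : 0 ≤ D) : 0 ≤ edgeWeight σ D := by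
  have : Real.exp (-(Real.pi * D / σ ^ 2)) ≤ 1 := Real.exp_le_one_iff.2 (by
    have : 0 ≤ Real.pi * D / σ ^ 2 := by positivity
    linarith)
  have : 0 ≤ 1 - Real.exp (-(Real.pi * D / σ ^ 2)) := by linarith
  unfold edgeWeight; positivity

/-- The tail carries a term in `(b/d) · edgeWeight` that has to be paid for. If `b ≤ 0.42 d`, it is
at most `1.68 π edgeWeight`, which `norm_defect_le` saves by averaging over the detuning. For larger
`b` only the cubic branch of `epsTwo` can occur, and the gap between the constants `16.18` and
`17.9` covers it. -/
theorem exists_alias_add_tail_le {d : ℕ} {σ n₀ : ℝ} (k₀ : ℝ) {b : ℝ} (hσ : σ ∈ Set.Ioo (0 : ℝ) d)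
    (hn₀ : n₀ ∈ Set.Ioo (0 : ℝ) ((d : ℝ) - 1)) (hb : 0 < b) :
    ∃ η, 0 < η ∧
      normConst d σ k₀ * (aliasBound σ (alpha d n₀) (2 * Real.pi * b / d) η +
        2 * (2 * Real.pi * b / d) * edgeWeight σ d) ≤
      epsTwo d σ n₀ k₀ b + normConst d σ k₀ * (168 / 100 * Real.pi * edgeWeight σ d) := by
  have hσ0 := hσ.1
  have ha0 := alpha_pos hn₀
  have ha1 := alpha_le_one hn₀
  have hpi := Real.pi_gt_d2
  have hpi0 := Real.pi_pos
  have hd2 : (2 : ℝ) ≤ d := by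
    have h1 : 1 < (d : ℝ) := by linarith [hn₀.1, hn₀.2]
    have : 1 < d := by exact_mod_cast h1
    exact_mod_cast this
  have hd0 : (0 : ℝ) < d := by linarith
  set A := normConst d σ k₀ with hA
  have hA0 : 0 ≤ A := normConst_nonneg _ _ _
  have hW0 : 0 ≤ edgeWeight σ d := edgeWeight_nonneg hd0.le
  set W := edgeWeight σ d with hW
  set a := alpha d n₀ with haa
  have hsmall : b ≤ 42 / 100 * d →
      2 * (2 * Real.pi * b / d) * W ≤ 168 / 100 * Real.pi * W := by
    intro h
    refine mul_le_mul_of_nonneg_right ?_ hW0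
    rw [← mul_div_assoc, div_le_iff₀ hd0]
    nlinarith
  unfold epsTwo
  split_ifs with hcase
  · obtain ⟨hN, hrate⟩ := hcase
    set L := Real.log (Real.pi * a ^ 2 * σ ^ 2 / 2) with hL
    set M := Real.pi * a ^ 2 * σ ^ 2 / 2 with hM
    have hk0 : 0 < kappa := by norm_num [kappa]
    have hρ : rate d σ n₀ b = Real.pi * a * kappa * b / L := rfl
    set ρ := rate d σ n₀ b with hρ'
    set r := ρ * σ ^ 2 / d + 1 with hr
    have hr1 : 1 ≤ r := by
      have : 0 ≤ ρ * σ ^ 2 / d := by positivity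
      rw [hr]; linarith
    have hr0 : 0 < r := by linarith
    have hM0 : 0 < M := by positivity
    -- In terms of `r` and `M` the condition `𝒩 ≥ 8` reads `8 r² ≤ M`.
    have hdec : Real.pi * a ^ 2 / (2 * (ρ + d / σ ^ 2) ^ 2) * (d / σ) ^ 2 = M / r ^ 2 := by
      have : ρ + d / σ ^ 2 = r * (d / σ ^ 2) := by rw [hr]; field_simp
      rw [this, hM]; field_simp
    have hK : 8 * r ^ 2 ≤ M := by
      have h1 := Int.le_floor.1 hN
      rw [← haa, ← hρ', hdec] at h1
      rw [le_div_iff₀ (by positivity)] at h1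
      exact_mod_cast h1
    -- `M ≥ 8` also excludes `L = 0`, where the division in `rate` returns the default value zero.
    have hL0 : 0 < L := Real.log_pos (by nlinarith)
    have hr' : r = 1 + kappa * (Real.pi * a * b * σ ^ 2 / d) / L := by
      rw [hr, hρ]; field_simp; ring
    obtain ⟨hbd, η, hη, hle⟩ := exists_aliasBound_le_exp hσ0 ha0 ha1 hb hd0 hL0 hL hr' hK
    refine ⟨η, hη, ?_⟩
    have hexp : -(Real.pi / 4) * (a ^ 2 / (d / σ ^ 2 + ρ) ^ 2) * (d / σ) ^ 2 =
        -(M / (2 * r ^ 2)) := by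
      have : d / σ ^ 2 + ρ = r * (d / σ ^ 2) := by rw [hr]; field_simp; ring
      rw [this, hM]; field_simp; norm_num
    rw [hexp, mul_add]
    refine add_le_add ?_ (mul_le_mul_of_nonneg_left (hsmall hbd) hA0)
    refine (mul_le_mul_of_nonneg_left hle hA0).trans_eq ?_
    ring
  · obtain ⟨hl1, hl2⟩ := mode_constant_bounds
    set lam := kappa * √(6 * Real.pi) / Real.log 3 with hlam
    set X := lam * b / d + 1 / σ with hX
    have hlam0 : 0 < lam := by linarith
    have hX0 : 0 < X := by positivity
    refine ⟨1 / (2 * X), by positivity, ?_⟩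
    have hle := aliasBound_le_cubic hσ0 ha0 ha1 hb.le hd0 hl1 hl2
    have hpre := prefactor_bound
    set C := (3 : ℝ) ^ ((7 : ℝ) / 4) / (√(2 * Real.pi) * Real.exp 1) with hC
    have hE : C * (A * (8 + Real.pi ^ 2) / a ^ 3) * (lam * b + d / σ) ^ 3 * (σ / (d : ℝ) ^ 3) =
        A * (C * (8 + Real.pi ^ 2) * (σ * (X / a) ^ 3)) := by
      have : lam * b + d / σ = d * X := by rw [hX]; field_simp
      rw [this]; field_simp
    rw [hE, ← mul_add]
    refine mul_le_mul_of_nonneg_left ?_ hA0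
    set u := X / a with hu
    have hu0 : 0 < u := by positivity
    have h1 : 179 / 10 * (σ * u ^ 3) ≤ C * (8 + Real.pi ^ 2) * (σ * u ^ 3) := by
      refine mul_le_mul_of_nonneg_right ?_ (by positivity)
      linarith
    rcases le_or_gt b (42 / 100 * d) with hbd | hbd
    · have : 0 ≤ σ * u ^ 3 := by positivity
      linarith [hsmall hbd]
    · have hWσ : W ≤ 6 / 10 * σ := tail_factor_le hσ0 hσ.2.le hd2
      have hbd' : 42 / 100 ≤ b / d := by rw [le_div_iff₀ hd0]; exact hbd.le
      set β := b / d with hβ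
      have hβ0 : 0 < β := by positivity
      have hu1 : 312 / 100 * β ≤ u := by
        rw [hu, le_div_iff₀ ha0, hX, mul_div_assoc, ← hβ]
        have : 312 / 100 * β * a ≤ 312 / 100 * β * 1 := by gcongr
        have : 312 / 100 * β ≤ lam * β := by gcongr
        have : 0 < 1 / σ := by positivity
        linarith
      -- `3.12³ · 0.42² > 5.35`. The spare `1.72 · 5.35 σβ` then exceeds the tail term, at most
      -- `7.56 σβ`.
      have hu3 : 535 / 100 * β ≤ u ^ 3 := by
        have h2 : (312 / 100 * β) ^ 3 ≤ u ^ 3 := by gcongr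
        have h3 : (312 / 100 * (42 / 100)) ^ 2 * (312 / 100 * β) ≤ (312 / 100 * β) ^ 3 := by
          have : (312 / 100 * (42 / 100)) ^ 2 ≤ (312 / 100 * β) ^ 2 := by gcongr
          calc _ ≤ (312 / 100 * β) ^ 2 * (312 / 100 * β) := by gcongr
            _ = _ := by ring
        nlinarith
      have h2 : 2 * (2 * Real.pi * b / d) * W ≤ 2 * (2 * (315 / 100) * β) * (6 / 10 * σ) := by
        rw [mul_div_assoc, ← hβ]
        gcongr
        linarith [Real.pi_lt_d2]
      have h3 : σ * (535 / 100 * β) ≤ σ * u ^ 3 := by gcongr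
      have h4 : 0 ≤ 168 / 100 * Real.pi * W := by positivity
      have h5 : 0 < σ * β := by positivity
      linarith

/-! ### The time states -/

theorem timeState_add_natCast {d : ℕ} (hd : 0 < d) (k : ℤ) :
    timeState d (k + d) = timeState d k := by
  have hd' : (d : ℂ) ≠ 0 := by exact_mod_cast hd.ne'
  ext n
  unfold timeState
  congr 1
  rw [Complex.exp_eq_exp_iff_exists_int]
  refine ⟨-(n : ℤ), ?_⟩
  push_cast
  field_simp
  ring

theorem star_timeState_mul (d : ℕ) (j k : ℤ) (n : Fin d) :
    star (timeState d j) n * timeState d k n =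
      (1 / d : ℂ) * Complex.exp (2 * Real.pi * Complex.I * ((j - k : ℤ) : ℂ) / d) ^ (n : ℕ) := by
  rw [Pi.star_apply, timeState, timeState, star_mul', ← Complex.exp_nat_mul, RCLike.star_def,
    Complex.conj_ofReal, ← Complex.exp_conj, mul_mul_mul_comm, ← Complex.exp_add]
  congr 1
  · rw [← Complex.ofReal_mul, div_mul_div_comm, one_mul, Real.mul_self_sqrt (Nat.cast_nonneg _)]
    push_cast; rfl
  · congr 1
    simp only [map_neg, map_mul, Complex.conj_I, Complex.conj_ofReal]
    push_cast
    ring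

theorem star_timeState_dotProduct {d : ℕ} (hd : 0 < d) (j k : ℤ) :
    star (timeState d j) ⬝ᵥ timeState d k = if (d : ℤ) ∣ j - k then 1 else 0 := by
  have hd' : (d : ℂ) ≠ 0 := by exact_mod_cast hd.ne'
  rw [dotProduct]
  simp_rw [star_timeState_mul]
  rw [← Finset.mul_sum, Fin.sum_univ_eq_sum_range
    (fun n => Complex.exp (2 * Real.pi * Complex.I * ((j - k : ℤ) : ℂ) / d) ^ n) d]
  set z := Complex.exp (2 * Real.pi * Complex.I * ((j - k : ℤ) : ℂ) / d) with hz
  have hzd : z ^ d = 1 := by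
    rw [hz, ← Complex.exp_nat_mul, Complex.exp_eq_one_iff]
    exact ⟨j - k, by field_simp⟩
  have hz1 : z = 1 ↔ (d : ℤ) ∣ j - k := by
    rw [hz, Complex.exp_eq_one_iff]
    constructor
    · rintro ⟨m, hm⟩
      refine ⟨m, ?_⟩
      have h2 : (2 * Real.pi * Complex.I : ℂ) ≠ 0 := Complex.two_pi_I_ne_zero
      field_simp at hm
      have h3 : ((j - k : ℤ) : ℂ) = ((d * m : ℤ) : ℂ) := by
        push_cast at hm ⊢
        exact hm
      exact_mod_cast h3
    · rintro ⟨m, hm⟩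
      refine ⟨m, ?_⟩
      rw [hm]; push_cast; field_simp
  split_ifs with h
  · rw [hz1.2 h]; simp [hd']
  · have hne : z ≠ 1 := fun h' => h (hz1.1 h')
    rw [geom_sum_eq hne, hzd]; simp

/-- The sum defining `potOp` runs over one period only, but `θ_k` and the potential are both
`d`-periodic in `k`. Reducing `k` modulo `d` leaves a single term by orthonormality, so windows may
lie anywhere in `ℤ`. -/
theorem potOp_mulVec_timeState {d : ℕ} (hd : 0 < d) (T₀ : ℝ) {V₀ : ℝ → ℝ}
    (hV : Function.Periodic V₀ (2 * Real.pi)) (k : ℤ) :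
    potOp d T₀ V₀ *ᵥ timeState d k =
      ((d / T₀ * stretchedPot d V₀ k : ℝ) : ℂ) • timeState d k := by
  have hd' : (d : ℤ) ≠ 0 := by exact_mod_cast hd.ne'
  have hdr : (d : ℝ) ≠ 0 := by exact_mod_cast hd.ne'
  unfold potOp
  rw [Matrix.sum_mulVec]
  simp_rw [Matrix.smul_mulVec, Matrix.vecMulVec_mulVec]
  obtain ⟨m, hm⟩ : ∃ m : ℕ, (m : ℤ) = k % d :=
    ⟨(k % d).toNat, Int.toNat_of_nonneg (Int.emod_nonneg _ hd')⟩
  have hmd : m < d := by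
    have := Int.emod_lt_of_pos k (by exact_mod_cast hd : (0 : ℤ) < d)
    omega
  have hkm : k = m + d * (k / d) := by rw [hm]; exact (Int.emod_add_mul_ediv k d).symm
  have hst : timeState d k = timeState d m := by
    have hper : Function.Periodic (timeState d) (d : ℤ) := timeState_add_natCast hd
    rw [hkm, mul_comm]
    exact hper.int_mul (k / d) m
  have hpot : stretchedPot d V₀ k = stretchedPot d V₀ m := by
    unfold stretchedPot
    congr 1
    have : 2 * Real.pi * (k : ℝ) / d = 2 * Real.pi * m / d + (k / (d : ℤ) : ℤ) * (2 * Real.pi) := by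
      conv_lhs => rw [hkm]
      push_cast
      field_simp
    rw [this]
    exact hV.int_mul (k / d) _
  rw [Finset.sum_eq_single m]
  · rw [hst, star_timeState_dotProduct hd, hpot]
    simp
  · intro j hj hne
    rw [star_timeState_dotProduct hd, if_neg]
    · simp
    · intro hdvd
      apply hne
      have h1 : (d : ℤ) ∣ (j : ℤ) - m := by
        have : (j : ℤ) - m = (j - k) + d * (k / d) := by linarith
        rw [this]; exact hdvd.add (dvd_mul_right _ _)
      have hj' := Finset.mem_range.1 hj
      have h2 := Int.eq_zero_of_abs_lt_dvd h1 (by rw [abs_lt]; omega)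
      omega
  · intro h; exact absurd (Finset.mem_range.2 hmd) h

/-- A superposition of `d` consecutive time states, starting at `θ_{M}`. -/
noncomputable def timeSum (d : ℕ) (M : ℤ) (c : ℕ → ℂ) : Fin d → ℂ :=
  ∑ j ∈ Finset.range d, c j • timeState d (M + j)

theorem star_timeSum_dotProduct {d : ℕ} (hd : 0 < d) (M : ℤ) (c c' : ℕ → ℂ) :
    star (timeSum d M c) ⬝ᵥ timeSum d M c' = ∑ j ∈ Finset.range d, star (c j) * c' j := by
  unfold timeSum
  rw [star_sum, sum_dotProduct]
  refine Finset.sum_congr rfl fun i hi => ?_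
  rw [dotProduct_sum, Finset.sum_eq_single i]
  · rw [star_smul, smul_dotProduct, dotProduct_smul, star_timeState_dotProduct hd]
    simp
  · intro j hj hne
    rw [star_smul, smul_dotProduct, dotProduct_smul, star_timeState_dotProduct hd, if_neg]
    · simp
    · intro hdvd
      apply hne
      have hi' := Finset.mem_range.1 hi
      have hj' := Finset.mem_range.1 hj
      have h2 := Int.eq_zero_of_abs_lt_dvd hdvd (by rw [abs_lt]; omega)
      omega
  · intro h; exact absurd hi h

theorem sum_Ioc_eq_sum_range {M : Type*} [AddCommMonoid M] (f : ℤ → M) (N : ℤ) (d : ℕ) :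
    ∑ k ∈ Finset.Ioc N (N + d), f k = ∑ j ∈ Finset.range d, f (N + 1 + j) := by
  symm
  refine Finset.sum_bij (fun j _ => N + 1 + (j : ℤ)) ?_ ?_ ?_ ?_
  · intro j hj
    rw [Finset.mem_range] at hj
    rw [Finset.mem_Ioc]; omega
  · intro i _ j _ h
    omega
  · intro k hk
    rw [Finset.mem_Ioc] at hk
    exact ⟨(k - N - 1).toNat, by rw [Finset.mem_range]; omega, by omega⟩
  · intro j _; rfl

theorem window_eq_Ioc (d : ℕ) (y : ℝ) :
    window d y = Finset.Ioc ⌊y - d / 2⌋ (⌊y - d / 2⌋ + d) := by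
  unfold window
  congr 1
  rw [← Int.floor_add_natCast]
  congr 1
  ring

theorem sum_window_eq_sum_range {M : Type*} [AddCommMonoid M] (f : ℤ → M) (d : ℕ) (y : ℝ) :
    ∑ k ∈ window d y, f k = ∑ j ∈ Finset.range d, f (⌊y - d / 2⌋ + 1 + j) := by
  rw [window_eq_Ioc, sum_Ioc_eq_sum_range]

theorem clockState_eq_timeSum (d : ℕ) (σ n₀ k₀ : ℝ) :
    clockState d σ n₀ k₀ = timeSum d (⌊k₀ - d / 2⌋ + 1)
      fun j => psiNor d σ n₀ k₀ ((⌊k₀ - d / 2⌋ + 1 + j : ℤ) : ℝ) := by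
  rw [clockState, sum_window_eq_sum_range]; rfl

theorem clockHam_isHermitian (d : ℕ) (T₀ : ℝ) : (clockHam d T₀).IsHermitian := by
  unfold clockHam
  rw [Matrix.IsHermitian, Matrix.diagonal_conjTranspose]
  congr 1
  ext n
  simp

theorem potOp_isHermitian (d : ℕ) (T₀ : ℝ) (V₀ : ℝ → ℝ) : (potOp d T₀ V₀).IsHermitian := by
  unfold potOp
  rw [Matrix.IsHermitian, Matrix.conjTranspose_sum]
  refine Finset.sum_congr rfl fun j _ => ?_
  rw [Matrix.conjTranspose_smul, Matrix.conjTranspose_vecMulVec, star_star, RCLike.star_def,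
    Complex.conj_ofReal]

/-! ### The ideally translated clock state and its defect in the Schrödinger equation -/

open Complex in
/-- The phase accumulated at the (real) clock position `x` after translating the clock by `Δ`, for
an interaction energy `Ω`. -/
noncomputable def accPhase (d : ℕ) (V₀ : ℝ → ℝ) (Ω Δ x : ℝ) : ℝ :=
  Ω * ∫ z in (2 * Real.pi / d * (x - Δ))..(2 * Real.pi / d * x), V₀ z

section
variable {d : ℕ} {V₀ : ℝ → ℝ}

theorem hasDerivAt_primitive (hV : Continuous V₀) (u : ℝ) :
    HasDerivAt (fun u => ∫ z in (0 : ℝ)..u, V₀ z) (V₀ u) u :=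
  intervalIntegral.integral_hasDerivAt_right (hV.intervalIntegrable _ _)
    hV.aestronglyMeasurable.stronglyMeasurableAtFilter hV.continuousAt

theorem accPhase_eq (hV : Continuous V₀) (Ω Δ x : ℝ) :
    accPhase d V₀ Ω Δ x = Ω * ((∫ z in (0 : ℝ)..(2 * Real.pi / d * x), V₀ z) -
      ∫ z in (0 : ℝ)..(2 * Real.pi / d * (x - Δ)), V₀ z) := by
  rw [accPhase, intervalIntegral.integral_interval_sub_left] <;> exact hV.intervalIntegrable _ _

theorem hasDerivAt_accPhase (hV : Continuous V₀) (Ω Δ x : ℝ) :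
    HasDerivAt (accPhase d V₀ Ω Δ) (Ω * (2 * Real.pi / d) *
      (V₀ (2 * Real.pi / d * x) - V₀ (2 * Real.pi / d * (x - Δ)))) x := by
  rw [show accPhase d V₀ Ω Δ = _ from funext fun x => accPhase_eq hV Ω Δ x]
  have h1 := (hasDerivAt_primitive hV (2 * Real.pi / d * x)).comp x
    ((hasDerivAt_id' x).const_mul (2 * Real.pi / (d : ℝ)))
  have h2 := (hasDerivAt_primitive hV (2 * Real.pi / d * (x - Δ))).comp x
    (((hasDerivAt_id' x).sub_const Δ).const_mul (2 * Real.pi / (d : ℝ)))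
  refine ((h1.sub h2).const_mul Ω).congr_deriv ?_
  ring

theorem hasDerivAt_accPhase_shift (hV : Continuous V₀) (Ω Δ x : ℝ) :
    HasDerivAt (fun Δ => accPhase d V₀ Ω Δ x)
      (Ω * (2 * Real.pi / d) * V₀ (2 * Real.pi / d * (x - Δ))) Δ := by
  rw [show (fun Δ => accPhase d V₀ Ω Δ x) = _ from funext fun Δ => accPhase_eq hV Ω Δ x]
  have h2 := (hasDerivAt_primitive hV (2 * Real.pi / d * (x - Δ))).comp Δ
    (((hasDerivAt_id' Δ).const_sub x).const_mul (2 * Real.pi / (d : ℝ)))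
  refine ((h2.const_sub _).const_mul Ω).congr_deriv ?_
  ring

theorem contDiff_accPhase (hV : ContDiff ℝ ∞ V₀) (Ω Δ : ℝ) :
    ContDiff ℝ ∞ (accPhase d V₀ Ω Δ) := by
  rw [contDiff_infty_iff_deriv]
  refine ⟨fun x => (hasDerivAt_accPhase hV.continuous Ω Δ x).differentiableAt, ?_⟩
  rw [show deriv (accPhase d V₀ Ω Δ) = _ from
    funext fun x => (hasDerivAt_accPhase hV.continuous Ω Δ x).deriv]
  fun_prop

/-- Periodicity carries the bound from `[0, 2π]` to the line; raising to the power `p + 1` undoes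
the root. -/
theorem abs_iteratedDeriv_le {b : ℝ} (hV_per : Function.Periodic V₀ (2 * Real.pi))
    (hb : IsDerivBound (fun x => Real.pi * V₀ x) b) (p : ℕ) (x : ℝ) :
    2 * (Real.pi * |iteratedDeriv p V₀ x|) ≤ b ^ (p + 1) := by
  have hper : Function.Periodic (iteratedDeriv p V₀) (2 * Real.pi) := fun t => by
    have h := congrFun (iteratedDeriv_comp_add_const p V₀ (2 * Real.pi)) t
    rw [show (fun z => V₀ (z + 2 * Real.pi)) = V₀ from funext hV_per] at h
    exact h.symm
  obtain ⟨x', hx', hxx⟩ := hper.exists_mem_Ico₀ Real.two_pi_pos x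
  have h1 := hb p x' ⟨hx'.1, hx'.2.le⟩
  rw [iteratedDeriv_const_mul_field, abs_mul, abs_of_pos Real.pi_pos] at h1
  rw [hxx]
  set v := 2 * (Real.pi * |iteratedDeriv p V₀ x'|) with hv
  have hv0 : 0 ≤ v := by positivity
  have h2 : (v ^ ((1 : ℝ) / ((p : ℝ) + 1))) ^ (p + 1) ≤ b ^ (p + 1) := by gcongr
  rw [← Real.rpow_natCast, ← Real.rpow_mul hv0] at h2
  push_cast at h2
  rwa [one_div_mul_cancel (by positivity), Real.rpow_one] at h2

/-- Each derivative is a difference of two values of a derivative of `V₀`; the factor `2` in the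
definition of `b` pays for the two terms and the factor `π` in `π V₀` for `|Ω|`. The bound does not
depend on `Δ`. -/
theorem abs_iteratedDeriv_accPhase_le {b : ℝ} (hV : ContDiff ℝ ∞ V₀)
    (hV_per : Function.Periodic V₀ (2 * Real.pi))
    (hb : IsDerivBound (fun x => Real.pi * V₀ x) b) {Ω : ℝ} (hΩ : |Ω| ≤ Real.pi) (Δ : ℝ) (k : ℕ)
    (x : ℝ) : |iteratedDeriv (k + 1) (accPhase d V₀ Ω Δ) x| ≤ (2 * Real.pi * b / d) ^ (k + 1) := by
  have hk : ContDiff ℝ k V₀ := hV.of_le (by exact_mod_cast le_top)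
  set c := 2 * Real.pi / (d : ℝ) with hc
  have hc0 : 0 ≤ c := by positivity
  have h1 : iteratedDeriv k (fun x => V₀ (c * x)) = fun x => c ^ k * iteratedDeriv k V₀ (c * x) :=
    iteratedDeriv_comp_const_mul hk c
  have h2 : iteratedDeriv k (fun x => V₀ (c * (x - Δ))) =
      fun x => c ^ k * iteratedDeriv k V₀ (c * (x - Δ)) := by
    have := iteratedDeriv_comp_sub_const k (fun x => V₀ (c * x)) Δ
    rw [this, h1]
  rw [iteratedDeriv_succ', show deriv (accPhase d V₀ Ω Δ) = _ from
    funext fun x => (hasDerivAt_accPhase hV.continuous Ω Δ x).deriv,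
    iteratedDeriv_const_mul_field]
  have h3 := iteratedDeriv_sub (n := k) (x := x) (f := fun x => V₀ (c * x))
    (g := fun x => V₀ (c * (x - Δ))) (by fun_prop) (by fun_prop)
  have h4 : iteratedDeriv k (fun x => V₀ (c * x) - V₀ (c * (x - Δ))) x =
      c ^ k * iteratedDeriv k V₀ (c * x) - c ^ k * iteratedDeriv k V₀ (c * (x - Δ)) := by
    rw [h1, h2] at h3; exact h3
  rw [h4, ← mul_sub, abs_mul, abs_mul, abs_mul, abs_of_nonneg hc0, abs_of_nonneg (pow_nonneg hc0 k)]
  have h5 := abs_sub (iteratedDeriv k V₀ (c * x)) (iteratedDeriv k V₀ (c * (x - Δ)))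
  have h6 := abs_iteratedDeriv_le hV_per hb k (c * x)
  have h7 := abs_iteratedDeriv_le hV_per hb k (c * (x - Δ))
  calc _ ≤ Real.pi * c * (c ^ k * (|iteratedDeriv k V₀ (c * x)| +
        |iteratedDeriv k V₀ (c * (x - Δ))|)) := by gcongr
    _ = c ^ (k + 1) * (Real.pi * |iteratedDeriv k V₀ (c * x)| +
        Real.pi * |iteratedDeriv k V₀ (c * (x - Δ))|) := by ring
    _ ≤ c ^ (k + 1) * b ^ (k + 1) := by gcongr; linarith
    _ = _ := by rw [← mul_pow, hc]; ring

/-- The amplitude at clock position `x` of the state that the clock ideally has after being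
translated by `Δ`. -/
noncomputable def amp (d : ℕ) (σ n₀ k₀ : ℝ) (V₀ : ℝ → ℝ) (Ω Δ x : ℝ) : ℂ :=
  psiNor d σ n₀ k₀ (x - Δ) * Complex.exp (-(Complex.I * (accPhase d V₀ Ω Δ x : ℂ)))

/-- The derivative of `amp` with respect to the translation. -/
noncomputable def ampShiftDeriv (d : ℕ) (σ n₀ k₀ : ℝ) (V₀ : ℝ → ℝ) (Ω Δ x : ℝ) : ℂ :=
  amp d σ n₀ k₀ V₀ Ω Δ x * (((2 * Real.pi / σ ^ 2 * (x - Δ - k₀) : ℝ) : ℂ) - Complex.I *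
    ((2 * Real.pi * n₀ / d + Ω * (2 * Real.pi / d) * V₀ (2 * Real.pi / d * (x - Δ)) : ℝ) : ℂ))

theorem hasDerivAt_amp (hV : Continuous V₀) (σ n₀ k₀ Ω Δ x : ℝ) :
    HasDerivAt (fun Δ => amp d σ n₀ k₀ V₀ Ω Δ x) (ampShiftDeriv d σ n₀ k₀ V₀ Ω Δ x) Δ := by
  have h0 : HasDerivAt (fun Δ : ℝ => x - Δ - k₀) (-1) Δ :=
    ((hasDerivAt_id' Δ).const_sub x).sub_const k₀
  have h1 : HasDerivAt (fun Δ : ℝ => Real.exp (-(Real.pi / σ ^ 2) * (x - Δ - k₀) ^ 2))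
      (Real.exp (-(Real.pi / σ ^ 2) * (x - Δ - k₀) ^ 2) *
        (2 * Real.pi / σ ^ 2 * (x - Δ - k₀))) Δ := by
    refine (((h0.fun_pow 2).const_mul (-(Real.pi / σ ^ 2))).exp).congr_deriv ?_
    norm_num
    ring_nf
  have h2 : HasDerivAt (fun Δ : ℝ => 2 * Real.pi * n₀ * (x - Δ - k₀) / d)
      (-(2 * Real.pi * n₀ / d)) Δ := by
    refine ((h0.const_mul (2 * Real.pi * n₀)).div_const (d : ℝ)).congr_deriv ?_
    ring
  have h3 := (h2.ofReal_comp.const_mul Complex.I).cexp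
  have h4 := ((hasDerivAt_accPhase_shift (d := d) hV Ω Δ x).ofReal_comp.const_mul
    Complex.I).fun_neg.cexp
  have h5 := ((h1.ofReal_comp.const_mul (normConst d σ k₀ : ℂ)).mul h3).mul h4
  refine h5.congr_deriv ?_
  unfold ampShiftDeriv amp psiNor
  push_cast
  simp only [Pi.mul_apply]
  ring

/-- The time states dress the amplitude into a modulated Gaussian with detuned frequency. -/
theorem amp_mul_timeState (σ n₀ k₀ Ω Δ : ℝ) (hd : 0 < d) (n : Fin d) (k : ℤ) :
    amp d σ n₀ k₀ V₀ Ω Δ k * timeState d k n =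
      ((1 / √(d : ℝ) * normConst d σ k₀ : ℝ) : ℂ) *
        Complex.exp (-(Complex.I * ((2 * Real.pi * n₀ * (k₀ + Δ) / d : ℝ) : ℂ))) *
        modGauss σ (k₀ + Δ) ((n₀ - n) / d) (accPhase d V₀ Ω Δ) k := by
  unfold amp psiNor timeState modGauss
  have hd' : (d : ℂ) ≠ 0 := by exact_mod_cast hd.ne'
  rw [Complex.ofReal_exp]
  have : ∀ A B : ℂ, ∀ a b c e f g : ℂ, a + b + c + e = f + g →
      A * Complex.exp a * Complex.exp b * Complex.exp c * (B * Complex.exp e) =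
        B * A * Complex.exp f * Complex.exp g := by
    intro A B a b c e f g h
    have h' : Complex.exp a * Complex.exp b * Complex.exp c * Complex.exp e =
        Complex.exp f * Complex.exp g := by
      rw [← Complex.exp_add, ← Complex.exp_add, ← Complex.exp_add, ← Complex.exp_add, h]
    linear_combination A * B * h'
  rw [Complex.ofReal_mul (1 / √(d : ℝ))]
  apply this
  push_cast
  field_simp
  ring

end

/-- The clock Hamiltonian in an eigenspace of the interaction, with eigenvalue `Ω`. -/
noncomputable def sectorHam (d : ℕ) (T₀ : ℝ) (V₀ : ℝ → ℝ) (Ω : ℝ) : Matrix (Fin d) (Fin d) ℂ :=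
  clockHam d T₀ + (Ω : ℂ) • potOp d T₀ V₀

theorem sectorHam_isHermitian (d : ℕ) (T₀ : ℝ) (V₀ : ℝ → ℝ) (Ω : ℝ) :
    (sectorHam d T₀ V₀ Ω).IsHermitian := by
  refine (clockHam_isHermitian d T₀).add ?_
  rw [Matrix.IsHermitian, Matrix.conjTranspose_smul, (potOp_isHermitian d T₀ V₀).eq,
    RCLike.star_def, Complex.conj_ofReal]

variable {d : ℕ} {V₀ : ℝ → ℝ}

theorem sectorHam_mulVec_timeSum (hd : 0 < d) (T₀ : ℝ) (hV : Function.Periodic V₀ (2 * Real.pi))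
    (Ω : ℝ) (M : ℤ) (c : ℕ → ℂ) (n : Fin d) :
    (sectorHam d T₀ V₀ Ω *ᵥ timeSum d M c) n = ∑ j ∈ Finset.range d,
      c j * (((n : ℝ) * (2 * Real.pi / T₀) : ℝ) + ((Ω * (d / T₀ * stretchedPot d V₀ (M + j : ℤ)) : ℝ)
        : ℂ)) * timeState d (M + j) n := by
  unfold timeSum
  rw [Matrix.mulVec_sum, Finset.sum_apply]
  refine Finset.sum_congr rfl fun j _ => ?_
  rw [Matrix.mulVec_smul, sectorHam, Matrix.add_mulVec, Matrix.smul_mulVec,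
    potOp_mulVec_timeState hd T₀ hV, clockHam]
  simp only [Pi.smul_apply, Pi.add_apply, Matrix.mulVec_diagonal, smul_eq_mul]
  push_cast
  ring

/-- The defect of the ideally translated state as a solution of the Schrödinger equation. -/
theorem schroedinger_defect (hd : 0 < d) {T₀ : ℝ} (hT₀ : 0 < T₀) (hV : Continuous V₀)
    (hV_per : Function.Periodic V₀ (2 * Real.pi)) (σ n₀ k₀ Ω Δ : ℝ) (M : ℤ) (n : Fin d) :
    timeSum d M (fun j => ampShiftDeriv d σ n₀ k₀ V₀ Ω Δ ((M + j : ℤ) : ℝ)) n +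
      Complex.I * ((T₀ / d : ℝ) : ℂ) * (sectorHam d T₀ V₀ Ω *ᵥ
        timeSum d M (fun j => amp d σ n₀ k₀ V₀ Ω Δ ((M + j : ℤ) : ℝ))) n =
    -(((1 / √(d : ℝ) * normConst d σ k₀ : ℝ) : ℂ) *
        Complex.exp (-(Complex.I * ((2 * Real.pi * n₀ * (k₀ + Δ) / d : ℝ) : ℂ))) *
      ∑ j ∈ Finset.range d, modGaussDeriv σ (k₀ + Δ) ((n₀ - n) / d) (accPhase d V₀ Ω Δ)
        ((M + j : ℤ) : ℝ)) := by
  have hd' : (d : ℂ) ≠ 0 := by exact_mod_cast hd.ne'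
  have hT' : (T₀ : ℂ) ≠ 0 := by exact_mod_cast hT₀.ne'
  rw [sectorHam_mulVec_timeSum hd T₀ hV_per, timeSum, Finset.sum_apply, Finset.mul_sum,
    Finset.mul_sum, ← Finset.sum_add_distrib, ← Finset.sum_neg_distrib]
  -- The identity holds term by term: the potential at `x - Δ` cancels between the shift derivative
  -- and the derivative of the phase, and the clock energy accounts for the detuning by `n`.
  refine Finset.sum_congr rfl fun j _ => ?_
  set k : ℤ := M + j
  have h1 := amp_mul_timeState (V₀ := V₀) σ n₀ k₀ Ω Δ hd n k
  rw [Pi.smul_apply, smul_eq_mul, modGaussDeriv, ← mul_assoc (((1 / √(d : ℝ) *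
    normConst d σ k₀ : ℝ) : ℂ) * _) (modGauss _ _ _ _ _), ← h1, ampShiftDeriv,
    (hasDerivAt_accPhase (d := d) hV Ω Δ k).deriv, stretchedPot,
    show 2 * Real.pi * (k : ℝ) / d = 2 * Real.pi / d * k by ring]
  push_cast
  field_simp
  ring

/-- The root mean square of the detuning over the energy levels is at most `1/√3 < 0.58`. Averaging,
instead of taking the largest detuning, frees the room needed for the tail term in `b`. -/
theorem norm_toLp_le_of_detuning {n₀ : ℝ} (hn₀ : n₀ ∈ Set.Ioo (0 : ℝ) ((d : ℝ) - 1))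
    {α β : ℝ} (hα : 0 ≤ α) (hβ : 0 ≤ β) {v : Fin d → ℂ}
    (hv : ∀ n, ‖v n‖ ≤ 1 / √(d : ℝ) * (α + β * |(n₀ - n) / d|)) :
    ‖WithLp.toLp 2 v‖ ≤ α + 58 / 100 * β := by
  have hd1 : (1 : ℝ) < d := by linarith [hn₀.1, hn₀.2]
  have hd0 : (0 : ℝ) < d := by linarith
  rw [EuclideanSpace.norm_eq]
  apply Real.sqrt_le_iff.2
  refine ⟨by positivity, ?_⟩
  have hsum : ∀ m : ℕ, ∑ n ∈ Finset.range m, (n₀ - n) ^ 2 =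
      m * n₀ ^ 2 - n₀ * (m * (m - 1)) + (m - 1) * m * (2 * m - 1) / 6 := by
    intro m
    induction m with
    | zero => simp
    | succ m ih => rw [Finset.sum_range_succ, ih]; push_cast; ring
  have hsq : ∑ n : Fin d, ((n₀ - n) / d) ^ 2 ≤ d / 3 := by
    simp_rw [div_pow]
    rw [← Finset.sum_div, Fin.sum_univ_eq_sum_range (fun n : ℕ => (n₀ - n) ^ 2) d, hsum,
      div_le_iff₀ (by positivity)]
    have h1 : d * n₀ ^ 2 - n₀ * (d * (d - 1)) ≤ 0 := by
      have := mul_nonneg (mul_nonneg hd0.le hn₀.1.le) (by linarith [hn₀.2] : 0 ≤ (d : ℝ) - 1 - n₀)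
      linarith
    nlinarith
  have habs : ∑ n : Fin d, |(n₀ - n) / d| ≤ 58 / 100 * d := by
    -- The tangent bound for the square at `q = 0.58`.
    have : ∀ n : Fin d, |(n₀ - n) / d| ≤ ((n₀ - n) / d) ^ 2 * (50 / 58) + 29 / 100 := by
      intro n
      rw [← sq_abs ((n₀ - n) / d)]
      generalize |(n₀ - n) / d| = q
      nlinarith [sq_nonneg (q - 58 / 100)]
    refine (Finset.sum_le_sum fun n _ => this n).trans ?_
    rw [Finset.sum_add_distrib, ← Finset.sum_mul]
    simp only [Finset.sum_const, Finset.card_univ, Fintype.card_fin, nsmul_eq_mul]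
    linarith
  calc ∑ n : Fin d, ‖v n‖ ^ 2
      ≤ ∑ n : Fin d, (1 / √(d : ℝ) * (α + β * |(n₀ - n) / d|)) ^ 2 := by
        gcongr with n
        exact hv n
    _ = 1 / d * ∑ n : Fin d, (α ^ 2 + 2 * α * β * |(n₀ - n) / d| +
          β ^ 2 * ((n₀ - n) / d) ^ 2) := by
        rw [Finset.mul_sum]
        refine Finset.sum_congr rfl fun n _ => ?_
        rw [mul_pow, div_pow, Real.sq_sqrt hd0.le, ← sq_abs ((n₀ - n) / d)]
        ring
    _ = 1 / d * (d * α ^ 2 + 2 * α * β * ∑ n : Fin d, |(n₀ - n) / d| +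
          β ^ 2 * ∑ n : Fin d, ((n₀ - n) / d) ^ 2) := by
        rw [Finset.sum_add_distrib, Finset.sum_add_distrib, ← Finset.mul_sum, ← Finset.mul_sum]
        simp
    _ ≤ 1 / d * (d * α ^ 2 + 2 * α * β * (58 / 100 * d) + β ^ 2 * (d / 3)) := by gcongr
    _ = α ^ 2 + 2 * α * β * (58 / 100) + β ^ 2 / 3 := by field_simp
    _ ≤ _ := by nlinarith [sq_nonneg β]

/-- The defect of the Schrödinger equation is at most `epsT`. -/
theorem norm_defect_le {σ n₀ : ℝ} (k₀ : ℝ) (hσ : σ ∈ Set.Ioo (0 : ℝ) d)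
    (hn₀ : n₀ ∈ Set.Ioo (0 : ℝ) ((d : ℝ) - 1)) {T₀ : ℝ} (hT₀ : 0 < T₀) (hV : ContDiff ℝ ∞ V₀)
    (hV_per : Function.Periodic V₀ (2 * Real.pi)) {b : ℝ} (hb0 : 0 < b)
    (hb : IsDerivBound (fun x => Real.pi * V₀ x) b) {Ω : ℝ} (hΩ : |Ω| ≤ Real.pi) {Δ : ℝ} {N : ℤ}
    (hN1 : (N : ℝ) ≤ k₀ + Δ - d / 2) (hN2 : k₀ + Δ - d / 2 ≤ N + 1) :
    ‖WithLp.toLp 2 (timeSum d (N + 1)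
        (fun j => ampShiftDeriv d σ n₀ k₀ V₀ Ω Δ ((N + 1 + j : ℤ) : ℝ)) +
      (Complex.I * ((T₀ / d : ℝ) : ℂ)) • (sectorHam d T₀ V₀ Ω *ᵥ
        timeSum d (N + 1) (fun j => amp d σ n₀ k₀ V₀ Ω Δ ((N + 1 + j : ℤ) : ℝ))))‖ ≤
      epsT d σ n₀ k₀ b := by
  have hd0 : (0 : ℝ) < d := hσ.1.trans hσ.2
  have hd : 0 < d := by exact_mod_cast hd0
  obtain ⟨η, hη, hle⟩ := exists_alias_add_tail_le k₀ hσ hn₀ hb0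
  have hA0 := normConst_nonneg d σ k₀
  have hW0 := edgeWeight_nonneg (σ := σ) hd0.le
  set A := normConst d σ k₀ with hA
  set W := edgeWeight σ d with hW
  set e := Real.exp (-(Real.pi / 4 * ((d : ℝ) ^ 2 / σ ^ 2))) with he
  set R := Real.pi * (d / σ ^ 2) + Real.pi * ((d : ℝ) ^ 2 / σ ^ 2) with hR
  set B := 2 * Real.pi * b / d with hB
  set F := aliasBound σ (alpha d n₀) B η with hF
  have hF0 : 0 ≤ F := by rw [hF]; unfold aliasBound; have := hσ.1; positivity
  have hR0 : 0 ≤ R := by positivity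
  have hB0 : 0 ≤ B := by positivity
  -- `β` collects the part of the tail bound proportional to the detuning.
  refine (norm_toLp_le_of_detuning hn₀ (α := A * (F + 2 * B * W + 2 * R * e))
    (β := A * (4 * Real.pi * W)) (by positivity) (by positivity) fun n => ?_).trans ?_
  · rw [Pi.add_apply, Pi.smul_apply, smul_eq_mul,
      schroedinger_defect hd hT₀ hV.continuous hV_per, norm_neg, norm_mul, norm_mul,
      Complex.norm_real, Real.norm_of_nonneg (by positivity)]
    have h1 : ‖Complex.exp (-(Complex.I * ((2 * Real.pi * n₀ * (k₀ + Δ) / d : ℝ) : ℂ)))‖ = 1 := by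
      rw [← mul_neg, ← Complex.ofReal_neg, mul_comm, Complex.norm_exp_ofReal_mul_I]
    rw [h1, mul_one, mul_assoc]
    refine mul_le_mul_of_nonneg_left ?_ (by positivity)
    have h2 := norm_sum_modGaussDeriv_le (contDiff_accPhase (d := d) hV Ω Δ) hB0
      (abs_iteratedDeriv_accPhase_le hV hV_per hb hΩ Δ) hσ.1 hσ.2.le hN1 hN2
      (alpha_le_one hn₀) (abs_detuning_le hn₀ n) hη
    have h3 := mul_le_mul_of_nonneg_left h2 hA0
    refine h3.trans_eq ?_
    rw [hF, hW, aliasBound, edgeWeight, ← he, ← hR]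
    ring
  · have hq1 : 0 ≤ (1 - Real.exp (-(Real.pi * (d : ℝ) ^ 2 / σ ^ 2)))⁻¹ := by
      rw [inv_nonneg, sub_nonneg]
      refine Real.exp_le_one_iff.2 ?_
      rw [neg_nonpos]; positivity
    have hq2 : 0 ≤ A * ((b + 2 * Real.pi / d) *
        (1 - Real.exp (-(Real.pi * (d : ℝ) ^ 2 / σ ^ 2)))⁻¹ + Real.pi * (d / σ ^ 2) + 1 / d) * e := by
      positivity
    have hE : epsT d σ n₀ k₀ b = epsTwo d σ n₀ k₀ b + A * (4 * Real.pi * W) + 2 * A * R * e +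
        2 * (A * ((b + 2 * Real.pi / d) *
        (1 - Real.exp (-(Real.pi * (d : ℝ) ^ 2 / σ ^ 2)))⁻¹ + Real.pi * (d / σ ^ 2) + 1 / d) * e) := by
      rw [epsT, hW, edgeWeight, ← he, ← hA, neg_mul, ← he, hR]
      ring
    -- The multiples of `π A · edgeWeight` add up exactly: `1.68` from `hle` and `0.58 · 4 = 2.32`
    -- from the detuning make the available `4`.
    rw [hE]
    have : 0 ≤ A * (Real.pi * W) := by positivity
    linarith

/-! ### Comparison with the Schrödinger evolution -/

theorem norm_toLp_sq {ι : Type*} [Fintype ι] (v : ι → ℂ) :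
    ((‖WithLp.toLp 2 v‖ ^ 2 : ℝ) : ℂ) = star v ⬝ᵥ v := by
  rw [EuclideanSpace.norm_sq_eq, dotProduct]
  push_cast
  refine Finset.sum_congr rfl fun i _ => ?_
  rw [Pi.star_apply, RCLike.star_def, Complex.conj_mul']

theorem norm_toLp_mulVec_of_isometry {ι : Type*} [Fintype ι] [DecidableEq ι] {U : Matrix ι ι ℂ}
    (hU : Uᴴ * U = 1) (v : ι → ℂ) : ‖WithLp.toLp 2 (U *ᵥ v)‖ = ‖WithLp.toLp 2 v‖ := by
  have h : ‖WithLp.toLp 2 (U *ᵥ v)‖ ^ 2 = ‖WithLp.toLp 2 v‖ ^ 2 := by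
    have : ((‖WithLp.toLp 2 (U *ᵥ v)‖ ^ 2 : ℝ) : ℂ) = ((‖WithLp.toLp 2 v‖ ^ 2 : ℝ) : ℂ) := by
      rw [norm_toLp_sq, norm_toLp_sq, Matrix.star_mulVec, ← Matrix.dotProduct_mulVec,
        Matrix.mulVec_mulVec, hU, Matrix.one_mulVec]
    exact_mod_cast this
  exact (sq_eq_sq₀ (norm_nonneg _) (norm_nonneg _)).1 h

theorem exp_conjTranspose_mul_exp_of_skew {ι : Type*} [Fintype ι] [DecidableEq ι]
    {X : Matrix ι ι ℂ} (hX : Xᴴ = -X) : (NormedSpace.exp X)ᴴ * NormedSpace.exp X = 1 := by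
  rw [← Matrix.exp_conjTranspose, hX, ← Matrix.exp_add_of_commute _ _ (Commute.refl X).neg_left,
    neg_add_cancel, NormedSpace.exp_zero]

open scoped Matrix.Norms.Operator in
theorem hasDerivAt_exp_smul_matrix {n : ℕ} (X : Matrix (Fin n) (Fin n) ℂ) (s : ℝ) (i j : Fin n) :
    HasDerivAt (fun s : ℝ => NormedSpace.exp (s • X) i j)
      ((NormedSpace.exp (s • X) * X) i j) s :=
  hasDerivAt_pi.1 (hasDerivAt_pi.1 (hasDerivAt_exp_smul_const X s) i) j

/-- The interaction picture: an exact solution of `φ' = -X φ` becomes constant, and the derivative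
is the rotated defect. -/
theorem hasDerivAt_exp_smul_mulVec {n : ℕ} (X : Matrix (Fin n) (Fin n) ℂ)
    {φ φ' : ℝ → Fin n → ℂ} {s : ℝ} (hφ : HasDerivAt φ (φ' s) s) :
    HasDerivAt (fun s : ℝ => WithLp.toLp 2 (NormedSpace.exp (s • X) *ᵥ φ s))
      (WithLp.toLp 2 (NormedSpace.exp (s • X) *ᵥ (φ' s + X *ᵥ φ s))) s := by
  have h : HasDerivAt (fun s : ℝ => NormedSpace.exp (s • X) *ᵥ φ s)
      (NormedSpace.exp (s • X) *ᵥ (φ' s + X *ᵥ φ s)) s := by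
    rw [hasDerivAt_pi]
    intro i
    have h1 := HasDerivAt.fun_sum (u := Finset.univ) fun j (_ : j ∈ Finset.univ) =>
      (hasDerivAt_exp_smul_matrix X s i j).mul (hasDerivAt_pi.1 hφ j)
    refine h1.congr_deriv ?_
    rw [Finset.sum_add_distrib, Matrix.mulVec_add, Pi.add_apply, Matrix.mulVec_mulVec, add_comm]
    rfl
  exact (PiLp.continuousLinearEquiv 2 ℝ fun _ : Fin n => ℂ).symm.hasFDerivAt.comp_hasDerivAt s h

/-- An approximate solution `φ` of `φ' = -X φ`, with `X` skew-Hermitian, stays close to an exact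
solution. -/
theorem norm_exp_mulVec_sub_le {n : ℕ} {X : Matrix (Fin n) (Fin n) ℂ} (hX : Xᴴ = -X)
    {φ φ' : ℝ → Fin n → ℂ} {s₁ s₂ ε : ℝ} (hs : s₁ ≤ s₂) (hφ : ∀ s, HasDerivAt φ (φ' s) s)
    (hε : ∀ s ∈ Set.Icc s₁ s₂, ‖WithLp.toLp 2 (φ' s + X *ᵥ φ s)‖ ≤ ε) :
    ‖WithLp.toLp 2 (NormedSpace.exp (s₂ • X) *ᵥ φ s₂) -
      WithLp.toLp 2 (NormedSpace.exp (s₁ • X) *ᵥ φ s₁)‖ ≤ ε * (s₂ - s₁) := by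
  have hskew : ∀ s : ℝ, (s • X)ᴴ = -(s • X) := fun s => by
    rw [Matrix.conjTranspose_smul, hX, star_trivial, smul_neg]
  refine norm_image_sub_le_of_norm_deriv_le_segment'
    (f := fun s : ℝ => WithLp.toLp 2 (NormedSpace.exp (s • X) *ᵥ φ s))
    (fun s _ => (hasDerivAt_exp_smul_mulVec X (hφ s)).hasDerivWithinAt) (fun s hs' => ?_) s₂
    ⟨hs, le_rfl⟩
  rw [norm_toLp_mulVec_of_isometry (exp_conjTranspose_mul_exp_of_skew (hskew s))]
  exact hε s ⟨hs'.1, hs'.2.le⟩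

theorem norm_psiNor (d : ℕ) (σ n₀ k₀ x : ℝ) :
    ‖psiNor d σ n₀ k₀ x‖ =
      normConst d σ k₀ * Real.exp (-(Real.pi / σ ^ 2) * (x - k₀) ^ 2) := by
  rw [psiNor, norm_mul, norm_mul, Complex.norm_real, Complex.norm_real, mul_comm Complex.I,
    Complex.norm_exp_ofReal_mul_I, mul_one, Real.norm_of_nonneg (normConst_nonneg _ _ _),
    Real.norm_of_nonneg (Real.exp_pos _).le]

theorem norm_amp (d : ℕ) (σ n₀ k₀ : ℝ) (V₀ : ℝ → ℝ) (Ω Δ x : ℝ) :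
    ‖amp d σ n₀ k₀ V₀ Ω Δ x‖ = ‖psiNor d σ n₀ k₀ (x - Δ)‖ := by
  rw [amp, norm_mul, ← mul_neg, ← Complex.ofReal_neg, mul_comm Complex.I,
    Complex.norm_exp_ofReal_mul_I, mul_one]

section
variable {d : ℕ} {V₀ : ℝ → ℝ}

theorem norm_toLp_timeState (hd : 0 < d) (k : ℤ) : ‖WithLp.toLp 2 (timeState d k)‖ = 1 := by
  have h := norm_toLp_sq (timeState d k)
  rw [star_timeState_dotProduct hd, sub_self, if_pos (dvd_zero _)] at h
  have h' : ‖WithLp.toLp 2 (timeState d k)‖ ^ 2 = 1 := by exact_mod_cast h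
  exact (pow_eq_one_iff_of_nonneg (norm_nonneg _) two_ne_zero).1 h'

/-- The ideally translated clock state, on the window `N + 1, …, N + d`. -/
noncomputable def idealState (d : ℕ) (σ n₀ k₀ : ℝ) (V₀ : ℝ → ℝ) (Ω : ℝ) (N : ℤ) (Δ : ℝ) :
    Fin d → ℂ :=
  timeSum d (N + 1) fun j => amp d σ n₀ k₀ V₀ Ω Δ ((N + 1 + j : ℤ) : ℝ)

theorem hasDerivAt_idealState (hV : Continuous V₀) (σ n₀ k₀ Ω : ℝ) (N : ℤ) (Δ : ℝ) :
    HasDerivAt (idealState d σ n₀ k₀ V₀ Ω N)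
      (timeSum d (N + 1) fun j => ampShiftDeriv d σ n₀ k₀ V₀ Ω Δ ((N + 1 + j : ℤ) : ℝ)) Δ :=
  HasDerivAt.fun_sum (u := Finset.range d) (A := fun (j : ℕ) Δ => amp d σ n₀ k₀ V₀ Ω Δ ((N + 1 + j : ℤ) : ℝ) •
      timeState d (N + 1 + j))
    fun j _ => (hasDerivAt_amp hV σ n₀ k₀ Ω Δ ((N + 1 + j : ℤ) : ℝ)).smul_const
      (timeState d (N + 1 + j))

theorem idealState_zero (d : ℕ) (σ n₀ k₀ : ℝ) (V₀ : ℝ → ℝ) (Ω : ℝ) :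
    idealState d σ n₀ k₀ V₀ Ω ⌊k₀ - d / 2⌋ 0 = clockState d σ n₀ k₀ := by
  rw [clockState_eq_timeSum, idealState]
  simp only [amp, accPhase, sub_zero, intervalIntegral.integral_same, mul_zero,
    Complex.ofReal_zero, neg_zero, Complex.exp_zero, mul_one]

/-- The jump of the ideally translated state when the window moves. -/
theorem norm_idealState_succ_sub_le (hd : 0 < d) (σ n₀ k₀ Ω : ℝ) {N : ℤ} {Δ : ℝ}
    (hN : k₀ + Δ - d / 2 = N + 1) :
    ‖WithLp.toLp 2 (idealState d σ n₀ k₀ V₀ Ω (N + 1) Δ - idealState d σ n₀ k₀ V₀ Ω N Δ)‖ ≤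
      epsStep d σ k₀ := by
  set F : ℤ → Fin d → ℂ := fun k => amp d σ n₀ k₀ V₀ Ω Δ k • timeState d k with hF
  -- Consecutive windows differ by the loss of `N + 1` and the gain of `N + 1 + d`; by `hN` both lie
  -- at distance `d/2` from the centre.
  have h1 : idealState d σ n₀ k₀ V₀ Ω (N + 1) Δ - idealState d σ n₀ k₀ V₀ Ω N Δ =
      F (N + 1 + d) - F (N + 1) := by
    have e1 := Finset.sum_range_succ (fun j : ℕ => F (N + 1 + j)) d
    have e2 := Finset.sum_range_succ' (fun j : ℕ => F (N + 1 + j)) d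
    have e3 : idealState d σ n₀ k₀ V₀ Ω (N + 1) Δ =
        ∑ j ∈ Finset.range d, F (N + 1 + ((j + 1 : ℕ) : ℤ)) := by
      rw [idealState, timeSum]
      refine Finset.sum_congr rfl fun j _ => ?_
      have : N + 1 + ((j + 1 : ℕ) : ℤ) = N + 1 + 1 + j := by push_cast; ring
      rw [this]
    have e4 : idealState d σ n₀ k₀ V₀ Ω N Δ = ∑ j ∈ Finset.range d, F (N + 1 + j) := rfl
    rw [e3, e4]
    rw [e1] at e2
    simp only [Nat.cast_zero, add_zero] at e2
    rw [sub_eq_sub_iff_add_eq_add, ← e2, add_comm]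
  have hnorm : ∀ k : ℤ, ‖WithLp.toLp 2 (F k)‖ = normConst d σ k₀ *
      Real.exp (-(Real.pi / σ ^ 2) * (k - Δ - k₀) ^ 2) := fun k => by
    rw [hF, WithLp.toLp_smul, norm_smul, norm_toLp_timeState hd, mul_one, norm_amp, norm_psiNor]
  rw [h1, WithLp.toLp_sub]
  refine (norm_sub_le _ _).trans_eq ?_
  rw [hnorm, hnorm, epsStep]
  have e1 : ((N + 1 + d : ℤ) : ℝ) - Δ - k₀ = d / 2 := by push_cast; linarith
  have e2 : ((N + 1 : ℤ) : ℝ) - Δ - k₀ = -(d / 2) := by push_cast; linarith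
  rw [e1, e2, neg_sq, show -(Real.pi / σ ^ 2) * ((d : ℝ) / 2) ^ 2 =
    -(Real.pi * (d : ℝ) ^ 2 / (4 * σ ^ 2)) by ring]
  ring

/-- The generator of the evolution in units of the translation of the clock. -/
noncomputable def sectorGen (d : ℕ) (T₀ : ℝ) (V₀ : ℝ → ℝ) (Ω : ℝ) : Matrix (Fin d) (Fin d) ℂ :=
  (Complex.I * ((T₀ / d : ℝ) : ℂ)) • sectorHam d T₀ V₀ Ω

theorem sectorGen_conjTranspose (d : ℕ) (T₀ : ℝ) (V₀ : ℝ → ℝ) (Ω : ℝ) :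
    (sectorGen d T₀ V₀ Ω)ᴴ = -sectorGen d T₀ V₀ Ω := by
  rw [sectorGen, Matrix.conjTranspose_smul, (sectorHam_isHermitian d T₀ V₀ Ω).eq, RCLike.star_def,
    map_mul, Complex.conj_I, Complex.conj_ofReal, neg_mul, neg_smul]

variable {σ n₀ T₀ b Ω : ℝ} (k₀ : ℝ) (hσ : σ ∈ Set.Ioo (0 : ℝ) d)
  (hn₀ : n₀ ∈ Set.Ioo (0 : ℝ) ((d : ℝ) - 1)) (hT₀ : 0 < T₀) (hV : ContDiff ℝ ∞ V₀)
  (hV_per : Function.Periodic V₀ (2 * Real.pi)) (hb0 : 0 < b)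
  (hb : IsDerivBound (fun x => Real.pi * V₀ x) b) (hΩ : |Ω| ≤ Real.pi)

include hσ hn₀ hT₀ hV hV_per hb0 hb hΩ

theorem norm_segment_le {N : ℤ} {s₁ s₂ : ℝ} (hs : s₁ ≤ s₂)
    (h1 : (N : ℝ) ≤ k₀ + s₁ - d / 2) (h2 : k₀ + s₂ - d / 2 ≤ N + 1) :
    ‖WithLp.toLp 2 (NormedSpace.exp (s₂ • sectorGen d T₀ V₀ Ω) *ᵥ
        idealState d σ n₀ k₀ V₀ Ω N s₂) -
      WithLp.toLp 2 (NormedSpace.exp (s₁ • sectorGen d T₀ V₀ Ω) *ᵥ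
        idealState d σ n₀ k₀ V₀ Ω N s₁)‖ ≤ epsT d σ n₀ k₀ b * (s₂ - s₁) := by
  refine norm_exp_mulVec_sub_le (sectorGen_conjTranspose d T₀ V₀ Ω) hs
    (fun s => hasDerivAt_idealState hV.continuous σ n₀ k₀ Ω N s) fun s hs' => ?_
  rw [sectorGen, Matrix.smul_mulVec]
  exact norm_defect_le k₀ hσ hn₀ hT₀ hV hV_per hb0 hb hΩ (by linarith [hs'.1]) (by linarith [hs'.2])

/-- Induction on the number `m` of slides of the window, alternating a stretch with fixed window and
a jump. -/
theorem norm_steps_le {N₀ : ℤ} (hN : (N₀ : ℝ) ≤ k₀ - d / 2) (hN' : k₀ - d / 2 < N₀ + 1) (m : ℕ) :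
    ∀ Δ : ℝ, 0 ≤ Δ → (N₀ : ℝ) + m ≤ k₀ + Δ - d / 2 → k₀ + Δ - d / 2 ≤ N₀ + m + 1 →
    ‖WithLp.toLp 2 (NormedSpace.exp (Δ • sectorGen d T₀ V₀ Ω) *ᵥ
        idealState d σ n₀ k₀ V₀ Ω (N₀ + m) Δ) -
      WithLp.toLp 2 (idealState d σ n₀ k₀ V₀ Ω N₀ 0)‖ ≤
        Δ * epsT d σ n₀ k₀ b + m * epsStep d σ k₀ := by
  have hd : 0 < d := by exact_mod_cast hσ.1.trans hσ.2
  induction m with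
  | zero =>
    intro Δ hΔ _ h2
    have h := norm_segment_le k₀ hσ hn₀ hT₀ hV hV_per hb0 hb hΩ (N := N₀) hΔ
      (by linarith) (by simpa using h2)
    rw [zero_smul, NormedSpace.exp_zero, Matrix.one_mulVec] at h
    simp only [Nat.cast_zero, add_zero, zero_mul]
    linarith
  | succ m ih =>
    intro Δ hΔ h1 h2
    push_cast at h1 h2 ⊢
    -- The translation at which the last slide happens.
    set s : ℝ := N₀ + m + 1 - k₀ + d / 2 with hs
    have hs0 : 0 ≤ s := by
      have : (0 : ℝ) ≤ m := Nat.cast_nonneg m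
      linarith
    have i1 := ih s hs0 (by linarith) (by linarith)
    have i2 := norm_segment_le k₀ hσ hn₀ hT₀ hV hV_per hb0 hb hΩ (N := N₀ + m + 1) (s₁ := s)
      (s₂ := Δ) (by linarith) (by push_cast; linarith) (by push_cast; linarith)
    have i3 := norm_idealState_succ_sub_le (V₀ := V₀) hd σ n₀ k₀ Ω (N := N₀ + m) (Δ := s)
      (by push_cast; linarith)
    rw [← norm_toLp_mulVec_of_isometry (exp_conjTranspose_mul_exp_of_skew (X :=
      s • sectorGen d T₀ V₀ Ω) (by
        rw [Matrix.conjTranspose_smul, sectorGen_conjTranspose, star_trivial, smul_neg])),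
      Matrix.mulVec_sub, WithLp.toLp_sub] at i3
    rw [← add_assoc]
    set u₁ := WithLp.toLp 2 (NormedSpace.exp (Δ • sectorGen d T₀ V₀ Ω) *ᵥ
      idealState d σ n₀ k₀ V₀ Ω (N₀ + m + 1) Δ)
    set u₂ := WithLp.toLp 2 (NormedSpace.exp (s • sectorGen d T₀ V₀ Ω) *ᵥ
      idealState d σ n₀ k₀ V₀ Ω (N₀ + m + 1) s)
    set u₃ := WithLp.toLp 2 (NormedSpace.exp (s • sectorGen d T₀ V₀ Ω) *ᵥ
      idealState d σ n₀ k₀ V₀ Ω (N₀ + m) s)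
    set u₄ := WithLp.toLp 2 (idealState d σ n₀ k₀ V₀ Ω N₀ 0)
    have t1 := norm_sub_le_norm_sub_add_norm_sub u₁ u₂ u₄
    have t2 := norm_sub_le_norm_sub_add_norm_sub u₂ u₃ u₄
    linarith

/-- The clock stays close to the ideally translated state. -/
theorem norm_evolved_sub_idealState_le {Δ : ℝ} (hΔ : 0 ≤ Δ) :
    ‖WithLp.toLp 2 (NormedSpace.exp (-(Δ • sectorGen d T₀ V₀ Ω)) *ᵥ clockState d σ n₀ k₀) -
      WithLp.toLp 2 (idealState d σ n₀ k₀ V₀ Ω ⌊k₀ + Δ - d / 2⌋ Δ)‖ ≤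
        Δ * epsT d σ n₀ k₀ b + (Δ + 1) * epsStep d σ k₀ := by
  set N₀ := ⌊k₀ - d / 2⌋ with hN₀
  have hle : N₀ ≤ ⌊k₀ + Δ - d / 2⌋ := Int.floor_le_floor (by linarith)
  obtain ⟨m, hm⟩ := Int.eq_ofNat_of_zero_le (sub_nonneg.2 hle)
  have hNm : ⌊k₀ + Δ - d / 2⌋ = N₀ + m := by omega
  have hf1 := Int.floor_le (k₀ + Δ - d / 2)
  have hf2 := Int.lt_floor_add_one (k₀ + Δ - d / 2)
  have hg1 := Int.floor_le (k₀ - d / 2)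
  have hg2 := Int.lt_floor_add_one (k₀ - d / 2)
  rw [hNm] at hf1 hf2 ⊢
  push_cast at hf1 hf2
  rw [← hN₀] at hg1 hg2
  have h := norm_steps_le k₀ hσ hn₀ hT₀ hV hV_per hb0 hb hΩ hg1 hg2 m Δ hΔ hf1 hf2.le
  have hskew : (-(Δ • sectorGen d T₀ V₀ Ω))ᴴ = -(-(Δ • sectorGen d T₀ V₀ Ω)) := by
    rw [Matrix.conjTranspose_neg, Matrix.conjTranspose_smul, sectorGen_conjTranspose, star_trivial,
      smul_neg]
  have hinv : NormedSpace.exp (-(Δ • sectorGen d T₀ V₀ Ω)) *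
      NormedSpace.exp (Δ • sectorGen d T₀ V₀ Ω) = 1 := by
    rw [← Matrix.exp_add_of_commute _ _ (Commute.refl (Δ • sectorGen d T₀ V₀ Ω)).neg_left,
      neg_add_cancel, NormedSpace.exp_zero]
  rw [idealState_zero, ← WithLp.toLp_sub,
    ← norm_toLp_mulVec_of_isometry (exp_conjTranspose_mul_exp_of_skew hskew), Matrix.mulVec_sub,
    Matrix.mulVec_mulVec, hinv, Matrix.one_mulVec, WithLp.toLp_sub, norm_sub_rev] at h
  refine h.trans ?_
  have hstep : 0 ≤ epsStep d σ k₀ := by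
    have := normConst_nonneg d σ k₀
    unfold epsStep; positivity
  -- A translation by `Δ` crosses at most `Δ + 1` integers; hence the `+ 1` in front of `ε_step`.
  have hmΔ : (m : ℝ) ≤ Δ + 1 := by linarith
  gcongr

end

/-! ### The trace norm and the Hilbert–Schmidt norm -/

theorem trace_conjTranspose_mul_self_eq {n : ℕ} (M : Matrix (Fin n) (Fin n) ℂ) :
    (Mᴴ * M).trace.re = ∑ i, ∑ j, ‖M i j‖ ^ 2 := by
  rw [Finset.sum_comm]
  simp only [Matrix.trace, Matrix.diag, Matrix.mul_apply, Matrix.conjTranspose_apply,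
    RCLike.star_def, Complex.conj_mul', Complex.re_sum, ← Complex.ofReal_pow, Complex.ofReal_re]

/-- Cauchy–Schwarz for the `n` singular values. -/
theorem traceNorm_le_sqrt {n : ℕ} (M : Matrix (Fin n) (Fin n) ℂ) :
    traceNorm M ≤ √((n : ℝ) * (Mᴴ * M).trace.re) := by
  have hM := Matrix.isHermitian_conjTranspose_mul_self M
  have hnn : ∀ i, 0 ≤ hM.eigenvalues i :=
    (Matrix.posSemidef_conjTranspose_mul_self M).eigenvalues_nonneg
  have htr : (Mᴴ * M).trace.re = ∑ i, hM.eigenvalues i := by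
    rw [hM.trace_eq_sum_eigenvalues, Complex.re_sum]; rfl
  refine Real.le_sqrt_of_sq_le ?_
  have h := sq_sum_le_card_mul_sum_sq (s := Finset.univ) (f := fun i => √(hM.eigenvalues i))
  simp only [Real.sq_sqrt (hnn _), Finset.card_univ, Fintype.card_fin] at h
  rw [htr]
  exact h

/-- The trace norm is not monotone in the moduli of the entries, but the Hilbert–Schmidt norm is,
and it is unitarily invariant; the factor `√n` is the price of the detour. -/
theorem traceNorm_conj_le {n : ℕ} {Y M R : Matrix (Fin n) (Fin n) ℂ} (hY : Yᴴ * Y = 1) {C : ℝ}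
    (hC : 0 ≤ C) (hM : ∀ i j, ‖M i j‖ ≤ C * ‖R i j‖) :
    traceNorm (Y * M * Yᴴ) ≤ √((n : ℝ) * (Rᴴ * R).trace.re) * C := by
  refine (traceNorm_le_sqrt _).trans ?_
  have h1 : ((Y * M * Yᴴ)ᴴ * (Y * M * Yᴴ)).trace = (Mᴴ * M).trace := by
    rw [Matrix.conjTranspose_mul, Matrix.conjTranspose_mul, Matrix.conjTranspose_conjTranspose,
      show Y * (Mᴴ * Yᴴ) * (Y * M * Yᴴ) = Y * (Mᴴ * (Yᴴ * Y) * (M * Yᴴ)) by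
        simp only [mul_assoc], hY, mul_one, Matrix.trace_mul_comm, mul_assoc, mul_assoc, hY, mul_one]
  rw [h1, trace_conjTranspose_mul_self_eq, trace_conjTranspose_mul_self_eq]
  have h2 : ∑ i, ∑ j, ‖M i j‖ ^ 2 ≤ (∑ i, ∑ j, ‖R i j‖ ^ 2) * C ^ 2 := by
    rw [Finset.sum_mul]
    refine Finset.sum_le_sum fun i _ => ?_
    rw [Finset.sum_mul]
    refine Finset.sum_le_sum fun j _ => ?_
    rw [← mul_pow, mul_comm]
    exact pow_le_pow_left₀ (norm_nonneg _) (hM i j) 2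
  calc √((n : ℝ) * ∑ i, ∑ j, ‖M i j‖ ^ 2)
      ≤ √((n : ℝ) * (∑ i, ∑ j, ‖R i j‖ ^ 2) * C ^ 2) := by
        rw [mul_assoc]; gcongr
    _ = _ := by rw [Real.sqrt_mul' _ (sq_nonneg C), Real.sqrt_sq hC]

/-! ### Exponentials on tensor products -/

open scoped Matrix.Norms.Operator in
theorem exp_kronecker_one {n d : ℕ} (X : Matrix (Fin n) (Fin n) ℂ) :
    NormedSpace.exp (X ⊗ₖ (1 : Matrix (Fin d) (Fin d) ℂ)) = NormedSpace.exp X ⊗ₖ 1 := by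
  rw [Matrix.kronecker_one, Matrix.kronecker_one, Matrix.exp_blockDiagonal]
  congr 1
  funext k
  exact Pi.coe_exp (fun _ : Fin d => X) k

/-- The matrix on `Fin n × Fin d` that acts on the second factor by `B i` on the `i`-th basis
vector of the first factor. -/
noncomputable def sectorBlock {n d : ℕ} (B : Fin n → Matrix (Fin d) (Fin d) ℂ) :
    Matrix (Fin n × Fin d) (Fin n × Fin d) ℂ :=
  Matrix.reindexAlgEquiv ℂ ℂ (Equiv.prodComm (Fin d) (Fin n)) (Matrix.blockDiagonal B)

theorem sectorBlock_apply {n d : ℕ} (B : Fin n → Matrix (Fin d) (Fin d) ℂ) (p q : Fin n × Fin d) :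
    sectorBlock B p q = if p.1 = q.1 then B p.1 p.2 q.2 else 0 := by
  simp [sectorBlock, Matrix.blockDiagonal_apply]

open scoped Matrix.Norms.Operator in
theorem exp_sectorBlock {n d : ℕ} (B : Fin n → Matrix (Fin d) (Fin d) ℂ) :
    NormedSpace.exp (sectorBlock B) = sectorBlock fun i => NormedSpace.exp (B i) := by
  have h := NormedSpace.map_exp (Matrix.reindexAlgEquiv ℂ ℂ (Equiv.prodComm (Fin d) (Fin n)))
    (continuous_id.matrix_submatrix _ _) (Matrix.blockDiagonal B)
  have h2 : NormedSpace.exp (Matrix.blockDiagonal B) =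
      Matrix.blockDiagonal fun i => NormedSpace.exp (B i) :=
    (Matrix.exp_blockDiagonal B).trans (congrArg _ (funext fun i => Pi.coe_exp B i))
  exact h.symm.trans (congrArg _ h2)

theorem partialTraceClock_conj {n d : ℕ} (X : Matrix (Fin n) (Fin n) ℂ)
    (M : Matrix (Fin n × Fin d) (Fin n × Fin d) ℂ) (Y : Matrix (Fin n) (Fin n) ℂ) :
    partialTraceClock ((X ⊗ₖ (1 : Matrix (Fin d) (Fin d) ℂ)) * M *
      (Y ⊗ₖ (1 : Matrix (Fin d) (Fin d) ℂ))) = X * partialTraceClock M * Y := by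
  ext i j
  simp only [partialTraceClock, Matrix.of_apply, Matrix.mul_apply, Fintype.sum_prod_type,
    Matrix.kroneckerMap_apply, Matrix.one_apply, mul_ite, ite_mul, mul_one, mul_zero, zero_mul,
    Finset.sum_ite_eq, Finset.sum_ite_eq', Finset.mem_univ, if_true, Finset.sum_mul,
    Finset.mul_sum]
  rw [Finset.sum_comm]
  refine Finset.sum_congr rfl fun _ _ => ?_
  rw [Finset.sum_comm]

/-- Tracing out the clock leaves the entrywise product of `R` with the overlaps of the vectors `B i
*ᵥ v`. -/
theorem partialTraceClock_sectorBlock {n d : ℕ} (B : Fin n → Matrix (Fin d) (Fin d) ℂ)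
    (R : Matrix (Fin n) (Fin n) ℂ) (v : Fin d → ℂ) (i j : Fin n) :
    partialTraceClock (sectorBlock B * (R ⊗ₖ Matrix.vecMulVec v (star v)) * (sectorBlock B)ᴴ) i j =
      R i j * (star (B j *ᵥ v) ⬝ᵥ (B i *ᵥ v)) := by
  simp only [partialTraceClock, Matrix.of_apply, Matrix.mul_apply, Fintype.sum_prod_type,
    Matrix.kroneckerMap_apply, sectorBlock_apply, Matrix.conjTranspose_apply, ite_mul, zero_mul,
    Finset.sum_ite_irrel, Finset.sum_const_zero, Finset.sum_ite_eq, Finset.mem_univ, if_true,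
    apply_ite star, star_zero, mul_ite, mul_zero, Matrix.vecMulVec_apply, dotProduct,
    Matrix.mulVec, Pi.star_apply, star_sum, star_mul', Finset.sum_mul, Finset.mul_sum]
  refine Finset.sum_congr rfl fun k _ => ?_
  rw [Finset.sum_comm]
  refine Finset.sum_congr rfl fun l _ => ?_
  refine Finset.sum_congr rfl fun l' _ => ?_
  ring

/-! ### Reduction to the sectors of the interaction -/

theorem isHermitian_eq_conj {n : ℕ} {A : Matrix (Fin n) (Fin n) ℂ} (hA : A.IsHermitian) :
    A = (hA.eigenvectorUnitary : Matrix (Fin n) (Fin n) ℂ) *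
      Matrix.diagonal (fun i => (hA.eigenvalues i : ℂ)) *
      (hA.eigenvectorUnitary : Matrix (Fin n) (Fin n) ℂ)ᴴ := by
  conv_lhs => rw [hA.spectral_theorem, Unitary.conjStarAlgAut_apply]
  rfl

theorem exp_conj_isometry {ι : Type*} [Fintype ι] [DecidableEq ι] {W A : Matrix ι ι ℂ}
    (hW : Wᴴ * W = 1) (c : ℂ) :
    NormedSpace.exp (c • (W * A * Wᴴ)) = W * NormedSpace.exp (c • A) * Wᴴ := by
  have hW' : W * Wᴴ = 1 := mul_eq_one_comm.1 hW
  have hinv : W⁻¹ = Wᴴ := Matrix.inv_eq_left_inv hW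
  rw [← hinv, ← Matrix.exp_conj W (c • A) ((Matrix.isUnit_iff_isUnit_det W).2
    (Matrix.isUnit_det_of_left_inverse hW)), Matrix.mul_smul, Matrix.smul_mul]

theorem exp_smul_conjTranspose {ι : Type*} [Fintype ι] [DecidableEq ι] {A : Matrix ι ι ℂ}
    (hA : A.IsHermitian) (r : ℝ) :
    NormedSpace.exp ((Complex.I * r) • A) = (NormedSpace.exp (-(Complex.I * r) • A))ᴴ := by
  rw [← Matrix.exp_conjTranspose, Matrix.conjTranspose_smul, hA.eq]
  simp

section
variable {n d : ℕ} (T₀ : ℝ) (V₀ : ℝ → ℝ) {Hs Hint : Matrix (Fin n) (Fin n) ℂ}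
  (hHint : Hint.IsHermitian)

theorem interaction_eq_conj :
    (1 : Matrix (Fin n) (Fin n) ℂ) ⊗ₖ clockHam d T₀ + Hint ⊗ₖ potOp d T₀ V₀ =
      ((hHint.eigenvectorUnitary : Matrix (Fin n) (Fin n) ℂ) ⊗ₖ (1 : Matrix (Fin d) (Fin d) ℂ)) *
        sectorBlock (fun i => sectorHam d T₀ V₀ (hHint.eigenvalues i)) *
      ((hHint.eigenvectorUnitary : Matrix (Fin n) (Fin n) ℂ) ⊗ₖ
        (1 : Matrix (Fin d) (Fin d) ℂ))ᴴ := by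
  have hW : (hHint.eigenvectorUnitary : Matrix (Fin n) (Fin n) ℂ) *
      (hHint.eigenvectorUnitary : Matrix (Fin n) (Fin n) ℂ)ᴴ = 1 :=
    Unitary.mul_star_self_of_mem hHint.eigenvectorUnitary.2
  have hB : sectorBlock (fun i => sectorHam d T₀ V₀ (hHint.eigenvalues i)) =
      (1 : Matrix (Fin n) (Fin n) ℂ) ⊗ₖ clockHam d T₀ +
        Matrix.diagonal (fun i => (hHint.eigenvalues i : ℂ)) ⊗ₖ potOp d T₀ V₀ := by
    ext p q
    simp only [sectorBlock_apply, sectorHam, Matrix.add_apply, Matrix.smul_apply,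
      Matrix.kroneckerMap_apply, Matrix.one_apply, Matrix.diagonal_apply, smul_eq_mul]
    split_ifs <;> simp
  rw [hB, Matrix.mul_add, Matrix.add_mul, Matrix.conjTranspose_kronecker,
    ← Matrix.mul_kronecker_mul, ← Matrix.mul_kronecker_mul, ← Matrix.mul_kronecker_mul,
    ← Matrix.mul_kronecker_mul, ← isHermitian_eq_conj hHint]
  simp [hW]

theorem totalHam_isHermitian (hHs : Hs.IsHermitian) (hHint : Hint.IsHermitian) :
    (totalHam d T₀ V₀ Hs Hint).IsHermitian := by
  rw [Matrix.IsHermitian, totalHam, Matrix.conjTranspose_add, Matrix.conjTranspose_add,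
    Matrix.conjTranspose_kronecker, Matrix.conjTranspose_kronecker, Matrix.conjTranspose_kronecker,
    hHs.eq, hHint.eq, (clockHam_isHermitian d T₀).eq, (potOp_isHermitian d T₀ V₀).eq,
    Matrix.conjTranspose_one, Matrix.conjTranspose_one]

/-- `Hs ⊗ 1` commutes with the other two terms, so its exponential factors out and `Hs` need not be
diagonal in the chosen eigenbasis of `Hint`. -/
theorem exp_totalHam (hcomm : Commute Hint Hs) (c : ℂ) :
    NormedSpace.exp (c • totalHam d T₀ V₀ Hs Hint) =
      ((NormedSpace.exp (c • Hs) * (hHint.eigenvectorUnitary : Matrix (Fin n) (Fin n) ℂ)) ⊗ₖ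
        (1 : Matrix (Fin d) (Fin d) ℂ)) *
      sectorBlock (fun i => NormedSpace.exp (c • sectorHam d T₀ V₀ (hHint.eigenvalues i))) *
      ((hHint.eigenvectorUnitary : Matrix (Fin n) (Fin n) ℂ) ⊗ₖ
        (1 : Matrix (Fin d) (Fin d) ℂ))ᴴ := by
  have hW : (hHint.eigenvectorUnitary : Matrix (Fin n) (Fin n) ℂ)ᴴ *
      (hHint.eigenvectorUnitary : Matrix (Fin n) (Fin n) ℂ) = 1 :=
    Unitary.star_mul_self_of_mem hHint.eigenvectorUnitary.2
  have hc : Commute (Hs ⊗ₖ (1 : Matrix (Fin d) (Fin d) ℂ))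
      ((1 : Matrix (Fin n) (Fin n) ℂ) ⊗ₖ clockHam d T₀ + Hint ⊗ₖ potOp d T₀ V₀) := by
    rw [commute_iff_eq, Matrix.mul_add, Matrix.add_mul, ← Matrix.mul_kronecker_mul,
      ← Matrix.mul_kronecker_mul, ← Matrix.mul_kronecker_mul, ← Matrix.mul_kronecker_mul,
      hcomm.eq]
    simp
  have hW2 : ((hHint.eigenvectorUnitary : Matrix (Fin n) (Fin n) ℂ) ⊗ₖ
        (1 : Matrix (Fin d) (Fin d) ℂ))ᴴ *
      ((hHint.eigenvectorUnitary : Matrix (Fin n) (Fin n) ℂ) ⊗ₖ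
        (1 : Matrix (Fin d) (Fin d) ℂ)) = 1 := by
    rw [Matrix.conjTranspose_kronecker, ← Matrix.mul_kronecker_mul, hW]
    simp
  have hS : sectorBlock (fun i => c • sectorHam d T₀ V₀ (hHint.eigenvalues i)) =
      c • sectorBlock (fun i => sectorHam d T₀ V₀ (hHint.eigenvalues i)) := by
    ext p q
    simp [sectorBlock_apply]
  rw [totalHam, add_assoc, smul_add, Matrix.exp_add_of_commute _ _ ((hc.smul_left c).smul_right c),
    interaction_eq_conj T₀ V₀ hHint, exp_conj_isometry hW2, ← hS, exp_sectorBlock,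
    ← Matrix.smul_kronecker, exp_kronecker_one, ← mul_assoc, ← mul_assoc,
    ← Matrix.mul_kronecker_mul, mul_one]

/-- The clock state in the sector of the interaction eigenvalue `Ω`. -/
noncomputable def sectorState (d : ℕ) (σ n₀ k₀ T₀ : ℝ) (V₀ : ℝ → ℝ) (t Ω : ℝ) : Fin d → ℂ :=
  NormedSpace.exp (-(Complex.I * (t : ℂ)) • sectorHam d T₀ V₀ Ω) *ᵥ clockState d σ n₀ k₀

theorem clockControlled_eq (hHs : Hs.IsHermitian) (hcomm : Commute Hint Hs) (σ n₀ k₀ : ℝ)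
    (ρ : Matrix (Fin n) (Fin n) ℂ) (t : ℝ) :
    clockControlled d σ n₀ k₀ T₀ V₀ Hs Hint ρ t =
      (NormedSpace.exp (-(Complex.I * (t : ℂ)) • Hs) *
        (hHint.eigenvectorUnitary : Matrix (Fin n) (Fin n) ℂ)) *
      (Matrix.of fun i j => ((hHint.eigenvectorUnitary : Matrix (Fin n) (Fin n) ℂ)ᴴ * ρ *
          (hHint.eigenvectorUnitary : Matrix (Fin n) (Fin n) ℂ)) i j *
        (star (sectorState d σ n₀ k₀ T₀ V₀ t (hHint.eigenvalues j)) ⬝ᵥ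
          sectorState d σ n₀ k₀ T₀ V₀ t (hHint.eigenvalues i))) *
      (NormedSpace.exp (-(Complex.I * (t : ℂ)) • Hs) *
        (hHint.eigenvectorUnitary : Matrix (Fin n) (Fin n) ℂ))ᴴ := by
  set W := (hHint.eigenvectorUnitary : Matrix (Fin n) (Fin n) ℂ) with hWdef
  set S := NormedSpace.exp (-(Complex.I * (t : ℂ)) • Hs) with hS
  rw [clockControlled, jointState,
    exp_smul_conjTranspose (totalHam_isHermitian T₀ V₀ hHs hHint) t,
    exp_totalHam T₀ V₀ hHint hcomm, ← hWdef, ← hS]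
  set B : Fin n → Matrix (Fin d) (Fin d) ℂ := fun i =>
    NormedSpace.exp (-(Complex.I * (t : ℂ)) • sectorHam d T₀ V₀ (hHint.eigenvalues i)) with hB
  set P := Matrix.vecMulVec (clockState d σ n₀ k₀) (star (clockState d σ n₀ k₀)) with hP
  have h1 : (S * W) ⊗ₖ (1 : Matrix (Fin d) (Fin d) ℂ) * sectorBlock B *
        (W ⊗ₖ (1 : Matrix (Fin d) (Fin d) ℂ))ᴴ * (ρ ⊗ₖ P) *
        ((S * W) ⊗ₖ (1 : Matrix (Fin d) (Fin d) ℂ) * sectorBlock B *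
          (W ⊗ₖ (1 : Matrix (Fin d) (Fin d) ℂ))ᴴ)ᴴ =
      (S * W) ⊗ₖ (1 : Matrix (Fin d) (Fin d) ℂ) *
        (sectorBlock B * ((Wᴴ * ρ * W) ⊗ₖ P) * (sectorBlock B)ᴴ) *
        ((S * W)ᴴ ⊗ₖ (1 : Matrix (Fin d) (Fin d) ℂ)) := by
    have h2 : (Wᴴ * ρ * W) ⊗ₖ P = (W ⊗ₖ (1 : Matrix (Fin d) (Fin d) ℂ))ᴴ * (ρ ⊗ₖ P) *
        (W ⊗ₖ (1 : Matrix (Fin d) (Fin d) ℂ)) := by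
      rw [Matrix.conjTranspose_kronecker, ← Matrix.mul_kronecker_mul, ← Matrix.mul_kronecker_mul]
      simp
    have h3 : (S * W)ᴴ ⊗ₖ (1 : Matrix (Fin d) (Fin d) ℂ) =
        ((S * W) ⊗ₖ (1 : Matrix (Fin d) (Fin d) ℂ))ᴴ := by
      rw [Matrix.conjTranspose_kronecker, Matrix.conjTranspose_one]
    rw [h2, h3, Matrix.conjTranspose_mul, Matrix.conjTranspose_mul,
      Matrix.conjTranspose_conjTranspose]
    simp only [mul_assoc]
  rw [h1, partialTraceClock_conj]
  congr 2
  ext i j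
  rw [partialTraceClock_sectorBlock]
  rfl

theorem pulseControlled_eq (hHs : Hs.IsHermitian) (ρ : Matrix (Fin n) (Fin n) ℂ) (t : ℝ) :
    pulseControlled T₀ V₀ Hs Hint ρ t =
      (NormedSpace.exp (-(Complex.I * (t : ℂ)) • Hs) *
        (hHint.eigenvectorUnitary : Matrix (Fin n) (Fin n) ℂ)) *
      (Matrix.of fun i j => ((hHint.eigenvectorUnitary : Matrix (Fin n) (Fin n) ℂ)ᴴ * ρ *
          (hHint.eigenvectorUnitary : Matrix (Fin n) (Fin n) ℂ)) i j *
        Complex.exp (((-((hHint.eigenvalues i - hHint.eigenvalues j) *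
          ∫ x in (0 : ℝ)..t, pulse T₀ V₀ x) : ℝ) : ℂ) * Complex.I)) *
      (NormedSpace.exp (-(Complex.I * (t : ℂ)) • Hs) *
        (hHint.eigenvectorUnitary : Matrix (Fin n) (Fin n) ℂ))ᴴ := by
  have hW : (hHint.eigenvectorUnitary : Matrix (Fin n) (Fin n) ℂ)ᴴ *
      (hHint.eigenvectorUnitary : Matrix (Fin n) (Fin n) ℂ) = 1 :=
    Unitary.star_mul_self_of_mem hHint.eigenvectorUnitary.2
  rw [pulseControlled, exp_smul_conjTranspose hHs t, exp_smul_conjTranspose hHint]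
  set g : ℝ := ∫ x in (0 : ℝ)..t, pulse T₀ V₀ x with hg
  have hexp : NormedSpace.exp (-(Complex.I * (g : ℂ)) • Hint) =
      (hHint.eigenvectorUnitary : Matrix (Fin n) (Fin n) ℂ) *
      Matrix.diagonal (fun i => Complex.exp (-(Complex.I * (g : ℂ)) * hHint.eigenvalues i)) *
      (hHint.eigenvectorUnitary : Matrix (Fin n) (Fin n) ℂ)ᴴ := by
    conv_lhs => rw [isHermitian_eq_conj hHint]
    rw [exp_conj_isometry hW, ← Matrix.diagonal_smul, Matrix.exp_diagonal]
    congr 3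
    funext i
    rw [Pi.coe_exp, Complex.exp_eq_exp_ℂ]
    rfl
  rw [hexp]
  set W := (hHint.eigenvectorUnitary : Matrix (Fin n) (Fin n) ℂ) with hWdef
  set S := NormedSpace.exp (-(Complex.I * (t : ℂ)) • Hs) with hS
  set D := Matrix.diagonal (fun i => Complex.exp (-(Complex.I * (g : ℂ)) * hHint.eigenvalues i))
    with hD
  have hM : (Matrix.of fun i j => (Wᴴ * ρ * W) i j *
        Complex.exp (((-((hHint.eigenvalues i - hHint.eigenvalues j) * g) : ℝ) : ℂ) * Complex.I)) =
      D * (Wᴴ * ρ * W) * Dᴴ := by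
    ext i j
    rw [hD, Matrix.diagonal_conjTranspose, Matrix.mul_diagonal, Matrix.diagonal_mul,
      Matrix.of_apply, Pi.star_apply, RCLike.star_def, ← Complex.exp_conj, mul_right_comm,
      ← Complex.exp_add, mul_comm]
    congr 2
    simp only [map_mul, map_neg, Complex.conj_I, Complex.conj_ofReal]
    push_cast
    ring
  rw [hM, Matrix.conjTranspose_mul, Matrix.conjTranspose_mul, Matrix.conjTranspose_mul,
    Matrix.conjTranspose_conjTranspose]
  simp only [mul_assoc]

end

/-! ### The overlap of clock states of different sectors -/

theorem norm_exp_mul_I_sub_le (α β : ℝ) :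
    ‖Complex.exp (α * Complex.I) - Complex.exp (β * Complex.I)‖ ≤ |α - β| := by
  have h : Complex.exp (α * Complex.I) - Complex.exp (β * Complex.I) =
      Complex.exp (β * Complex.I) * (Complex.exp (Complex.I * ((α - β : ℝ) : ℂ)) - 1) := by
    rw [mul_sub, ← Complex.exp_add, mul_one]
    congr 2
    push_cast
    ring
  rw [h, norm_mul, Complex.norm_exp_ofReal_mul_I, one_mul]
  exact Real.norm_exp_I_mul_ofReal_sub_one_le

theorem norm_star_dotProduct_sub_le {n : ℕ} (u v u' v' : Fin n → ℂ) :
    ‖star u ⬝ᵥ v - star u' ⬝ᵥ v'‖ ≤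
      ‖WithLp.toLp 2 u - WithLp.toLp 2 u'‖ * ‖WithLp.toLp 2 v‖ +
        ‖WithLp.toLp 2 u'‖ * ‖WithLp.toLp 2 v - WithLp.toLp 2 v'‖ := by
  have h : ∀ x y : Fin n → ℂ, star x ⬝ᵥ y = inner ℂ (WithLp.toLp 2 x) (WithLp.toLp 2 y) :=
    fun x y => by rw [EuclideanSpace.inner_eq_star_dotProduct, dotProduct_comm]
  have e : star u ⬝ᵥ v - star u' ⬝ᵥ v' =
      inner ℂ (WithLp.toLp 2 u - WithLp.toLp 2 u') (WithLp.toLp 2 v) +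
        inner ℂ (WithLp.toLp 2 u') (WithLp.toLp 2 v - WithLp.toLp 2 v') := by
    rw [h, h, inner_sub_left, inner_sub_right]
    ring
  rw [e]
  exact (norm_add_le _ _).trans (add_le_add (norm_inner_le_norm _ _) (norm_inner_le_norm _ _))

theorem abs_le_of_isDerivBound {V₀ : ℝ → ℝ} {b : ℝ}
    (hV_per : Function.Periodic V₀ (2 * Real.pi))
    (hb : IsDerivBound (fun x => Real.pi * V₀ x) b) (x : ℝ) : 2 * (Real.pi * |V₀ x|) ≤ b := by
  simpa using abs_iteratedDeriv_le hV_per hb 0 x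

/-- If `b ≤ 0`, the potential vanishes, contradicting its normalisation, which enters only here. -/
theorem derivBound_pos {V₀ : ℝ → ℝ} {b : ℝ} (hV_per : Function.Periodic V₀ (2 * Real.pi))
    (hb : IsDerivBound (fun x => Real.pi * V₀ x) b)
    (hV_int : ∫ x in (0 : ℝ)..(2 * Real.pi), V₀ x = 1) : 0 < b := by
  by_contra! h
  have hz : V₀ = fun _ => 0 := funext fun x => by
    have h1 := abs_le_of_isDerivBound hV_per hb x
    have h2 : Real.pi * |V₀ x| ≤ 0 := by linarith
    have h3 : |V₀ x| ≤ 0 := by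
      by_contra! h4
      exact absurd h2 (not_le.2 (mul_pos Real.pi_pos h4))
    exact abs_nonpos_iff.1 h3
  rw [hz] at hV_int
  simp at hV_int

theorem integral_pulse {T₀ : ℝ} (hT₀ : 0 < T₀) (V₀ : ℝ → ℝ) (t : ℝ) :
    ∫ x in (0 : ℝ)..t, pulse T₀ V₀ x = ∫ x in (0 : ℝ)..(t * (2 * Real.pi) / T₀), V₀ x := by
  have hc : 2 * Real.pi / T₀ ≠ 0 := by positivity
  have h := intervalIntegral.smul_integral_comp_mul_left (a := 0) (b := t) V₀ (2 * Real.pi / T₀)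
  rw [mul_zero, show 2 * Real.pi / T₀ * t = t * (2 * Real.pi) / T₀ by ring, smul_eq_mul,
    ← intervalIntegral.integral_const_mul] at h
  rw [← h]
  refine intervalIntegral.integral_congr fun x _ => ?_
  simp only [pulse]
  rw [show x * (2 * Real.pi) / T₀ = 2 * Real.pi / T₀ * x by ring]

theorem epsK_nonneg (d : ℕ) (T₀ : ℝ) (V₀ : ℝ → ℝ) (t k : ℝ) : 0 ≤ epsK d T₀ V₀ t k := by
  unfold epsK; positivity

/-- The substitution `z = x + 2πk/d` turns the shifted integral into the phase collected by the
clock between `k` and `k + Δ`. -/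
theorem epsK_eq {d : ℕ} {V₀ : ℝ → ℝ} (hV : Continuous V₀) (hd : 0 < d) (T₀ t k : ℝ) :
    epsK d T₀ V₀ t k = 2 * Real.pi * |(∫ x in (0 : ℝ)..(t * (2 * Real.pi) / T₀), V₀ x) -
      ∫ z in (2 * Real.pi / d * k)..(2 * Real.pi / d * (k + d / T₀ * t)), V₀ z| := by
  have hd' : (d : ℝ) ≠ 0 := by positivity
  rw [epsK, intervalIntegral.integral_sub (hV.intervalIntegrable _ _)
    (Continuous.intervalIntegrable (by fun_prop) _ _),
    intervalIntegral.integral_comp_add_right]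
  congr 4
  · ring
  · field_simp
    ring

/-- Uniformity in `k` is the point: it makes the set in `epsV` bounded above, without which `sSup`
would be zero by convention. -/
theorem epsK_le {d : ℕ} {V₀ : ℝ → ℝ} {b : ℝ} (hV_per : Function.Periodic V₀ (2 * Real.pi))
    (hb : IsDerivBound (fun x => Real.pi * V₀ x) b) (T₀ t k : ℝ) :
    epsK d T₀ V₀ t k ≤ b * |t * (2 * Real.pi) / T₀| * 2 := by
  have h := intervalIntegral.norm_integral_le_of_norm_le_const (a := 0)
    (b := t * (2 * Real.pi) / T₀) (C := b / Real.pi)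
    (f := fun x => V₀ x - V₀ (x + 2 * Real.pi * k / d)) fun x _ => by
      have h1 := abs_le_of_isDerivBound hV_per hb x
      have h2 := abs_le_of_isDerivBound hV_per hb (x + 2 * Real.pi * k / d)
      rw [le_div_iff₀ Real.pi_pos]
      have h3 : ‖V₀ x - V₀ (x + 2 * Real.pi * k / d)‖ ≤
          |V₀ x| + |V₀ (x + 2 * Real.pi * k / d)| := abs_sub _ _
      nlinarith [Real.pi_pos, mul_le_mul_of_nonneg_right h3 Real.pi_pos.le]
  rw [sub_zero, Real.norm_eq_abs] at h
  rw [epsK]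
  calc _ ≤ 2 * Real.pi * (b / Real.pi * |t * (2 * Real.pi) / T₀|) := by gcongr
    _ = _ := by field_simp

theorem norm_psiNor_le (d : ℕ) (σ n₀ k₀ x : ℝ) : ‖psiNor d σ n₀ k₀ x‖ ≤ normConst d σ k₀ := by
  rw [norm_psiNor]
  refine mul_le_of_le_one_right (normConst_nonneg _ _ _) (Real.exp_le_one_iff.2 ?_)
  have : 0 ≤ Real.pi / σ ^ 2 := by positivity
  nlinarith [sq_nonneg (x - k₀)]

/-- The squares `ε_k²` and the last of the `d + 1` points are nonnegative and are dropped. -/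
theorem sum_le_epsV {d : ℕ} {V₀ : ℝ → ℝ} {b : ℝ} (hV_per : Function.Periodic V₀ (2 * Real.pi))
    (hb : IsDerivBound (fun x => Real.pi * V₀ x) b) (σ n₀ k₀ T₀ t : ℝ) {κ : ℝ}
    (hκ : κ ∈ Set.Icc (0 : ℝ) 1) :
    ∑ j ∈ Finset.range d, epsK d T₀ V₀ t (k₀ - d / 2 + κ + j) *
      ‖psiNor d σ n₀ k₀ (k₀ - d / 2 + κ + j)‖ ^ 2 ≤ epsV d σ n₀ k₀ T₀ V₀ t := by
  set K := b * |t * (2 * Real.pi) / T₀| * 2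
  refine le_trans ?_ (le_csSup ⟨∑ j ∈ Finset.range (d + 1), (K ^ 2 + K) * normConst d σ k₀ ^ 2, ?_⟩
    ⟨κ, hκ, rfl⟩)
  · dsimp only
    rw [Finset.sum_range_succ]
    refine le_add_of_le_of_nonneg (Finset.sum_le_sum fun j _ => ?_) ?_
    · gcongr
      exact le_add_of_nonneg_left (sq_nonneg _)
    · have := epsK_nonneg d T₀ V₀ t (k₀ - d / 2 + κ + d)
      positivity
  · have hK : 0 ≤ K := (epsK_nonneg d T₀ V₀ t 0).trans (epsK_le hV_per hb T₀ t 0)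
    rintro _ ⟨κ', _, rfl⟩
    refine Finset.sum_le_sum fun j _ => ?_
    have h0 := epsK_nonneg d T₀ V₀ t (k₀ - d / 2 + κ' + j)
    have h1 : epsK d T₀ V₀ t (k₀ - d / 2 + κ' + j) ≤ K := epsK_le hV_per hb T₀ t _
    have h2 := norm_psiNor_le d σ n₀ k₀ (k₀ - d / 2 + κ' + j)
    gcongr

/-- The Gaussian weight of the window around `y`. -/
noncomputable def gaussSum (d : ℕ) (σ y : ℝ) : ℝ :=
  ∑ k ∈ window d y, Real.exp (-(2 * Real.pi / σ ^ 2) * ((k : ℝ) - y) ^ 2)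

theorem gaussSum_pos {d : ℕ} (hd : 0 < d) (σ y : ℝ) : 0 < gaussSum d σ y := by
  rw [gaussSum, sum_window_eq_sum_range]
  exact Finset.sum_pos (fun _ _ => Real.exp_pos _) (Finset.nonempty_range_iff.2 hd.ne')

theorem norm_psiNor_sq {d : ℕ} (hd : 0 < d) (σ n₀ k₀ x : ℝ) :
    ‖psiNor d σ n₀ k₀ x‖ ^ 2 =
      Real.exp (-(2 * Real.pi / σ ^ 2) * (x - k₀) ^ 2) / gaussSum d σ k₀ := by
  rw [norm_psiNor, mul_pow, normConst, div_pow, ← gaussSum,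
    Real.sq_sqrt (gaussSum_pos hd σ k₀).le, ← Real.exp_nat_mul]
  rw [show ((2 : ℕ) : ℝ) * (-(Real.pi / σ ^ 2) * (x - k₀) ^ 2) =
    -(2 * Real.pi / σ ^ 2) * (x - k₀) ^ 2 by push_cast; ring]
  ring

theorem sum_norm_psiNor_sq {d : ℕ} (hd : 0 < d) (σ n₀ k₀ Δ : ℝ) :
    ∑ j ∈ Finset.range d,
        ‖psiNor d σ n₀ k₀ (((⌊k₀ + Δ - d / 2⌋ + 1 + j : ℤ) : ℝ) - Δ)‖ ^ 2 =
      gaussSum d σ (k₀ + Δ) / gaussSum d σ k₀ := by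
  rw [gaussSum, sum_window_eq_sum_range, Finset.sum_div]
  refine Finset.sum_congr rfl fun j _ => ?_
  rw [norm_psiNor_sq hd]
  congr 4
  ring

theorem norm_toLp_idealState {d : ℕ} (hd : 0 < d) (σ n₀ k₀ : ℝ) (V₀ : ℝ → ℝ) (Ω Δ : ℝ) :
    ‖WithLp.toLp 2 (idealState d σ n₀ k₀ V₀ Ω ⌊k₀ + Δ - d / 2⌋ Δ)‖ =
      √(gaussSum d σ (k₀ + Δ) / gaussSum d σ k₀) := by
  rw [← sum_norm_psiNor_sq hd σ n₀, eq_comm, Real.sqrt_eq_iff_eq_sq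
    (Finset.sum_nonneg fun _ _ => sq_nonneg _) (norm_nonneg _)]
  have h := norm_toLp_sq (idealState d σ n₀ k₀ V₀ Ω ⌊k₀ + Δ - d / 2⌋ Δ)
  rw [idealState, star_timeSum_dotProduct hd] at h
  rw [← Complex.ofReal_inj, idealState, h]
  push_cast
  refine Finset.sum_congr rfl fun j _ => ?_
  rw [RCLike.star_def, Complex.conj_mul', norm_amp]

theorem norm_toLp_clockState {d : ℕ} (hd : 0 < d) (σ n₀ k₀ : ℝ) :
    ‖WithLp.toLp 2 (clockState d σ n₀ k₀)‖ = 1 := by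
  have h := norm_toLp_idealState hd σ n₀ k₀ (fun _ => 0) 0 0
  rw [add_zero, idealState_zero, div_self (gaussSum_pos hd σ k₀).ne', Real.sqrt_one] at h
  exact h

theorem sectorState_eq {d : ℕ} (hd : 0 < d) {T₀ : ℝ} (hT₀ : 0 < T₀) (σ n₀ k₀ : ℝ) (V₀ : ℝ → ℝ)
    (t Ω : ℝ) : sectorState d σ n₀ k₀ T₀ V₀ t Ω =
      NormedSpace.exp (-((d / T₀ * t : ℝ) • sectorGen d T₀ V₀ Ω)) *ᵥ clockState d σ n₀ k₀ := by
  have hd' : (d : ℂ) ≠ 0 := by exact_mod_cast hd.ne'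
  have hT' : (T₀ : ℂ) ≠ 0 := by exact_mod_cast hT₀.ne'
  rw [sectorState, sectorGen, ← Complex.coe_smul, smul_smul, ← neg_smul]
  congr 3
  push_cast
  field_simp

theorem norm_toLp_sectorState {d : ℕ} (hd : 0 < d) {T₀ : ℝ} (hT₀ : 0 < T₀) (σ n₀ k₀ : ℝ)
    (V₀ : ℝ → ℝ) (t Ω : ℝ) : ‖WithLp.toLp 2 (sectorState d σ n₀ k₀ T₀ V₀ t Ω)‖ = 1 := by
  rw [sectorState_eq hd hT₀, norm_toLp_mulVec_of_isometry, norm_toLp_clockState hd]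
  refine exp_conjTranspose_mul_exp_of_skew ?_
  rw [Matrix.conjTranspose_neg, Matrix.conjTranspose_smul, sectorGen_conjTranspose, star_trivial,
    smul_neg]

theorem epsNor_eq (d : ℕ) (σ k₀ T₀ t : ℝ) : epsNor d σ k₀ T₀ t =
    |√(gaussSum d σ (k₀ + d / T₀ * t) / gaussSum d σ k₀) - 1| := by
  simp only [epsNor, gaussSum, sub_sub]

/-- The overlap of the ideally translated states. -/
theorem norm_phase_sub_overlap_le {d : ℕ} {V₀ : ℝ → ℝ} {b T₀ : ℝ} (hd : 0 < d)
    (hV : Continuous V₀) (hV_per : Function.Periodic V₀ (2 * Real.pi))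
    (hb : IsDerivBound (fun x => Real.pi * V₀ x) b) (σ n₀ k₀ t : ℝ) {Ω Ω' : ℝ}
    (hΩ : |Ω| ≤ Real.pi) (hΩ' : |Ω'| ≤ Real.pi) :
    ‖Complex.exp (((-((Ω - Ω') * ∫ x in (0 : ℝ)..(t * (2 * Real.pi) / T₀), V₀ x) : ℝ) : ℂ) *
        Complex.I) -
      star (idealState d σ n₀ k₀ V₀ Ω' ⌊k₀ + d / T₀ * t - d / 2⌋ (d / T₀ * t)) ⬝ᵥ
        idealState d σ n₀ k₀ V₀ Ω ⌊k₀ + d / T₀ * t - d / 2⌋ (d / T₀ * t)‖ ≤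
      |1 - gaussSum d σ (k₀ + d / T₀ * t) / gaussSum d σ k₀| + epsV d σ n₀ k₀ T₀ V₀ t := by
  set Δ := d / T₀ * t with hΔ
  set N := ⌊k₀ + Δ - d / 2⌋ with hN
  set G := ∫ x in (0 : ℝ)..(t * (2 * Real.pi) / T₀), V₀ x with hG
  set E := Complex.exp (((-((Ω - Ω') * G) : ℝ) : ℂ) * Complex.I) with hE
  -- Translated back by `Δ`, the window starts at `k₀ - d/2 + κ`, with `κ` the rounding offset of
  -- its edge.
  set κ : ℝ := N + 1 - (k₀ + Δ - d / 2) with hκ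
  have hκI : κ ∈ Set.Icc (0 : ℝ) 1 := by
    have h1 := Int.floor_le (k₀ + Δ - d / 2)
    have h2 := Int.lt_floor_add_one (k₀ + Δ - d / 2)
    rw [← hN] at h1 h2
    constructor <;> linarith
  have hx : ∀ j : ℕ, ((N + 1 + j : ℤ) : ℝ) - Δ = k₀ - d / 2 + κ + j := fun j => by
    push_cast; rw [hκ]; ring
  have hE1 : ‖E‖ = 1 := Complex.norm_exp_ofReal_mul_I _
  rw [idealState, idealState, star_timeSum_dotProduct hd]
  set J : ℕ → ℝ := fun j => ∫ z in (2 * Real.pi / d * (((N + 1 + j : ℤ) : ℝ) - Δ))..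
    (2 * Real.pi / d * ((N + 1 + j : ℤ) : ℝ)), V₀ z with hJ
  have hterm : ∀ j : ℕ, star (amp d σ n₀ k₀ V₀ Ω' Δ ((N + 1 + j : ℤ) : ℝ)) *
      amp d σ n₀ k₀ V₀ Ω Δ ((N + 1 + j : ℤ) : ℝ) =
      ((‖psiNor d σ n₀ k₀ (((N + 1 + j : ℤ) : ℝ) - Δ)‖ ^ 2 : ℝ) : ℂ) *
        Complex.exp (((-((Ω - Ω') * J j) : ℝ) : ℂ) * Complex.I) := fun j => by
    rw [amp, amp, RCLike.star_def, map_mul, mul_mul_mul_comm, Complex.conj_mul',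
      ← Complex.exp_conj, ← Complex.exp_add, Complex.ofReal_pow]
    congr 2
    simp only [map_neg, map_mul, Complex.conj_I, Complex.conj_ofReal, accPhase, hJ]
    push_cast
    ring
  have hdecomp : E - ∑ j ∈ Finset.range d, star (amp d σ n₀ k₀ V₀ Ω' Δ ((N + 1 + j : ℤ) : ℝ)) *
      amp d σ n₀ k₀ V₀ Ω Δ ((N + 1 + j : ℤ) : ℝ) =
      ((1 - gaussSum d σ (k₀ + Δ) / gaussSum d σ k₀ : ℝ) : ℂ) * E +
      ∑ j ∈ Finset.range d, ((‖psiNor d σ n₀ k₀ (((N + 1 + j : ℤ) : ℝ) - Δ)‖ ^ 2 : ℝ) : ℂ) *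
        (E - Complex.exp (((-((Ω - Ω') * J j) : ℝ) : ℂ) * Complex.I)) := by
    rw [Finset.sum_congr rfl fun j _ => hterm j]
    simp only [mul_sub, Finset.sum_sub_distrib]
    rw [← Finset.sum_mul, ← Complex.ofReal_sum, hN, sum_norm_psiNor_sq hd, Complex.ofReal_sub,
      Complex.ofReal_one]
    ring
  rw [hdecomp]
  refine (norm_add_le _ _).trans (add_le_add ?_ ?_)
  · rw [norm_mul, hE1, mul_one, Complex.norm_real, Real.norm_eq_abs]
  · refine (norm_sum_le _ _).trans (le_trans (Finset.sum_le_sum fun j _ => ?_)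
      (sum_le_epsV hV_per hb σ n₀ k₀ T₀ t hκI))
    rw [norm_mul, Complex.norm_real, Real.norm_of_nonneg (sq_nonneg _), mul_comm, hx]
    refine mul_le_mul_of_nonneg_right ?_ (sq_nonneg _)
    refine (norm_exp_mul_I_sub_le _ _).trans ?_
    rw [epsK_eq hV hd, ← hΔ, ← hG, ← hx, sub_add_cancel]
    have hJj : (∫ z in (2 * Real.pi / d * (((N + 1 + j : ℤ) : ℝ) - Δ))..
      (2 * Real.pi / d * ((N + 1 + j : ℤ) : ℝ)), V₀ z) = J j := rfl
    rw [hJj, show -((Ω - Ω') * G) - -((Ω - Ω') * J j) = -((Ω - Ω') * (G - J j)) by ring, abs_neg,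
      abs_mul]
    refine mul_le_mul_of_nonneg_right ?_ (abs_nonneg _)
    exact (abs_sub _ _).trans (by linarith)

/-- With `r` the norm of the ideal state and `e` its distance from the true one, the errors sum to
`|1 - r²| + (1 + r) e = (1 + r)(e + |r - 1|)` plus `ε_V`. Since `ε_v = e + |r - 1|`, the first part
is at most `(2 + ε_v) ε_v`. -/
theorem norm_phase_sub_sectorOverlap_le {d : ℕ} {σ n₀ T₀ b : ℝ} {V₀ : ℝ → ℝ} (k₀ : ℝ)
    (hσ : σ ∈ Set.Ioo (0 : ℝ) d) (hn₀ : n₀ ∈ Set.Ioo (0 : ℝ) ((d : ℝ) - 1)) (hT₀ : 0 < T₀)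
    (hV : ContDiff ℝ ∞ V₀) (hV_per : Function.Periodic V₀ (2 * Real.pi)) (hb0 : 0 < b)
    (hb : IsDerivBound (fun x => Real.pi * V₀ x) b) {t : ℝ} (ht : 0 ≤ t) {Ω Ω' : ℝ}
    (hΩ : |Ω| ≤ Real.pi) (hΩ' : |Ω'| ≤ Real.pi) :
    ‖Complex.exp (((-((Ω - Ω') * ∫ x in (0 : ℝ)..t, pulse T₀ V₀ x) : ℝ) : ℂ) * Complex.I) -
      star (sectorState d σ n₀ k₀ T₀ V₀ t Ω') ⬝ᵥ sectorState d σ n₀ k₀ T₀ V₀ t Ω‖ ≤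
      2 * epsv d σ n₀ k₀ T₀ b t + epsv d σ n₀ k₀ T₀ b t ^ 2 + epsV d σ n₀ k₀ T₀ V₀ t := by
  have hd : 0 < d := by exact_mod_cast hσ.1.trans hσ.2
  set Δ := d / T₀ * t with hΔ
  have hΔ0 : 0 ≤ Δ := by positivity
  have h1 := norm_evolved_sub_idealState_le k₀ hσ hn₀ hT₀ hV hV_per hb0 hb hΩ hΔ0
  have h2 := norm_evolved_sub_idealState_le k₀ hσ hn₀ hT₀ hV hV_per hb0 hb hΩ' hΔ0
  rw [hΔ, ← sectorState_eq hd hT₀, ← hΔ] at h1 h2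
  have h3 := norm_phase_sub_overlap_le (T₀ := T₀) hd hV.continuous hV_per hb σ n₀ k₀ t hΩ hΩ'
  rw [← hΔ] at h3
  have h4 := norm_star_dotProduct_sub_le
    (sectorState d σ n₀ k₀ T₀ V₀ t Ω') (sectorState d σ n₀ k₀ T₀ V₀ t Ω)
    (idealState d σ n₀ k₀ V₀ Ω' ⌊k₀ + Δ - d / 2⌋ Δ) (idealState d σ n₀ k₀ V₀ Ω ⌊k₀ + Δ - d / 2⌋ Δ)
  rw [norm_toLp_sectorState hd hT₀, norm_toLp_idealState hd, mul_one] at h4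
  have hnor := epsNor_eq d σ k₀ T₀ t
  rw [← hΔ] at hnor
  set r := √(gaussSum d σ (k₀ + Δ) / gaussSum d σ k₀) with hr
  have hr0 : 0 ≤ r := Real.sqrt_nonneg _
  have hr2 : gaussSum d σ (k₀ + Δ) / gaussSum d σ k₀ = r ^ 2 :=
    (Real.sq_sqrt (div_pos (gaussSum_pos hd _ _) (gaussSum_pos hd _ _)).le).symm
  set e := Δ * epsT d σ n₀ k₀ b + (Δ + 1) * epsStep d σ k₀ with he
  have he0 : 0 ≤ e := (norm_nonneg _).trans h1
  have hv : epsv d σ n₀ k₀ T₀ b t = e + |r - 1| := by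
    rw [epsv, hnor, abs_of_nonneg ht, he, hΔ]
    ring
  rw [integral_pulse hT₀, hv]
  rw [hr2, show 1 - r ^ 2 = -((r - 1) * (r + 1)) by ring, abs_neg, abs_mul,
    abs_of_nonneg (by linarith : 0 ≤ r + 1)] at h3
  refine (norm_sub_le_norm_sub_add_norm_sub _
    (star (idealState d σ n₀ k₀ V₀ Ω' ⌊k₀ + Δ - d / 2⌋ Δ) ⬝ᵥ
      idealState d σ n₀ k₀ V₀ Ω ⌊k₀ + Δ - d / 2⌋ Δ) _).trans ?_
  rw [norm_sub_rev (star (idealState _ _ _ _ _ _ _ _) ⬝ᵥ _)]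
  have h5 : r - 1 ≤ |r - 1| := le_abs_self _
  have h6 := abs_nonneg (r - 1)
  have h7 := mul_le_mul_of_nonneg_left h1 hr0
  nlinarith [mul_nonneg (add_nonneg he0 h6) (sub_nonneg.2 h5), mul_nonneg (add_nonneg he0 h6) he0]

end GaussianClock

/-! ### The distance between the two system states -/

theorem mainTheorem5
    (d : ℕ) (σ n₀ k₀ T₀ : ℝ)
    (hσ : σ ∈ Set.Ioo (0 : ℝ) d) (hn₀ : n₀ ∈ Set.Ioo (0 : ℝ) ((d : ℝ) - 1)) (hT₀ : 0 < T₀)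
    (V₀ : ℝ → ℝ) (hV_smooth : ContDiff ℝ ∞ V₀) (hV_per : Function.Periodic V₀ (2 * Real.pi))
    (hV_int : ∫ x in (0 : ℝ)..(2 * Real.pi), V₀ x = 1)
    (b : ℝ) (hb : GaussianClock.IsDerivBound (fun x => Real.pi * V₀ x) b)
    (ds : ℕ) (Us Hs Hint : Matrix (Fin ds) (Fin ds) ℂ)
    (hHs : Hs.IsHermitian) (hHint : Hint.IsHermitian)
    (hUs : Us = NormedSpace.exp (-Complex.I • Hint))
    (hUs_comm : Commute Us Hs) (hHint_comm : Commute Hint Hs)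
    (hspec : ∀ i, hHint.eigenvalues i ∈ Set.Ico (-Real.pi) Real.pi)
    (ρ : Matrix (Fin ds) (Fin ds) ℂ) (hρ : GaussianClock.IsState ρ)
    (t : ℝ) (ht : t ∈ Set.Icc (0 : ℝ) T₀) :
    GaussianClock.traceNorm
        (GaussianClock.pulseControlled T₀ V₀ Hs Hint ρ t -
          GaussianClock.clockControlled d σ n₀ k₀ T₀ V₀ Hs Hint ρ t) ≤
      √((ds : ℝ) * ((ρ ^ 2).trace).re) *
        (2 * GaussianClock.epsv d σ n₀ k₀ T₀ b t +
          GaussianClock.epsv d σ n₀ k₀ T₀ b t ^ 2 +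
          GaussianClock.epsV d σ n₀ k₀ T₀ V₀ t) := by

  obtain ⟨W, hWdef⟩ : ∃ W, W = (hHint.eigenvectorUnitary : Matrix (Fin ds) (Fin ds) ℂ) := ⟨_, rfl⟩
  have hW : Wᴴ * W = 1 := by
    rw [hWdef]; exact Unitary.star_mul_self_of_mem hHint.eigenvectorUnitary.2
  have hW' : W * Wᴴ = 1 := mul_eq_one_comm.1 hW
  have hb0 := GaussianClock.derivBound_pos hV_per hb hV_int
  have hΩ : ∀ i, |hHint.eigenvalues i| ≤ Real.pi := fun i =>
    abs_le.2 ⟨(hspec i).1, (hspec i).2.le⟩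
  -- Unit trace excludes the zero-dimensional system; an index is needed to see that the error bound
  -- is nonnegative.
  have hds : 0 < ds := by
    rcases Nat.eq_zero_or_pos ds with rfl | h
    · have := hρ.2
      simp [Matrix.trace] at this
    · exact h
  have hD := fun i j => GaussianClock.norm_phase_sub_sectorOverlap_le k₀ hσ hn₀ hT₀ hV_smooth
    hV_per hb0 hb ht.1 (hΩ i) (hΩ j)
  have hS : (NormedSpace.exp (-(Complex.I * (t : ℂ)) • Hs))ᴴ *
      NormedSpace.exp (-(Complex.I * (t : ℂ)) • Hs) = 1 := by
    refine GaussianClock.exp_conjTranspose_mul_exp_of_skew ?_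
    rw [Matrix.conjTranspose_smul, hHs.eq]
    simp
  rw [GaussianClock.pulseControlled_eq T₀ V₀ hHint hHs,
    GaussianClock.clockControlled_eq T₀ V₀ hHint hHs hHint_comm, ← sub_mul, ← mul_sub, ← hWdef]
  have hR : ((Wᴴ * ρ * W)ᴴ * (Wᴴ * ρ * W)).trace = (ρ ^ 2).trace := by
    rw [Matrix.conjTranspose_mul, Matrix.conjTranspose_mul, Matrix.conjTranspose_conjTranspose,
      hρ.1.1.eq, show Wᴴ * (ρ * W) * (Wᴴ * ρ * W) = Wᴴ * (ρ * (W * Wᴴ) * ρ * W) by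
        simp only [mul_assoc], hW', mul_one, Matrix.trace_mul_comm, mul_assoc, hW', mul_one,
      sq]
  rw [← hR]
  refine GaussianClock.traceNorm_conj_le ?_ ((norm_nonneg _).trans (hD ⟨0, hds⟩ ⟨0, hds⟩))
    fun i j => ?_
  · rw [Matrix.conjTranspose_mul, show ∀ A B C D : Matrix (Fin ds) (Fin ds) ℂ,
      A * B * (C * D) = A * (B * C) * D from fun A B C D => by simp only [mul_assoc], hS, mul_one,
      hW]
  · rw [Matrix.sub_apply, Matrix.of_apply, Matrix.of_apply, ← mul_sub, norm_mul, mul_comm]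
    exact mul_le_mul_of_nonneg_right (hD i j) (norm_nonneg _)
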